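/- **Setting.** Let $\Sigma$ be a finite nonempty alphabet. A timed word is a finite sequence $(t_1\cdot a_1)\cdots(t_k\cdot a_k)$ with $t_i\in\mathbb{R}_{\ge 0}$, $a_i\in\Sigma$; it is half-integral if every $t_i\in\frac12\mathbb{N}$; $\mathcal{HI}$ is the set of half-integral words. A 1-DTA is a deterministic one-clock timed automaton (guards: conjunctions of $c<x$, $x=c$, $x<c$ with $c\in\mathbb{N}$; each transition resets the clock or keeps it). Let $L$ be a language accepted by some 1-DTA, and let $K_L$ be the least maximum constant of a 1-DTA accepting $L$. A reset function is a map $R$ from timed words to $\mathbb{R}_{\ge0}$ with $R(\epsilon)=0$ and $R(u(t\cdot a))\in\{0,R(u)+t\}$. The syntactic reset function $\mathbf{R}^L$ is the one with $\mathbf{R}^L(u(t\cdot a))=0$ if $(u(t\cdot a))^{-1}L$ is accepted by a 1-DTA, and $\mathbf{R}^L(u(t\cdot a))=\mathbf{R}^L(u)+t$ otherwise. For $u,v\in\mathcal{HI}$ put $u\approx^L v$ iff $\mathbf{R}^L(u)=\mathbf{R}^L(v)$ and $u^{-1}L=v^{-1}L$; let $n$ be the number of classes of $\approx^L$. For $x\ge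 0$ let $\mathit{hi}(x)=x$ if $x\in\mathbb{N}$ and $\lfloor x\rfloor+\frac12$ otherwise. The normal form of a timed word under $R$ is given by $N^R(\epsilon)=\epsilon$ and $N^R(u(t\cdot a))=N^R(u)(t'\cdot a)$, $t'=\mathit{hi}(R(u)+t)-\mathit{hi}(R(u))$; the possible normal forms of $w$ are the words $N^R(w)$, $R$ a reset function. The $K$-regions are $\{c\}$ ($0\le c\le K$), $(c,c+1)$ ($0\le c<K$) and $(K,\infty)$. A strict $K$-acceptor is a complete 1-DTA with maximum constant $K$ whose guards are $K$-regions, in which every state $q$ carries a $K$-region containing the clock value of every run arriving in $q$ (if some transition into $q$ resets, all do and the region is $\{0\}$; otherwise all transitions into $q$ have the region of $q$ as guard), and in which every transition with guard $x=c$ resets the clock. **Observation tables.** An observation table is $\mathcal{T}=(K,S,E,T)$ with $K\in\mathbb{N}$, finite $S,E\subseteq\mathcal{HI}$ containing $\epsilon$, $S$ prefix-closed, $E$ suffix-closed, and $T=(T_1,r)$ on $(S\cup S\Sigma_K)\times E$, where $\Sigma_K=\{0,\frac12,\dots,K,K+\frac12\}\times\Sigma$; $T_1(s,e)\in\{0,1\}$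 says whether $se\in L$ (filled by membership queries), and $r$ is a possible reset assignment: $r(s,e)=R(se)$ for all cells, for some reset function $R$ taking no strictly positive integer value. Write $\mathit{row}(s)=T(s,\cdot)$ and $r(s)=r(s,\epsilon)$. $\mathcal{T}$ is closed if every $\mathit{row}(w)$, $w\in S\Sigma_K$, equals some $\mathit{row}(s)$, $s\in S$; consistent if (a) $\mathit{row}(s_1)=\mathit{row}(s_2)$ implies $\mathit{row}(s_1p)=\mathit{row}(s_2p)$ for $s_1,s_2\in S$, $p\in\Sigma_K$, and (b) $r(s)+t>K$ implies $\mathit{row}(s(t\cdot a))=\mathit{row}(s(K+\frac12\cdot a))$ whenever $s(t\cdot a)\in S\cup S\Sigma_K$; valid if $r\le K$ everywhere. The conjecture $\mathcal{A}_{\mathcal T}$ has states $\mathit{row}(s)$, $s\in S$, initial state $\mathit{row}(\epsilon)$, final states those with $T_1(s,\epsilon)=1$, and, whenever $s,s'\in S$, $(t\cdot a)\in\Sigma_K$ and $\mathit{row}(s(t\cdot a))=\mathit{row}(s')$, an $a$-transition from $\mathit{row}(s)$ to $\mathit{row}(s')$ whose guard is the $K$-region of $r(s)+t$ and which resets iff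 $r(s')=0$. **The Normal Teacher algorithm.** The pool $P_0$ consists of all tables with $K=0$, $S=E=\{\epsilon\}$, one for each possible reset assignment (their common cells are filled once, with one membership query each). The tables of $P_i$ are removed and processed one after the other, in any order; once $P_i$ is empty the algorithm goes on with $P_{i+1}$. Processing $\mathcal{T}$ means: - If $\mathcal{T}$ is not closed, consistent and valid, apply one applicable action: (1) add to $S$ some $w\in S\Sigma_K$ whose row is not the row of any $s\in S$; (2) add to $E$ a word $pe$ where $\mathit{row}(s_1)=\mathit{row}(s_2)$ but $T(s_1p,e)\ne T(s_2p,e)$ for some $s_1,s_2\in S$, $p\in\Sigma_K$, $e\in E$; (3) if (b) fails, or (4) if some $r(s,e)>K$, increase $K$ by one. - Otherwise ask whether $\mathcal{A}_{\mathcal T}$ accepts exactly $L$. If so, return $\mathcal{A}_{\mathcal T}$ and halt. If not, the Teacher returns an arbitrary counterexample $w$, and all prefixes of all possible normal forms of $w$ are added to $S$. After an action or a counterexample, one membership query is asked for each new cell, and one copy of the extended table for each possible reset assignment extending that of $\mathcal{T}$ is put into $P_{i+1}$. **Theorem.** Whatever the choices of the Learner and the counterexamples of the Teacher, the Normal Teacher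 algorithm terminates and returns, for some $K\ge K_L$, a strict $K$-acceptor accepting $L$ whose reset function (the clock value after each timed word) takes values in $[0,K]\setminus\mathbb{N}_{>0}$. Moreover, with $H=K_L+n$ and $m$ the maximum of $1$ and the length of the longest counterexample received, it processes $$O\bigl(2^{H^3 m 2^m|\Sigma|}\,H\bigr)$$ observation tables and asks $$O\bigl(2^{H^3 m 2^m|\Sigma|}\,H^3 m 2^m|\Sigma|\bigr)$$ membership queries, where the constants in $O(\cdot)$ are absolute. -/

import Mathlib

open scoped NNReal

universe u

/-! ### Timed words and residuals -/

/-- A timed word `(t₁·a₁)⋯(tₖ·aₖ)`: a finite sequence of pairs (delay, letter). -/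
abbrev TimedWord (α : Type u) : Type u := List (ℝ≥0 × α)

/-- The residual language `u⁻¹L`. -/
def residualLang {α : Type u} (L : Set (TimedWord α)) (u : TimedWord α) : Set (TimedWord α) :=
  {w | u ++ w ∈ L}

/-! ### Clock constraints and one-clock timed automata -/

/-- Clock constraints `c < x`, `x = c`, `x < c` and conjunctions, with `c` a natural number. -/
inductive ClockConstraint : Type
  | gt (c : ℕ) : ClockConstraint
  | eq (c : ℕ) : ClockConstraint
  | lt (c : ℕ) : ClockConstraint
  | and (φ ψ : ClockConstraint) : ClockConstraint

/-- The set of clock values satisfying a constraint. -/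
def ClockConstraint.denote : ClockConstraint → Set ℝ≥0
  | .gt c => {x | (c : ℝ≥0) < x}
  | .eq c => {x | x = (c : ℝ≥0)}
  | .lt c => {x | x < (c : ℝ≥0)}
  | .and φ ψ => φ.denote ∩ ψ.denote

/-- The largest constant that occurs in a constraint. -/
def ClockConstraint.maxConst : ClockConstraint → ℕ
  | .gt c => c
  | .eq c => c
  | .lt c => c
  | .and φ ψ => max φ.maxConst ψ.maxConst

/-- A transition `(q, q', a, φ, r)`; `keep = false` means that the clock is reset (`r = 0`),
`keep = true` that it is not (`r = 1`). -/
structure ClockTransition (α : Type u) (Q : Type u) : Type u where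
  src : Q
  tgt : Q
  letter : α
  guard : ClockConstraint
  keep : Bool

/-- A one-clock timed automaton over `α`. -/
structure OneTA (α : Type u) : Type (u + 1) where
  Q : Type u
  finite_Q : Finite Q
  init : Q
  trans : Set (ClockTransition α Q)
  finite_trans : trans.Finite
  final : Set Q

namespace OneTA

variable {α : Type u}

/-- `A.Run q ν w θs q' ν'`: the sequence of transitions `θs` is a run of `A` on `w`
from the configuration `(q, ν)` to the configuration `(q', ν')`. -/
inductive Run (A : OneTA α) :
    A.Q → ℝ≥0 → TimedWord α → List (ClockTransition α A.Q) → A.Q → ℝ≥0 → Prop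
  | nil (q : A.Q) (ν : ℝ≥0) : Run A q ν [] [] q ν
  | cons (θ : ClockTransition α A.Q) (ν t : ℝ≥0) (w : TimedWord α)
      (θs : List (ClockTransition α A.Q)) (q' : A.Q) (ν' : ℝ≥0)
      (hθ : θ ∈ A.trans) (hguard : ν + t ∈ θ.guard.denote)
      (hrun : Run A θ.tgt (if θ.keep then ν + t else 0) w θs q' ν') :
      Run A θ.src ν ((t, θ.letter) :: w) (θ :: θs) q' ν'

/-- The language of `A`: the timed words with an accepting run from the initial configuration. -/
def lang (A : OneTA α) : Set (TimedWord α) :=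
  {w | ∃ θs q ν, A.Run A.init 0 w θs q ν ∧ q ∈ A.final}

def IsDeterministic (A : OneTA α) : Prop :=
  ∀ θ ∈ A.trans, ∀ θ₁ ∈ A.trans, θ ≠ θ₁ →
    θ.src ≠ θ₁.src ∨ θ.letter ≠ θ₁.letter ∨ Disjoint θ.guard.denote θ₁.guard.denote

/-- Every timed word has exactly one run from the initial configuration. -/
def IsComplete (A : OneTA α) : Prop :=
  ∀ w : TimedWord α, ∃! θs : List (ClockTransition α A.Q), ∃ q ν, A.Run A.init 0 w θs q ν

/-- The largest constant that occurs in the transitions of `A` (`0` if there are none). -/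
noncomputable def maxConst (A : OneTA α) : ℕ :=
  sSup ((fun θ => θ.guard.maxConst) '' A.trans)

end OneTA

/-- `L` is the language of some 1-DTA. -/
def IsDTARecognizable {α : Type u} (L : Set (TimedWord α)) : Prop :=
  ∃ A : OneTA α, A.IsDeterministic ∧ A.lang = L

/-- `K_L`: the smallest maximum constant of a 1-DTA that accepts `L`. -/
noncomputable def minConst {α : Type u} (L : Set (TimedWord α)) : ℕ :=
  sInf {K | ∃ A : OneTA α, A.IsDeterministic ∧ A.maxConst = K ∧ A.lang = L}

/-! ### Regions, acceptors, strictness -/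

/-- Region equivalence `y ≡ z`: same integral part, and the fractional parts vanish together. -/
def RegionEquiv (y z : ℝ≥0) : Prop :=
  ⌊y⌋₊ = ⌊z⌋₊ ∧ ((⌊y⌋₊ : ℝ≥0) = y ↔ (⌊z⌋₊ : ℝ≥0) = z)

/-- Region equivalence with respect to the constant `K`. -/
def KRegionEquiv (K : ℕ) (y z : ℝ≥0) : Prop :=
  RegionEquiv y z ∨ ((K : ℝ≥0) < y ∧ (K : ℝ≥0) < z)

/-- `X` is a `K`-region, i.e. a class of `KRegionEquiv K`. -/
def IsKRegion (K : ℕ) (X : Set ℝ≥0) : Prop :=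
  ∃ y : ℝ≥0, X = {z | KRegionEquiv K y z}

/-- A `K`-acceptor: a complete 1-DTA of maximum constant `K` whose guards are `K`-regions and whose
states carry a `K`-region such that every word reaching a state arrives with a clock value in its
region; syntactically, if some transition into `q` resets the clock then all of them do and the
region of `q` is `{0}`, and otherwise all of them have the region of `q` as guard. -/
structure OneTA.IsAcceptor {α : Type u} (K : ℕ) (A : OneTA α) : Prop where
  det : A.IsDeterministic
  complete : A.IsComplete
  maxConst_eq : A.maxConst = K
  guard_region : ∀ θ ∈ A.trans, IsKRegion K θ.guard.denote
  region : ∃ reg : A.Q → Set ℝ≥0,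
    (∀ q, IsKRegion K (reg q)) ∧
    (∀ w θs q ν, A.Run A.init 0 w θs q ν → ν ∈ reg q) ∧
    (∀ q, (∃ θ ∈ A.trans, θ.tgt = q ∧ θ.keep = false) →
      reg q = {0} ∧ ∀ θ ∈ A.trans, θ.tgt = q → θ.keep = false) ∧
    (∀ q, (∀ θ ∈ A.trans, θ.tgt = q → θ.keep = true) →
      ∀ θ ∈ A.trans, θ.tgt = q → θ.guard.denote = reg q)

/-- A strict `K`-acceptor: every transition with an equality guard `x = c` resets the clock. -/
structure OneTA.IsStrictAcceptor {α : Type u} (K : ℕ) (A : OneTA α) : Prop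
    extends OneTA.IsAcceptor K A where
  strict : ∀ θ ∈ A.trans, ∀ c : ℕ, θ.guard.denote = {(c : ℝ≥0)} → θ.keep = false

/-! ### Reset functions, half-integral words, normal forms -/

/-- `x` is a strictly positive integer. -/
def IsPosInt (x : ℝ≥0) : Prop := ∃ k : ℕ, 0 < k ∧ x = (k : ℝ≥0)

structure IsResetFunction {α : Type u} (R : TimedWord α → ℝ≥0) : Prop where
  nil : R [] = 0
  snoc : ∀ (u : TimedWord α) (t : ℝ≥0) (a : α), R (u ++ [(t, a)]) = 0 ∨ R (u ++ [(t, a)]) = R u + t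

/-- A reset function that takes no strictly positive integral value. -/
structure IsStrictResetFunction {α : Type u} (R : TimedWord α → ℝ≥0) : Prop
    extends IsResetFunction R where
  not_posInt : ∀ u, ¬ IsPosInt (R u)

open Classical in
/-- Auxiliary to `resetBy`: `pre` is the part already read, with clock value `v`. -/
noncomputable def resetByAux {α : Type u} (P : TimedWord α → Prop) :
    TimedWord α → ℝ≥0 → TimedWord α → ℝ≥0
  | _, v, [] => v
  | pre, v, (t, a) :: w =>
      resetByAux P (pre ++ [(t, a)]) (if P (pre ++ [(t, a)]) then 0 else v + t) w

/-- The clock value after a word when the clock is reset exactly after the nonempty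
prefixes that satisfy `P`. -/
noncomputable def resetBy {α : Type u} (P : TimedWord α → Prop) (w : TimedWord α) : ℝ≥0 :=
  resetByAux P [] 0 w

/-- The syntactic reset function `R^L`; see `synReset_nil` and `synReset_snoc`. -/
noncomputable def synReset {α : Type u} (L : Set (TimedWord α)) : TimedWord α → ℝ≥0 :=
  resetBy (fun w => IsDTARecognizable (residualLang L w))

open Classical in
theorem resetByAux_snoc {α : Type u} (P : TimedWord α → Prop) (w : TimedWord α) (t : ℝ≥0) (a : α) :
    ∀ (pre : TimedWord α) (v : ℝ≥0), resetByAux P pre v (w ++ [(t, a)]) =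
      if P (pre ++ w ++ [(t, a)]) then 0 else resetByAux P pre v w + t := by
  induction w with
  | nil => intro pre v; simp [resetByAux]
  | cons p w ih =>
      intro pre v
      obtain ⟨s, b⟩ := p
      simp [resetByAux, ih]

theorem synReset_nil {α : Type u} (L : Set (TimedWord α)) : synReset L [] = 0 := rfl

open Classical in
theorem synReset_snoc {α : Type u} (L : Set (TimedWord α)) (w : TimedWord α) (t : ℝ≥0) (a : α) :
    synReset L (w ++ [(t, a)]) =
      if IsDTARecognizable (residualLang L (w ++ [(t, a)])) then 0 else synReset L w + t := by
  simp only [synReset, resetBy, resetByAux_snoc, List.nil_append]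

/-- `x = k/2` for some natural number `k`. -/
def IsHalfInt (x : ℝ≥0) : Prop := ∃ k : ℕ, x = (k : ℝ≥0) / 2

/-- Half-integral timed words. -/
def IsHIWord {α : Type u} (w : TimedWord α) : Prop := ∀ p ∈ w, IsHalfInt p.1

open Classical in
/-- The half-integral value region equivalent to `x`. -/
noncomputable def hi (x : ℝ≥0) : ℝ≥0 :=
  if (⌊x⌋₊ : ℝ≥0) = x then x else (⌊x⌋₊ : ℝ≥0) + 1 / 2

/-- Auxiliary to `normalForm`: `pre` is the part already read. The new delay `t'` is the one with
`hi (R pre) + t' = hi (R pre + t)`; as `hi` is monotone, the subtraction does not truncate. -/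
noncomputable def normalFormAux {α : Type u} (R : TimedWord α → ℝ≥0) :
    TimedWord α → TimedWord α → TimedWord α
  | _, [] => []
  | pre, (t, a) :: w => (hi (R pre + t) - hi (R pre), a) :: normalFormAux R (pre ++ [(t, a)]) w

/-- The normal form `N^R(w)`. -/
noncomputable def normalForm {α : Type u} (R : TimedWord α → ℝ≥0) (w : TimedWord α) :
    TimedWord α :=
  normalFormAux R [] w

/-- All possible normal forms of `w`. -/
def normalForms {α : Type u} (w : TimedWord α) : Set (TimedWord α) :=
  {v | ∃ R : TimedWord α → ℝ≥0, IsResetFunction R ∧ v = normalForm R w}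

/-- The equivalence `≈^L` on half-integral words. -/
def synSetoid {α : Type u} (L : Set (TimedWord α)) : Setoid {w : TimedWord α // IsHIWord w} where
  r v w := synReset L v = synReset L w ∧ residualLang L v = residualLang L w
  iseqv := ⟨fun _ => ⟨rfl, rfl⟩, fun h => ⟨h.1.symm, h.2.symm⟩,
    fun h h' => ⟨h.1.trans h'.1, h.2.trans h'.2⟩⟩

/-- The number of classes of `≈^L`. -/
noncomputable def synIndex {α : Type u} (L : Set (TimedWord α)) : ℕ :=
  Nat.card (Quotient (synSetoid L))

/-! ### Observation tables -/

/-- `Σ_K = {0, 1/2, …, K, K + 1/2} × Σ`. -/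
def sigmaK (α : Type u) (K : ℕ) : Set (ℝ≥0 × α) :=
  {p | IsHalfInt p.1 ∧ p.1 < (K : ℝ≥0) + 1}

/-- The one letter extensions `S Σ_K`. -/
def extensions {α : Type u} (K : ℕ) (S : Set (TimedWord α)) : Set (TimedWord α) :=
  {w | ∃ s ∈ S, ∃ p ∈ sigmaK α K, w = s ++ [p]}

/-- The cells `(S ∪ S Σ_K) × E` of a table. -/
def cells {α : Type u} (K : ℕ) (S E : Set (TimedWord α)) : Set (TimedWord α × TimedWord α) :=
  (S ∪ extensions K S) ×ˢ E

/-- An observation table. `entry s e` is the content of the cell `(s, e)`; it is meaningful on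
`cells K S E` only, and is fixed to a default value elsewhere, so that two tables are equal as soon
as they have the same `K`, `S`, `E` and the same contents. -/
structure ObsTable (α : Type u) : Type u where
  K : ℕ
  S : Set (TimedWord α)
  E : Set (TimedWord α)
  entry : TimedWord α → TimedWord α → Bool × ℝ≥0
  finite_S : S.Finite
  finite_E : E.Finite
  nil_mem_S : [] ∈ S
  nil_mem_E : [] ∈ E
  hi_S : ∀ s ∈ S, IsHIWord s
  hi_E : ∀ e ∈ E, IsHIWord e
  prefix_S : ∀ s ∈ S, ∀ v, v <+: s → v ∈ S
  suffix_E : ∀ e ∈ E, ∀ v, v <:+ e → v ∈ E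
  range_entry : ∀ s e, (s, e) ∈ cells K S E →
    IsHalfInt (entry s e).2 ∧ ¬ IsPosInt (entry s e).2
  entry_default : ∀ s e, (s, e) ∉ cells K S E → entry s e = (false, 0)

/-- The constraint `φ_K(t)` denoting the `K`-region of `t`. -/
noncomputable def regionGuard (K : ℕ) (t : ℝ≥0) : ClockConstraint :=
  open Classical in
  if t ≤ (K : ℝ≥0) then
    if (⌊t⌋₊ : ℝ≥0) = t then .eq ⌊t⌋₊ else .and (.gt ⌊t⌋₊) (.lt ⌈t⌉₊)
  else .gt K

theorem sigmaK_finite (α : Type u) [Finite α] (K : ℕ) : (sigmaK α K).Finite := by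
  refine Set.Finite.subset
    (((Set.finite_lt_nat (2 * (K + 1))).image fun k : ℕ => (k : ℝ≥0) / 2).prod
      (Set.finite_univ (α := α))) ?_
  rintro ⟨t, a⟩ ⟨⟨k, hk⟩, hlt⟩
  refine ⟨⟨k, ?_, hk.symm⟩, Set.mem_univ _⟩
  simp only at hk hlt
  rw [hk, div_lt_iff₀ (by norm_num)] at hlt
  have : (k : ℝ≥0) < ((2 * (K + 1) : ℕ) : ℝ≥0) := by
    push_cast
    rwa [mul_comm]
  exact_mod_cast this

namespace ObsTable

variable {α : Type u}

/-- The row of `s`. -/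
def row (T : ObsTable α) (s : TimedWord α) : T.E → Bool × ℝ≥0 := fun e => T.entry s e

/-- `r(s) = r(s, ε)`, where `r` is the reset assignment of `T`. -/
def r (T : ObsTable α) (s : TimedWord α) : ℝ≥0 := (T.entry s []).2

def Closed (T : ObsTable α) : Prop :=
  ∀ w ∈ extensions T.K T.S, ∃ s ∈ T.S, T.row w = T.row s

def ConsistentA (T : ObsTable α) : Prop :=
  ∀ s₁ ∈ T.S, ∀ s₂ ∈ T.S, T.row s₁ = T.row s₂ →
    ∀ p ∈ sigmaK α T.K, T.row (s₁ ++ [p]) = T.row (s₂ ++ [p])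

def ConsistentB (T : ObsTable α) : Prop :=
  ∀ (s : TimedWord α) (t : ℝ≥0) (a : α), s ++ [(t, a)] ∈ T.S ∪ extensions T.K T.S →
    (T.K : ℝ≥0) < T.r s + t →
      T.row (s ++ [(t, a)]) = T.row (s ++ [((T.K : ℝ≥0) + 1 / 2, a)])

/-- The reset assignment has range in `[0, K]` (it never takes a positive integral value). -/
def Valid (T : ObsTable α) : Prop :=
  ∀ s e, (s, e) ∈ cells T.K T.S T.E → (T.entry s e).2 ≤ (T.K : ℝ≥0)

/-- Closed, consistent and valid. -/
def Ready (T : ObsTable α) : Prop :=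
  T.Closed ∧ T.ConsistentA ∧ T.ConsistentB ∧ T.Valid

open Classical in
/-- The conjecture `A_T`. -/
noncomputable def conj [Finite α] (T : ObsTable α) : OneTA α where
  Q := T.row '' T.S
  finite_Q := (T.finite_S.image T.row).to_subtype
  init := ⟨T.row [], Set.mem_image_of_mem _ T.nil_mem_S⟩
  trans := {θ | ∃ s ∈ T.S, ∃ s' ∈ T.S, ∃ p ∈ sigmaK α T.K,
    T.row (s ++ [p]) = T.row s' ∧
    θ.src.1 = T.row s ∧ θ.tgt.1 = T.row s' ∧ θ.letter = p.2 ∧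
    θ.guard = regionGuard T.K (T.r s + p.1) ∧ θ.keep = !decide (T.r s' = 0)}
  finite_trans := by
    have : Finite (T.S) := T.finite_S.to_subtype
    have : Finite (sigmaK α T.K) := (sigmaK_finite α T.K).to_subtype
    refine Set.Finite.subset (Set.finite_range
      (fun x : T.S × T.S × sigmaK α T.K =>
        (⟨⟨T.row x.1, Set.mem_image_of_mem _ x.1.2⟩, ⟨T.row x.2.1, Set.mem_image_of_mem _ x.2.1.2⟩,
          x.2.2.1.2, regionGuard T.K (T.r x.1 + x.2.2.1.1), !decide (T.r x.2.1 = 0)⟩ :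
          ClockTransition α (T.row '' T.S)))) ?_
    rintro ⟨⟨q, hq⟩, ⟨q', hq'⟩, a, g, d⟩ ⟨s, hs, s', hs', p, hp, -, h1, h2, h3, h4, h5⟩
    refine ⟨⟨⟨s, hs⟩, ⟨s', hs'⟩, ⟨p, hp⟩⟩, ?_⟩
    simp only at h1 h2 h3 h4 h5
    subst h1 h2 h3 h4 h5
    rfl
  final := {q | (q.1 ⟨[], T.nil_mem_E⟩).1 = true}

/-- `T.Action K' S' E'`: one of the four actions of the processing procedure applies to `T`, and
turns the parameters `(K, S, E)` of `T` into `(K', S', E')`. -/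
inductive Action (T : ObsTable α) : ℕ → Set (TimedWord α) → Set (TimedWord α) → Prop
  | close (w : TimedWord α) (hw : w ∈ extensions T.K T.S)
      (hne : ∀ s ∈ T.S, T.row w ≠ T.row s) :
      Action T T.K (T.S ∪ {w}) T.E
  | distinguish (s₁ s₂ : TimedWord α) (p : ℝ≥0 × α) (e : TimedWord α)
      (hs₁ : s₁ ∈ T.S) (hs₂ : s₂ ∈ T.S) (hp : p ∈ sigmaK α T.K) (he : e ∈ T.E)
      (hrow : T.row s₁ = T.row s₂) (hne : T.entry (s₁ ++ [p]) e ≠ T.entry (s₂ ++ [p]) e) :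
      Action T T.K T.S (T.E ∪ {p :: e})
  | enlarge (h : ¬ T.ConsistentB) : Action T (T.K + 1) T.S T.E
  | validate (s e : TimedWord α) (hse : (s, e) ∈ cells T.K T.S T.E)
      (h : (T.K : ℝ≥0) < (T.entry s e).2) :
      Action T (T.K + 1) T.S T.E

/-- The first components of the entries of `T` are the answers to the membership queries for `L`,
and the second components form a possible reset assignment, that is, the values on the words `se`
of some reset function without positive integral values. -/
def Filled (L : Set (TimedWord α)) (T : ObsTable α) : Prop :=
  (∀ s e, (s, e) ∈ cells T.K T.S T.E → ((T.entry s e).1 = true ↔ s ++ e ∈ L)) ∧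
  ∃ R : TimedWord α → ℝ≥0, IsStrictResetFunction R ∧
    ∀ s e, (s, e) ∈ cells T.K T.S T.E → (T.entry s e).2 = R (s ++ e)

/-- The tables with parameters `(K', S', E')`, one for each possible reset assignment that extends
the one of `T`. -/
def copies (L : Set (TimedWord α)) (T : ObsTable α) (K' : ℕ) (S' E' : Set (TimedWord α)) :
    Set (ObsTable α) :=
  {T' | T'.K = K' ∧ T'.S = S' ∧ T'.E = E' ∧ T'.Filled L ∧
    ∀ s e, (s, e) ∈ cells T.K T.S T.E → T'.entry s e = T.entry s e}

/-- The cells that are new in a table with parameters `(K', S', E')` built from `T`. -/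
def newCells (T : ObsTable α) (K' : ℕ) (S' E' : Set (TimedWord α)) :
    Set (TimedWord α × TimedWord α) :=
  cells K' S' E' \ cells T.K T.S T.E

/-- The row words after processing the counterexample `w`: all prefixes of all possible normal
forms of `w` are added. -/
def refineRows (T : ObsTable α) (w : TimedWord α) : Set (TimedWord α) :=
  T.S ∪ {v | ∃ x ∈ normalForms w, v <+: x}

end ObsTable

/-! ### The Normal Teacher algorithm -/

/-- A state of the algorithm: the tables of the current pool `P_i` that remain to be processed, the
part of `P_{i+1}` built so far, the number of tables processed, the number of membership queries
asked, the length of the longest counterexample received (`0` if none), and the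
automaton returned, if any. -/
structure LearnState (α : Type u) : Type (u + 1) where
  pool : Set (ObsTable α)
  next : Set (ObsTable α)
  processed : ℕ
  queries : ℕ∞
  longest : ℕ
  result : Option (OneTA α)

/-- The initial state: the pool `P₀` holds one table with `K = 0` and `S = E = {ε}` for each
possible reset assignment; one membership query has been asked for each cell. -/
noncomputable def LearnState.initial {α : Type u} (L : Set (TimedWord α)) : LearnState α where
  pool := {T | T.K = 0 ∧ T.S = {[]} ∧ T.E = {[]} ∧ T.Filled L}
  next := ∅
  processed := 0
  queries := (cells (α := α) 0 {[]} {[]}).encard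
  longest := 0
  result := none

/-- One step of the algorithm for the unknown language `L`. All choices are left open: the
table picked in the pool, the action applied to it, and the counterexample of the Teacher. -/
inductive LearnStep {α : Type u} [Finite α] (L : Set (TimedWord α)) :
    LearnState α → LearnState α → Prop
  /-- A table that is not closed, consistent and valid is processed by a single action. -/
  | act (st : LearnState α) (hres : st.result = none) (T : ObsTable α) (hT : T ∈ st.pool)
      (hready : ¬ T.Ready) (K' : ℕ) (S' E' : Set (TimedWord α)) (haction : T.Action K' S' E') :
      LearnStep L st
        { pool := st.pool \ {T}
          next := st.next ∪ T.copies L K' S' E'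
          processed := st.processed + 1
          queries := st.queries + (T.newCells K' S' E').encard
          longest := st.longest
          result := none }
  /-- The Teacher refutes the conjecture with the counterexample `w`. -/
  | refute (st : LearnState α) (hres : st.result = none) (T : ObsTable α) (hT : T ∈ st.pool)
      (hready : T.Ready) (w : TimedWord α) (hw : ¬ (w ∈ T.conj.lang ↔ w ∈ L)) :
      LearnStep L st
        { pool := st.pool \ {T}
          next := st.next ∪ T.copies L T.K (T.refineRows w) T.E
          processed := st.processed + 1
          queries := st.queries + (T.newCells T.K (T.refineRows w) T.E).encard
          longest := max st.longest w.length
          result := none }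
  /-- The Teacher confirms the conjecture, which is returned. -/
  | confirm (st : LearnState α) (hres : st.result = none) (T : ObsTable α) (hT : T ∈ st.pool)
      (hready : T.Ready) (hL : T.conj.lang = L) :
      LearnStep L st
        { pool := st.pool \ {T}
          next := st.next
          processed := st.processed + 1
          queries := st.queries
          longest := st.longest
          result := some T.conj }
  /-- The current pool is exhausted, and the next one takes its place. -/
  | advance (st : LearnState α) (hres : st.result = none) (hpool : st.pool = ∅) :
      LearnStep L st { st with pool := st.next, next := ∅ }

/-! ### Regions -/

/-! Every 1-DTA can be made strict without raising its constant: reset the clock at integral values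
and above `K`, and remember in the state what was subtracted (`RegionMachine.strictify`). The heart
of the proof is `RegionMachine.rigid`. Take two configurations of strict machines with the same
language, whose clock values do not differ by an integer. As a function of the first delay,
acceptance is locally constant, because at each instant one of the two clocks is nonintegral and its
machine meets no region border nearby. The half-line is connected, so acceptance does not depend on
that delay at all, and the language does not change when the clock value moves within its region.

A 1-DTA starts at clock value 0. So rigidity applies whenever a residual is recognizable although a
strict machine arrives with a nonintegral clock value. Hence `synReset L` follows the clock of every
strict machine for `L`, except where it is 0 because the clock has become useless
(`RegionMachine.synReset_eq_or`). It is therefore bounded by `minConst L`, takes no positive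
integral value, has finitely many classes of `≈^L`, and its normal form preserves membership.

Termination: until an automaton is returned, some table waiting in the pools is filled with
`synReset L`. Its level, the constant plus the number of distinct rows, is at most `H`. An action
raises the level. A counterexample does not lower it, and leaves a table that is not ready
(`ObsTable.IsSyntactic.not_ready_of_counterexample`), so that an action must follow. Hence round `i`
satisfies `i + 2 ≤ 2 * H`. The returned automaton needs no syntactic table: the conjecture of every
filled and ready table is a strict acceptor.

Complexity: two strict reset functions that are nonzero on the same half-integral word agree there,
so a new cell has at most two fillings. Give a table with `N` cells the weight `2⁻ᴺ`. The copies of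
a table together weigh no more than the table, so a pool weighs at most 1, and at most `2ᴰ` tables
with at most `D` cells are processed per round. The bound on `D` comes from the inequality between
the arithmetic and geometric means, and it leaves enough room to absorb the number of rounds. -/

theorem kRegionEquiv_iff {K : ℕ} {y z : ℝ≥0} :
    KRegionEquiv K y z ↔ ∀ c : ℕ, c ≤ K → (y < c ↔ z < c) ∧ (y = c ↔ z = c) := by
  constructor
  · rintro (⟨h1, h2⟩ | ⟨h1, h2⟩) c hc
    · constructor
      · rw [← Nat.floor_lt zero_le, ← Nat.floor_lt zero_le, h1]
      · constructor
        · rintro rfl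
          simp only [Nat.floor_natCast, true_iff] at h1 h2
          rw [← h2, ← h1]
        · rintro rfl
          simp only [Nat.floor_natCast, iff_true] at h1 h2
          rw [← h2, ← h1]
    · have hcK : (c : ℝ≥0) ≤ K := by exact_mod_cast hc
      have h3 := lt_of_le_of_lt hcK h1
      have h4 := lt_of_le_of_lt hcK h2
      exact ⟨iff_of_false h3.not_gt h4.not_gt, iff_of_false h3.ne' h4.ne'⟩
  · intro h
    by_cases hy : (K : ℝ≥0) < y
    · right
      obtain ⟨h1, h2⟩ := h K le_rfl
      refine ⟨hy, lt_of_le_of_ne (not_lt.1 fun h3 => ?_) fun h3 => ?_⟩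
      · exact absurd (h1.2 h3) (not_lt.2 hy.le)
      · exact hy.ne' (h2.2 h3.symm)
    · left
      rw [not_lt] at hy
      have hn : (⌊y⌋₊ : ℝ≥0) ≤ y := Nat.floor_le zero_le
      have hnK : ⌊y⌋₊ ≤ K := by exact_mod_cast hn.trans hy
      obtain ⟨h1, h2⟩ := h _ hnK
      by_cases hyn : y = (⌊y⌋₊ : ℝ≥0)
      · have hz := h2.1 hyn
        have : ⌊z⌋₊ = ⌊y⌋₊ := by rw [hz, Nat.floor_natCast]
        exact ⟨this.symm, by rw [this]; exact ⟨fun _ => hz.symm, fun _ => hyn.symm⟩⟩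
      · have hlt : (⌊y⌋₊ : ℝ≥0) < K := lt_of_lt_of_le (lt_of_le_of_ne hn (Ne.symm hyn)) hy
        have hnK' : ⌊y⌋₊ + 1 ≤ K := by
          have : ⌊y⌋₊ < K := by exact_mod_cast hlt
          exact this
        obtain ⟨h3, -⟩ := h _ hnK'
        have hz1 : z < ((⌊y⌋₊ + 1 : ℕ) : ℝ≥0) := h3.1 (by push_cast; exact Nat.lt_floor_add_one y)
        have hz0 : (⌊y⌋₊ : ℝ≥0) ≤ z := not_lt.1 fun h4 => absurd (h1.2 h4) (not_lt.2 hn)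
        have hz : ⌊z⌋₊ = ⌊y⌋₊ := by
          rw [Nat.floor_eq_iff zero_le]
          exact ⟨hz0, by push_cast at hz1; exact hz1⟩
        refine ⟨hz.symm, ?_⟩
        rw [hz]
        exact ⟨fun h4 => absurd h4.symm hyn, fun h4 => absurd (h2.2 h4.symm) hyn⟩

namespace KRegionEquiv

variable {K : ℕ} {x y z : ℝ≥0}

theorem refl (K : ℕ) (y : ℝ≥0) : KRegionEquiv K y y := Or.inl ⟨rfl, Iff.rfl⟩

theorem symm (h : KRegionEquiv K y z) : KRegionEquiv K z y := by
  rw [kRegionEquiv_iff] at h ⊢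
  exact fun c hc => ⟨(h c hc).1.symm, (h c hc).2.symm⟩

theorem trans (h : KRegionEquiv K x y) (h' : KRegionEquiv K y z) : KRegionEquiv K x z := by
  rw [kRegionEquiv_iff] at h h' ⊢
  exact fun c hc => ⟨(h c hc).1.trans (h' c hc).1, (h c hc).2.trans (h' c hc).2⟩

/-- Comparing `y + d` with `c ≤ K` is trivial or amounts to comparing `y` with `c - d ≤ K`. This
lets `strictify` store an integral offset without raising the constant. -/
theorem add_natCast (h : KRegionEquiv K y z) (d : ℕ) : KRegionEquiv K (y + d) (z + d) := by
  rw [kRegionEquiv_iff] at h ⊢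
  intro c hc
  rcases le_or_gt d c with hdc | hdc
  · obtain ⟨e, rfl⟩ := Nat.exists_eq_add_of_le' hdc
    have := h e (by omega)
    push_cast
    simpa using this
  · have hlt : (c : ℝ≥0) < d := by exact_mod_cast hdc
    have h1 : ∀ w : ℝ≥0, (c : ℝ≥0) < w + d := fun w => lt_of_lt_of_le hlt le_add_self
    exact ⟨iff_of_false (h1 y).not_gt (h1 z).not_gt, iff_of_false (h1 y).ne' (h1 z).ne'⟩

theorem of_between (h : KRegionEquiv K x z) (hxy : x ≤ y) (hyz : y ≤ z) : KRegionEquiv K x y := by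
  rw [kRegionEquiv_iff] at h ⊢
  intro c hc
  obtain ⟨h1, h2⟩ := h c hc
  refine ⟨⟨fun h3 => lt_of_le_of_lt hyz (h1.1 h3), fun h3 => lt_of_le_of_lt hxy h3⟩,
    fun h3 => ?_, fun h3 => ?_⟩
  · exact le_antisymm (hyz.trans (h2.1 h3).le) (h3 ▸ hxy)
  · refine le_antisymm (hxy.trans h3.le) (not_lt.1 fun h4 => ?_)
    exact absurd (h1.1 h4) (not_lt.2 (h3 ▸ hyz))

theorem of_gt (hy : (K : ℝ≥0) < y) (hz : (K : ℝ≥0) < z) : KRegionEquiv K y z := Or.inr ⟨hy, hz⟩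

theorem le_iff (h : KRegionEquiv K y z) : y ≤ K ↔ z ≤ K := by
  rw [kRegionEquiv_iff] at h
  obtain ⟨h1, h2⟩ := h K le_rfl
  rw [le_iff_lt_or_eq, le_iff_lt_or_eq, h1, h2]

theorem lt_iff (h : KRegionEquiv K y z) : (K : ℝ≥0) < y ↔ (K : ℝ≥0) < z := by
  rw [← not_le, ← not_le, h.le_iff]

theorem floor_eq (h : KRegionEquiv K y z) (hy : y ≤ K) : ⌊y⌋₊ = ⌊z⌋₊ := by
  rcases h with h | h
  · exact h.1
  · exact absurd h.1 (not_lt.2 hy)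

theorem floor_eq_iff (h : KRegionEquiv K y z) (hy : y ≤ K) :
    (⌊y⌋₊ : ℝ≥0) = y ↔ (⌊z⌋₊ : ℝ≥0) = z := by
  rcases h with h | h
  · exact h.2
  · exact absurd h.1 (not_lt.2 hy)

end KRegionEquiv

theorem kRegionEquiv_zero_iff {K : ℕ} {z : ℝ≥0} : KRegionEquiv K 0 z ↔ z = 0 := by
  constructor
  · intro h
    have := (kRegionEquiv_iff.1 h 0 (Nat.zero_le _)).2
    simpa using this
  · rintro rfl
    exact KRegionEquiv.refl _ _

theorem ClockConstraint.mem_denote_iff_of_kRegionEquiv {K : ℕ} {y z : ℝ≥0}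
    (h : KRegionEquiv K y z) (φ : ClockConstraint) (hφ : φ.maxConst ≤ K) :
    y ∈ φ.denote ↔ z ∈ φ.denote := by
  induction φ with
  | gt c =>
      obtain ⟨h1, h2⟩ := kRegionEquiv_iff.1 h c hφ
      simp only [denote, Set.mem_ofPred_eq]
      rw [← not_le, ← not_le, le_iff_lt_or_eq, le_iff_lt_or_eq, h1, h2]
  | eq c => exact (kRegionEquiv_iff.1 h c hφ).2
  | lt c => exact (kRegionEquiv_iff.1 h c hφ).1
  | and φ ψ ih1 ih2 =>
      simp only [maxConst, max_le_iff] at hφ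
      simp only [denote, Set.mem_inter_iff]
      rw [ih1 hφ.1, ih2 hφ.2]

/-- `x` is not an integer. -/
def IsNonInt (x : ℝ≥0) : Prop := (⌊x⌋₊ : ℝ≥0) ≠ x

theorem isNonInt_iff {x : ℝ≥0} : IsNonInt x ↔ ∀ k : ℕ, x ≠ k := by
  constructor
  · rintro h k rfl
    exact h (by simp)
  · intro h h'
    exact h _ h'.symm

theorem isNonInt_add_natCast {x : ℝ≥0} {k : ℕ} : IsNonInt (x + k) ↔ IsNonInt x := by
  simp only [isNonInt_iff]
  constructor
  · rintro h j rfl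
    exact h (j + k) (by push_cast; rfl)
  · intro h j hj
    have hkj : k ≤ j := by
      have : (k : ℝ≥0) ≤ j := hj ▸ le_add_self
      exact_mod_cast this
    obtain ⟨i, rfl⟩ := Nat.exists_eq_add_of_le' hkj
    push_cast at hj
    exact h i (add_right_cancel hj)

theorem IsNonInt.ne_zero {x : ℝ≥0} (h : IsNonInt x) : x ≠ 0 := by
  simpa using isNonInt_iff.1 h 0

theorem isNonInt_iff_not_isPosInt {x : ℝ≥0} (hx : x ≠ 0) : IsNonInt x ↔ ¬ IsPosInt x := by
  rw [isNonInt_iff]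
  constructor
  · rintro h ⟨k, -, rfl⟩
    exact h k rfl
  · rintro h k rfl
    exact h ⟨k, Nat.pos_of_ne_zero (by simpa using hx), rfl⟩

theorem not_isPosInt_zero : ¬ IsPosInt 0 := by
  rintro ⟨k, hk, h⟩
  have : k = 0 := by exact_mod_cast h.symm
  omega

theorem IsNonInt.not_isPosInt {x : ℝ≥0} (h : IsNonInt x) : ¬ IsPosInt x :=
  (isNonInt_iff_not_isPosInt h.ne_zero).1 h

theorem mem_regionGuard {K : ℕ} {y z : ℝ≥0} :
    z ∈ (regionGuard K y).denote ↔ KRegionEquiv K y z := by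
  classical
  unfold regionGuard
  split_ifs with h1 h2
  · simp only [ClockConstraint.denote, Set.mem_ofPred_eq, h2]
    constructor
    · rintro rfl
      exact KRegionEquiv.refl _ _
    · intro h
      have h3 := (h.floor_eq_iff h1).1 h2
      rw [← h3, ← h.floor_eq h1, h2]
  · have hlt : (⌊y⌋₊ : ℝ≥0) < y := lt_of_le_of_ne (Nat.floor_le zero_le) h2
    have hceil : ⌈y⌉₊ = ⌊y⌋₊ + 1 := by
      refine le_antisymm (Nat.ceil_le_floor_add_one y) (Nat.lt_ceil.2 hlt)
    simp only [ClockConstraint.denote, Set.mem_inter_iff, Set.mem_ofPred_eq, hceil]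
    constructor
    · rintro ⟨h3, h4⟩
      have hz : ⌊z⌋₊ = ⌊y⌋₊ := by
        rw [Nat.floor_eq_iff zero_le]
        exact ⟨h3.le, by push_cast at h4; exact h4⟩
      exact Or.inl ⟨hz.symm, by rw [hz]; exact ⟨fun h => absurd h h2, fun h => absurd h h3.ne⟩⟩
    · intro h
      have h3 : (⌊z⌋₊ : ℝ≥0) ≠ z := fun h' => h2 ((h.floor_eq_iff h1).2 h')
      rw [h.floor_eq h1]
      exact ⟨lt_of_le_of_ne (Nat.floor_le zero_le) h3, by
        push_cast; exact Nat.lt_floor_add_one z⟩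
  · simp only [ClockConstraint.denote, Set.mem_ofPred_eq]
    rw [not_le] at h1
    exact ⟨fun h => KRegionEquiv.of_gt h1 h, fun h => h.lt_iff.1 h1⟩

theorem denote_regionGuard (K : ℕ) (y : ℝ≥0) :
    (regionGuard K y).denote = {z | KRegionEquiv K y z} := by
  ext z
  exact mem_regionGuard

theorem KRegionEquiv.regionGuard_eq {K : ℕ} {y z : ℝ≥0} (h : KRegionEquiv K y z) :
    regionGuard K y = regionGuard K z := by
  classical
  by_cases hy : y ≤ K
  · have hz := h.le_iff.1 hy
    by_cases hn : (⌊y⌋₊ : ℝ≥0) = y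
    · have hn' := (h.floor_eq_iff hy).1 hn
      rw [regionGuard, regionGuard, if_pos hy, if_pos hz, if_pos hn, if_pos hn', h.floor_eq hy]
    · have hn' : ¬ (⌊z⌋₊ : ℝ≥0) = z := fun h' => hn ((h.floor_eq_iff hy).2 h')
      have hc : ∀ x : ℝ≥0, ¬ (⌊x⌋₊ : ℝ≥0) = x → ⌈x⌉₊ = ⌊x⌋₊ + 1 := fun x hx =>
        le_antisymm (Nat.ceil_le_floor_add_one x)
          (Nat.lt_ceil.2 (lt_of_le_of_ne (Nat.floor_le zero_le) hx))
      rw [regionGuard, regionGuard, if_pos hy, if_pos hz, if_neg hn, if_neg hn', hc _ hn, hc _ hn',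
        h.floor_eq hy]
  · have hz : ¬ z ≤ K := fun h' => hy (h.le_iff.2 h')
    simp only [regionGuard, hy, hz, if_false]

theorem maxConst_regionGuard_le (K : ℕ) (y : ℝ≥0) : (regionGuard K y).maxConst ≤ K := by
  classical
  unfold regionGuard
  split_ifs with h1 h2
  · exact Nat.floor_le_of_le h1
  · simp only [ClockConstraint.maxConst, max_le_iff]
    exact ⟨Nat.floor_le_of_le h1, Nat.ceil_le.2 h1⟩
  · exact le_rfl

/-! ### Half-integral representatives -/

theorem hi_of_isNonInt {x : ℝ≥0} (h : IsNonInt x) : hi x = (⌊x⌋₊ : ℝ≥0) + 1 / 2 := if_neg h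

theorem hi_natCast (k : ℕ) : hi (k : ℝ≥0) = k := by
  classical
  simp [hi]

theorem hi_zero : hi 0 = 0 := by simpa using hi_natCast 0

theorem half_lt_one : (1 / 2 : ℝ≥0) < 1 := by
  rw [← NNReal.coe_lt_coe]; push_cast; norm_num

theorem floor_add_half (n : ℕ) : ⌊(n : ℝ≥0) + 1 / 2⌋₊ = n := by
  rw [Nat.floor_eq_iff zero_le]
  exact ⟨le_self_add, by gcongr; exact half_lt_one⟩

theorem isNonInt_add_half (n : ℕ) : IsNonInt ((n : ℝ≥0) + 1 / 2) := by
  unfold IsNonInt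
  rw [floor_add_half]
  exact (lt_add_of_pos_right _ (by positivity)).ne

theorem regionEquiv_hi (x : ℝ≥0) : RegionEquiv x (hi x) := by
  by_cases h : (⌊x⌋₊ : ℝ≥0) = x
  · rw [← h, hi_natCast]
    exact ⟨rfl, Iff.rfl⟩
  · rw [hi_of_isNonInt h]
    refine ⟨(floor_add_half _).symm, ⟨fun h' => absurd h' h, fun h' => ?_⟩⟩
    exact absurd h' (isNonInt_add_half _)

theorem kRegionEquiv_hi (K : ℕ) (x : ℝ≥0) : KRegionEquiv K x (hi x) := Or.inl (regionEquiv_hi x)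

theorem isHalfInt_natCast (k : ℕ) : IsHalfInt (k : ℝ≥0) := ⟨2 * k, by push_cast; field_simp⟩

theorem isHalfInt_zero : IsHalfInt 0 := by simpa using isHalfInt_natCast 0

theorem IsHalfInt.add {x y : ℝ≥0} (hx : IsHalfInt x) (hy : IsHalfInt y) : IsHalfInt (x + y) := by
  obtain ⟨j, rfl⟩ := hx
  obtain ⟨k, rfl⟩ := hy
  exact ⟨j + k, by push_cast; rw [add_div]⟩

theorem IsHalfInt.tsub {x y : ℝ≥0} (hx : IsHalfInt x) (hy : IsHalfInt y) : IsHalfInt (x - y) := by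
  obtain ⟨j, rfl⟩ := hx
  obtain ⟨k, rfl⟩ := hy
  exact ⟨j - k, by rw [← NNReal.sub_div, Nat.cast_tsub]⟩

theorem isHalfInt_natCast_add_half (k : ℕ) : IsHalfInt ((k : ℝ≥0) + 1 / 2) :=
  (isHalfInt_natCast k).add ⟨1, by norm_num⟩

theorem isHalfInt_hi (x : ℝ≥0) : IsHalfInt (hi x) := by
  by_cases h : (⌊x⌋₊ : ℝ≥0) = x
  · rw [← h, hi_natCast]
    exact isHalfInt_natCast _
  · rw [hi_of_isNonInt h]
    exact isHalfInt_natCast_add_half _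

theorem IsHalfInt.eq_or {x : ℝ≥0} (h : IsHalfInt x) :
    (∃ k : ℕ, x = k) ∨ ∃ k : ℕ, x = (k : ℝ≥0) + 1 / 2 := by
  obtain ⟨j, rfl⟩ := h
  rcases Nat.even_or_odd' j with ⟨k, rfl | rfl⟩
  · left; exact ⟨k, by push_cast; field_simp⟩
  · right; exact ⟨k, by push_cast; field_simp⟩

theorem IsHalfInt.hi_eq {x : ℝ≥0} (h : IsHalfInt x) : hi x = x := by
  rcases h.eq_or with ⟨k, rfl⟩ | ⟨k, rfl⟩
  · exact hi_natCast k
  · rw [hi_of_isNonInt (isNonInt_add_half k), floor_add_half]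

theorem hi_mono : Monotone hi := by
  intro x y hxy
  have hf : ⌊x⌋₊ ≤ ⌊y⌋₊ := Nat.floor_mono hxy
  have hfc : (⌊x⌋₊ : ℝ≥0) ≤ ⌊y⌋₊ := by exact_mod_cast hf
  by_cases hx : (⌊x⌋₊ : ℝ≥0) = x <;> by_cases hy : (⌊y⌋₊ : ℝ≥0) = y
  · rw [← hx, ← hy, hi_natCast, hi_natCast]; exact hfc
  · rw [← hx, hi_natCast, hi_of_isNonInt hy]
    exact hfc.trans le_self_add
  · rw [hi_of_isNonInt hx, ← hy, hi_natCast]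
    have hlt : ⌊x⌋₊ < ⌊y⌋₊ := by
      refine lt_of_le_of_ne hf fun h => hx ?_
      exact le_antisymm (Nat.floor_le zero_le) (by rw [h, hy]; exact hxy)
    have : ((⌊x⌋₊ + 1 : ℕ) : ℝ≥0) ≤ ⌊y⌋₊ := by exact_mod_cast hlt
    push_cast at this
    refine le_trans ?_ this
    gcongr
    exact half_lt_one.le
  · rw [hi_of_isNonInt hx, hi_of_isNonInt hy]
    gcongr

/-- A bounded region contains exactly one half-integral value. So in tables, region equivalence up
to `K` is equality of clock values. -/
theorem IsHalfInt.eq_of_kRegionEquiv {K : ℕ} {y z : ℝ≥0} (hy : IsHalfInt y) (hz : IsHalfInt z)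
    (h : KRegionEquiv K y z) (hyK : y ≤ K) : y = z := by
  have h1 := h.floor_eq hyK
  have h2 := h.floor_eq_iff hyK
  rw [← hy.hi_eq, ← hz.hi_eq]
  by_cases h3 : (⌊y⌋₊ : ℝ≥0) = y
  · rw [← h3, ← h2.1 h3, h1]
  · rw [hi_of_isNonInt h3, hi_of_isNonInt (fun h4 => h3 (h2.2 h4)), h1]

theorem natCast_lt_add_half (K : ℕ) : (K : ℝ≥0) < (K : ℝ≥0) + 1 / 2 :=
  lt_add_of_pos_right _ (by positivity)

theorem IsHalfInt.mem_sigmaK_of_le {α : Type u} {K : ℕ} {t : ℝ≥0} (h : IsHalfInt t) (ht : t ≤ K)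
    (a : α) : (t, a) ∈ sigmaK α K :=
  ⟨h, lt_of_le_of_lt ht (lt_add_of_pos_right _ one_pos)⟩

theorem natCast_add_half_mem_sigmaK {α : Type u} (K : ℕ) (a : α) :
    ((K : ℝ≥0) + 1 / 2, a) ∈ sigmaK α K := by
  refine ⟨isHalfInt_natCast_add_half K, ?_⟩
  simp only
  gcongr
  exact half_lt_one

/-- Every clock value is equivalent to a half-integral one below `K + 1`. -/
theorem exists_halfInt_kRegionEquiv (K : ℕ) (y : ℝ≥0) :
    ∃ k : ℕ, k < 2 * K + 2 ∧ KRegionEquiv K ((k : ℝ≥0) / 2) y := by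
  rcases le_or_gt y (K : ℝ≥0) with h | h
  · obtain ⟨k, hk⟩ := isHalfInt_hi y
    refine ⟨k, ?_, hk ▸ (kRegionEquiv_hi K y).symm⟩
    have h1 : hi y ≤ K := by simpa [hi_natCast] using hi_mono h
    rw [hk, div_le_iff₀ (by norm_num)] at h1
    have : k ≤ K * 2 := by exact_mod_cast h1
    omega
  · refine ⟨2 * K + 1, by omega, KRegionEquiv.of_gt ?_ h⟩
    rw [lt_div_iff₀ (by norm_num)]
    push_cast
    rw [mul_comm]
    exact lt_add_of_pos_right _ one_pos

/-! ### Runs -/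

namespace OneTA

variable {α : Type u} {A : OneTA α}

theorem run_nil_iff {q q' : A.Q} {ν ν' : ℝ≥0} {θs : List (ClockTransition α A.Q)} :
    A.Run q ν [] θs q' ν' ↔ θs = [] ∧ q' = q ∧ ν' = ν := by
  constructor
  · intro h
    cases h
    exact ⟨rfl, rfl, rfl⟩
  · rintro ⟨rfl, rfl, rfl⟩
    exact .nil _ _

theorem run_cons_iff {q q' : A.Q} {ν ν' t : ℝ≥0} {a : α} {w : TimedWord α}
    {θs : List (ClockTransition α A.Q)} :
    A.Run q ν ((t, a) :: w) θs q' ν' ↔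
      ∃ θ ∈ A.trans, θ.src = q ∧ θ.letter = a ∧ ν + t ∈ θ.guard.denote ∧
        ∃ θs', θs = θ :: θs' ∧ A.Run θ.tgt (if θ.keep then ν + t else 0) w θs' q' ν' := by
  constructor
  · intro h
    cases h with
    | cons θ _ _ _ θs _ _ hθ hguard hrun => exact ⟨θ, hθ, rfl, rfl, hguard, θs, rfl, hrun⟩
  · rintro ⟨θ, hθ, rfl, rfl, hguard, θs, rfl, hrun⟩
    exact .cons θ ν t w θs q' ν' hθ hguard hrun

end OneTA

/-! ### Region machines -/

/-- A deterministic and complete one-clock machine whose moves depend only on the `K`-region of the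
clock value. The second component of a move tells whether the clock is kept. -/
structure RegionMachine (α : Type u) (K : ℕ) : Type (u + 1) where
  X : Type u
  finite_X : Finite X
  init : X
  step : X → α → ℝ≥0 → X × Bool
  final : Set X
  region : ∀ x a y z, KRegionEquiv K y z → step x a y = step x a z

namespace RegionMachine

variable {α : Type u} {K : ℕ}

/-- The clock value after a move made at clock value `y`. -/
def clock (M : RegionMachine α K) (x : M.X) (a : α) (y : ℝ≥0) : ℝ≥0 :=
  if (M.step x a y).2 then y else 0

/-- Acceptance of a timed word from a configuration. -/
def acc (M : RegionMachine α K) : M.X → ℝ≥0 → TimedWord α → Prop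
  | x, _, [] => x ∈ M.final
  | x, ν, (t, a) :: w => M.acc (M.step x a (ν + t)).1 (M.clock x a (ν + t)) w

/-- The configuration reached after a timed word. -/
def conf (M : RegionMachine α K) : M.X × ℝ≥0 → TimedWord α → M.X × ℝ≥0
  | c, [] => c
  | c, (t, a) :: w => M.conf ((M.step c.1 a (c.2 + t)).1, M.clock c.1 a (c.2 + t)) w

def lang (M : RegionMachine α K) : Set (TimedWord α) := {w | M.acc M.init 0 w}

/-- The clock is kept only at nonintegral values below `K`. -/
def IsStrict (M : RegionMachine α K) : Prop :=
  ∀ x a y, (M.step x a y).2 = true → y ≤ K ∧ IsNonInt y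

theorem acc_cons (M : RegionMachine α K) (x : M.X) (ν t : ℝ≥0) (a : α) (w : TimedWord α) :
    M.acc x ν ((t, a) :: w) ↔ M.acc (M.step x a (ν + t)).1 (M.clock x a (ν + t)) w := Iff.rfl

theorem acc_append (M : RegionMachine α K) (w v : TimedWord α) :
    ∀ c : M.X × ℝ≥0, M.acc c.1 c.2 (w ++ v) ↔ M.acc (M.conf c w).1 (M.conf c w).2 v := by
  induction w with
  | nil => intro c; rfl
  | cons p w ih =>
      intro c
      obtain ⟨t, a⟩ := p
      exact ih (_, _)

theorem conf_snoc (M : RegionMachine α K) (w : TimedWord α) (t : ℝ≥0) (a : α) :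
    ∀ c : M.X × ℝ≥0, M.conf c (w ++ [(t, a)]) =
      ((M.step (M.conf c w).1 a ((M.conf c w).2 + t)).1,
        M.clock (M.conf c w).1 a ((M.conf c w).2 + t)) := by
  induction w with
  | nil => intro c; rfl
  | cons p w ih =>
      intro c
      obtain ⟨s, b⟩ := p
      exact ih (_, _)

theorem residualLang_lang (M : RegionMachine α K) (u : TimedWord α) :
    residualLang M.lang u =
      {w | M.acc (M.conf (M.init, 0) u).1 (M.conf (M.init, 0) u).2 w} := by
  ext w
  exact M.acc_append u w (M.init, 0)

/-- Above `K` the clock stays in the last region until it is reset, so its exact value is never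
seen. -/
theorem acc_of_gt (M : RegionMachine α K) (w : TimedWord α) :
    ∀ (x : M.X) (ν ν' : ℝ≥0), (K : ℝ≥0) < ν → (K : ℝ≥0) < ν' → (M.acc x ν w ↔ M.acc x ν' w) := by
  induction w with
  | nil => intro x ν ν' _ _; rfl
  | cons p w ih =>
      intro x ν ν' h h'
      obtain ⟨t, a⟩ := p
      have h1 : (K : ℝ≥0) < ν + t := lt_of_lt_of_le h le_self_add
      have h2 : (K : ℝ≥0) < ν' + t := lt_of_lt_of_le h' le_self_add
      have hs := M.region x a _ _ (KRegionEquiv.of_gt h1 h2)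
      rw [acc_cons, acc_cons, clock, clock, hs]
      split_ifs
      · exact ih _ _ _ h1 h2
      · rfl

/-! ### From automata to machines -/

open Classical in
/-- The move of the completed automaton, given the enabled transitions. -/
noncomputable def move {Q : Type u} (p : ClockTransition α Q → Prop) : Option Q × Bool :=
  if h : ∃ θ, p θ then (some h.choose.tgt, h.choose.keep) else (none, false)

def enabled (A : OneTA α) (q : A.Q) (a : α) (y : ℝ≥0) (θ : ClockTransition α A.Q) : Prop :=
  θ ∈ A.trans ∧ θ.src = q ∧ θ.letter = a ∧ y ∈ θ.guard.denote

theorem _root_.OneTA.maxConst_guard_le (A : OneTA α) {θ : ClockTransition α A.Q}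
    (hθ : θ ∈ A.trans) : θ.guard.maxConst ≤ A.maxConst :=
  le_csSup (A.finite_trans.image _).bddAbove ⟨θ, hθ, rfl⟩

/-- The completion of an automaton. -/
noncomputable abbrev ofOneTA (A : OneTA α) : RegionMachine α A.maxConst where
  X := Option A.Q
  finite_X := by
    have := A.finite_Q
    infer_instance
  init := some A.init
  step x a y := x.elim (none, false) fun q => move (enabled A q a y)
  final := {x | ∃ q ∈ A.final, x = some q}
  region := by
    rintro (_ | q) a y z h
    · rfl
    · have : enabled A q a y = enabled A q a z := by
        funext θ
        refine propext (and_congr_right fun hθ => ?_)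
        rw [ClockConstraint.mem_denote_iff_of_kRegionEquiv h _ (A.maxConst_guard_le hθ)]
      simp only [Option.elim_some, this]

theorem not_acc_none (A : OneTA α) (w : TimedWord α) :
    ∀ ν, ¬ (ofOneTA A).acc (none : Option A.Q) ν w := by
  induction w with
  | nil =>
      rintro ν ⟨q, -, h⟩
      cases h
  | cons p w ih =>
      intro ν
      obtain ⟨t, a⟩ := p
      exact ih _

theorem acc_ofOneTA (A : OneTA α) (hA : A.IsDeterministic) (w : TimedWord α) :
    ∀ (q : A.Q) (ν : ℝ≥0), (ofOneTA A).acc (some q : Option A.Q) ν w ↔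
      ∃ θs q' ν', A.Run q ν w θs q' ν' ∧ q' ∈ A.final := by
  induction w with
  | nil =>
      intro q ν
      constructor
      · rintro ⟨q', hq', h⟩
        cases h
        exact ⟨[], q, ν, .nil _ _, hq'⟩
      · rintro ⟨θs, q', ν', hrun, hq'⟩
        obtain ⟨-, rfl, -⟩ := OneTA.run_nil_iff.1 hrun
        exact ⟨_, hq', rfl⟩
  | cons p w ih =>
      intro q ν
      obtain ⟨t, a⟩ := p
      simp only [OneTA.run_cons_iff]
      by_cases h : ∃ θ, enabled A q a (ν + t) θ
      · have hstep : (ofOneTA A).step (some q : Option A.Q) a (ν + t) =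
            (some h.choose.tgt, h.choose.keep) := dif_pos h
        have hclock : (ofOneTA A).clock (some q : Option A.Q) a (ν + t) =
            if h.choose.keep then ν + t else 0 :=
          congrArg (fun s : Option A.Q × Bool => if s.2 then ν + t else 0) hstep
        rw [acc_cons, hclock, hstep]
        refine (ih _ _).trans ?_
        obtain ⟨h1, h2, h3, h4⟩ := h.choose_spec
        generalize h.choose = θ at *
        constructor
        · rintro ⟨θs, q', ν', hrun, hq'⟩
          exact ⟨_, q', ν', ⟨θ, h1, h2, h3, h4, θs, rfl, hrun⟩, hq'⟩
        · rintro ⟨-, q', ν', ⟨θ', hθ, h2', h3', hguard, θs, rfl, hrun⟩, hq'⟩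
          have hθθ : θ = θ' := by
            by_contra hne
            rcases hA θ h1 θ' hθ hne with h5 | h5 | h5
            · exact h5 (h2.trans h2'.symm)
            · exact h5 (h3.trans h3'.symm)
            · exact Set.disjoint_left.1 h5 h4 hguard
          subst hθθ
          exact ⟨θs, q', ν', hrun, hq'⟩
      · have hstep : (ofOneTA A).step (some q : Option A.Q) a (ν + t) = (none, false) := dif_neg h
        rw [acc_cons, hstep]
        refine iff_of_false (not_acc_none A w _) ?_
        rintro ⟨-, q', ν', ⟨θ', hθ, h2', h3', hguard, -⟩, hq'⟩
        exact h ⟨θ', hθ, h2', h3', hguard⟩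

theorem lang_ofOneTA (A : OneTA α) (hA : A.IsDeterministic) : (ofOneTA A).lang = A.lang := by
  ext w
  exact acc_ofOneTA A hA w A.init 0

/-! ### Strictification -/

open Classical in
/-- The machine that resets its clock at integral values and at values above `K`, and remembers
what has been subtracted. -/
noncomputable abbrev strictify (M : RegionMachine α K) : RegionMachine α K where
  X := M.X × Fin (K + 2)
  finite_X := by
    have := M.finite_X
    infer_instance
  init := (M.init, 0)
  step x a y :=
    let z : ℝ≥0 := y + (x.2 : ℕ)
    let s := M.step x.1 a z
    if s.2 = false then ((s.1, 0), false)
    else if h : z ≤ K then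
      if (⌊z⌋₊ : ℝ≥0) = z then
        ((s.1, ⟨⌊z⌋₊, Nat.lt_succ_of_le ((Nat.floor_le_of_le h).trans (Nat.le_succ K))⟩), false)
      else ((s.1, x.2), true)
    else ((s.1, Fin.last (K + 1)), false)
  final := {x | x.1 ∈ M.final}
  region := by
    rintro ⟨x, c⟩ a y z h
    have h' := h.add_natCast (c : ℕ)
    simp only
    rw [M.region x a _ _ h']
    split_ifs with h1 h2 h3 h4 h5 h6 h7 h8 h9
    · rfl
    · simp only [h'.floor_eq h2]
    · exact absurd ((h'.floor_eq_iff h2).1 h3) h5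
    · exact absurd (h'.le_iff.1 h2) h4
    · exact absurd ((h'.floor_eq_iff h2).2 h7) h3
    · rfl
    · exact absurd (h'.le_iff.1 h2) h6
    · exact absurd (h'.le_iff.2 h8) h2
    · exact absurd (h'.le_iff.2 h8) h2
    · rfl

theorem isStrict_strictify (M : RegionMachine α K) : M.strictify.IsStrict := by
  classical
  rintro ⟨x, c⟩ a y h
  simp only [strictify] at h
  split_ifs at h with h1 h2 h3
  exact ⟨le_self_add.trans h2, isNonInt_add_natCast.1 h3⟩

/-- The configuration `((x, c), ν)` simulates `(x, ν + c)`. The offset `K + 1` stands for all values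
above `K`, which is harmless by `acc_of_gt`. -/
theorem acc_strictify (M : RegionMachine α K) (w : TimedWord α) :
    ∀ (x : M.X) (c : Fin (K + 2)) (ν : ℝ≥0),
      M.strictify.acc ((x, c) : M.X × Fin (K + 2)) ν w ↔ M.acc x (ν + (c : ℕ)) w := by
  classical
  induction w with
  | nil => intro x c ν; rfl
  | cons p w ih =>
      intro x c ν
      obtain ⟨t, a⟩ := p
      rw [acc_cons, acc_cons, clock, clock]
      have e : ν + (c : ℕ) + t = ν + t + (c : ℕ) := add_right_comm _ _ _
      rw [e]
      simp only [strictify]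
      split_ifs with h1 h2 h3 h4 h5 h6 h7 <;> simp_all
      exact M.acc_of_gt w _ _ _ (lt_add_of_pos_right _ one_pos) (by assumption)

theorem lang_strictify (M : RegionMachine α K) : M.strictify.lang = M.lang := by
  ext w
  refine (acc_strictify M w _ _ _).trans ?_
  simp [lang]

/-! ### From machines to automata -/

/-- The automaton of a machine, with regions as guards. -/
noncomputable abbrev toOneTA [Finite α] (M : RegionMachine α K) : OneTA α where
  Q := M.X
  finite_Q := M.finite_X
  init := M.init
  trans := Set.range fun i : M.X × α × Fin (2 * K + 2) =>
    ⟨i.1, (M.step i.1 i.2.1 (((i.2.2 : ℕ) : ℝ≥0) / 2)).1, i.2.1,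
      regionGuard K (((i.2.2 : ℕ) : ℝ≥0) / 2), (M.step i.1 i.2.1 (((i.2.2 : ℕ) : ℝ≥0) / 2)).2⟩
  finite_trans := by
    have := M.finite_X
    exact Set.finite_range _
  final := M.final

theorem isDeterministic_toOneTA [Finite α] (M : RegionMachine α K) :
    M.toOneTA.IsDeterministic := by
  rintro θ ⟨⟨x, a, i⟩, rfl⟩ θ₁ ⟨⟨x', a', i'⟩, rfl⟩ hne
  by_contra h
  push Not at h
  obtain ⟨h1, h2, h3⟩ := h
  simp only at h1 h2 h3
  subst h1 h2
  obtain ⟨z, hz, hz'⟩ := Set.not_disjoint_iff.1 h3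
  rw [mem_regionGuard] at hz hz'
  have h4 := hz.trans hz'.symm
  apply hne
  show ClockTransition.mk _ _ _ _ _ = ClockTransition.mk _ _ _ _ _
  rw [h4.regionGuard_eq, M.region x a _ _ h4]

theorem acc_toOneTA [Finite α] (M : RegionMachine α K) (w : TimedWord α) :
    ∀ (x : M.X) (ν : ℝ≥0), (∃ θs q' ν', M.toOneTA.Run x ν w θs q' ν' ∧ q' ∈ M.final) ↔
      M.acc x ν w := by
  induction w with
  | nil =>
      intro q ν
      simp only [OneTA.run_nil_iff]
      exact ⟨fun ⟨_, _, _, ⟨_, h, _⟩, hq⟩ => h ▸ hq, fun h => ⟨[], q, ν, ⟨rfl, rfl, rfl⟩, h⟩⟩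
  | cons p w ih =>
      intro x ν
      obtain ⟨t, a⟩ := p
      simp only [OneTA.run_cons_iff]
      rw [acc_cons, ← ih, clock]
      constructor
      · rintro ⟨-, q', ν', ⟨-, ⟨⟨x, a, i⟩, rfl⟩, rfl, rfl, hguard, θs, rfl, hrun⟩, hq'⟩
        rw [← M.region x a _ _ (mem_regionGuard.1 hguard)]
        exact ⟨θs, q', ν', hrun, hq'⟩
      · rintro ⟨θs, q', ν', hrun, hq'⟩
        obtain ⟨k, hk, hr⟩ := exists_halfInt_kRegionEquiv K (ν + t)
        rw [← M.region x a _ _ hr] at hrun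
        exact ⟨_, q', ν', ⟨_, ⟨(x, a, ⟨k, hk⟩), rfl⟩, rfl, rfl, mem_regionGuard.2 hr, θs, rfl, hrun⟩,
          hq'⟩

theorem lang_toOneTA [Finite α] (M : RegionMachine α K) : M.toOneTA.lang = M.lang := by
  ext w
  exact acc_toOneTA M w M.init 0

/-- The same machine, started in another state. -/
def withInit (M : RegionMachine α K) (x : M.X) : RegionMachine α K := { M with init := x }

theorem acc_withInit (M : RegionMachine α K) (x : M.X) (w : TimedWord α) :
    ∀ (y : M.X) (ν : ℝ≥0), (M.withInit x).acc y ν w ↔ M.acc y ν w := by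
  induction w with
  | nil => intro y ν; rfl
  | cons p w ih =>
      intro y ν
      obtain ⟨t, a⟩ := p
      exact ih _ _

/-- Runs of an automaton start at clock value 0, so whatever remains after a reset is recognizable.
This is how recognizability of residuals is obtained. -/
theorem isDTARecognizable_acc_zero [Finite α] (M : RegionMachine α K) (x : M.X) :
    IsDTARecognizable {w | M.acc x 0 w} := by
  refine ⟨(M.withInit x).toOneTA, isDeterministic_toOneTA _, ?_⟩
  rw [lang_toOneTA]
  ext w
  exact M.acc_withInit x w x 0

end RegionMachine

theorem exists_strict_machine_of_isDeterministic {α : Type u} (A : OneTA α)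
    (hA : A.IsDeterministic) :
    ∃ M : RegionMachine α A.maxConst, M.IsStrict ∧ M.lang = A.lang :=
  ⟨_, (RegionMachine.ofOneTA A).isStrict_strictify, by
    rw [RegionMachine.lang_strictify, RegionMachine.lang_ofOneTA A hA]⟩

theorem IsDTARecognizable.exists_machine {α : Type u} {L : Set (TimedWord α)}
    (hL : IsDTARecognizable L) : ∃ (K : ℕ) (M : RegionMachine α K), M.IsStrict ∧ M.lang = L := by
  obtain ⟨A, hA, rfl⟩ := hL
  exact ⟨_, exists_strict_machine_of_isDeterministic A hA⟩

/-- Strictification keeps the constant, so the minimum is attained by a strict machine. All bounds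
by `minConst L` come from this machine. -/
theorem IsDTARecognizable.exists_machine_minConst {α : Type u} {L : Set (TimedWord α)}
    (hL : IsDTARecognizable L) : ∃ M : RegionMachine α (minConst L), M.IsStrict ∧ M.lang = L := by
  have hne : {K | ∃ A : OneTA α, A.IsDeterministic ∧ A.maxConst = K ∧ A.lang = L}.Nonempty := by
    obtain ⟨A, hA, hAL⟩ := hL
    exact ⟨_, A, hA, rfl, hAL⟩
  obtain ⟨A, hA, hAK, rfl⟩ := Nat.sInf_mem hne
  have := exists_strict_machine_of_isDeterministic A hA
  rwa [hAK] at this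

/-! ### Languages of configurations with incongruent clock values -/

/-- No integer shifts of `ν` and `μ` coincide. -/
def Incongruent (ν μ : ℝ≥0) : Prop := ∀ c d : ℕ, ν + c ≠ μ + d

namespace Incongruent

variable {ν μ : ℝ≥0}

theorem symm (h : Incongruent ν μ) : Incongruent μ ν := fun c d hcd => h d c hcd.symm

theorem add_right (h : Incongruent ν μ) (t : ℝ≥0) : Incongruent (ν + t) (μ + t) := by
  intro c d hcd
  refine h c d (add_right_cancel (b := t) ?_)
  rw [add_right_comm, hcd, add_right_comm]

theorem isNonInt_or (h : Incongruent ν μ) : IsNonInt ν ∨ IsNonInt μ := by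
  by_contra h'
  push Not at h'
  obtain ⟨h1, h2⟩ := h'
  simp only [IsNonInt, ne_eq, not_not] at h1 h2
  refine h ⌊μ⌋₊ ⌊ν⌋₊ ?_
  rw [h1, h2, add_comm]

end Incongruent

theorem IsNonInt.incongruent_zero {ν : ℝ≥0} (h : IsNonInt ν) : Incongruent ν 0 := by
  intro c d hcd
  rw [zero_add] at hcd
  exact isNonInt_iff.1 (isNonInt_add_natCast.2 h : IsNonInt (ν + c)) d hcd

theorem IsNonInt.eventually_regionEquiv {ν t : ℝ≥0} (h : IsNonInt (ν + t)) :
    ∀ᶠ t' in nhds t, RegionEquiv (ν + t) (ν + t') := by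
  have h1 : (⌊ν + t⌋₊ : ℝ≥0) < ν + t := lt_of_le_of_ne (Nat.floor_le zero_le) h
  have h2 : ν + t < (⌊ν + t⌋₊ : ℝ≥0) + 1 := Nat.lt_floor_add_one _
  have hc : Filter.Tendsto (fun t' => ν + t') (nhds t) (nhds (ν + t)) := by
    exact (continuous_const.add continuous_id).tendsto t
  filter_upwards [hc.eventually (lt_mem_nhds h1), hc.eventually (gt_mem_nhds h2)] with t' h3 h4
  have h5 : ⌊ν + t'⌋₊ = ⌊ν + t⌋₊ := by
    rw [Nat.floor_eq_iff zero_le]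
    exact ⟨h3.le, h4⟩
  refine ⟨h5.symm, ?_⟩
  rw [h5]
  exact ⟨fun h' => absurd h' h, fun h' => absurd h' h3.ne⟩

namespace RegionMachine

variable {α : Type u} {K K' : ℕ}

/-- If the languages of two configurations with incongruent clock values coincide, then they do
not change when the first clock value moves within its region. -/
def Rigid (α : Type u) (w : TimedWord α) : Prop :=
  ∀ (K K' : ℕ) (M : RegionMachine α K) (M' : RegionMachine α K'), M.IsStrict → M'.IsStrict →
    ∀ (x : M.X) (y : M'.X) (ν μ : ℝ≥0), (∀ v, M.acc x ν v ↔ M'.acc y μ v) → Incongruent ν μ →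
      ∀ ν', KRegionEquiv K ν ν' → (M.acc x ν w ↔ M.acc x ν' w)

theorem clock_of_keep (M : RegionMachine α K) {x : M.X} {a : α} {y : ℝ≥0}
    (h : (M.step x a y).2 = true) : M.clock x a y = y := if_pos h

theorem clock_of_reset (M : RegionMachine α K) {x : M.X} {a : α} {y : ℝ≥0}
    (h : ¬ (M.step x a y).2 = true) : M.clock x a y = 0 := if_neg h

/-- The second machine may reset when the first does not. Its clock is then 0, and nonintegrality of
`ν` keeps the pair incongruent. -/
theorem incongruent_clock {M' : RegionMachine α K'}
    {ν μ : ℝ≥0} (h : Incongruent ν μ) (hν : IsNonInt ν) (y : M'.X) (a : α) :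
    Incongruent ν (M'.clock y a μ) := by
  by_cases hk : (M'.step y a μ).2 = true
  · rw [M'.clock_of_keep hk]
    exact h
  · rw [M'.clock_of_reset hk]
    exact hν.incongruent_zero

/-- If `M` keeps its clock at `ν + t`, strictness makes this value nonintegral, and `M'` has moved
to a configuration with the same language and an incongruent clock value, so `ih` moves the clock to
`z`. If `M` resets, only the region of `ν + t` matters. -/
theorem Rigid.acc_cons_of_regionEquiv {w : TimedWord α} (ih : Rigid α w) {M : RegionMachine α K}
    {M' : RegionMachine α K'} (hM : M.IsStrict) (hM' : M'.IsStrict) {x : M.X} {y : M'.X}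
    {ν μ : ℝ≥0} (hL : ∀ v, M.acc x ν v ↔ M'.acc y μ v) (hνμ : Incongruent ν μ)
    {t : ℝ≥0} {a : α} {z : ℝ≥0} (hz : KRegionEquiv K (ν + t) z) :
    M.acc x ν ((t, a) :: w) ↔ M.acc (M.step x a z).1 (M.clock x a z) w := by
  rw [acc_cons, clock, clock, ← M.region x a _ _ hz]
  split_ifs with hk
  · refine ih K K' M M' hM hM' _ (M'.step y a (μ + t)).1 _ (M'.clock y a (μ + t)) ?_ ?_ _ hz
    · intro v
      have := hL ((t, a) :: v)
      rwa [acc_cons, acc_cons, M.clock_of_keep hk] at this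
    · exact incongruent_clock (hνμ.add_right t) (hM _ _ _ hk).2 _ _
  · rfl

/-- For each `t` one of `ν + t` and `μ + t` is nonintegral, and the corresponding machine stays in
its region for nearby delays. Read through that machine, acceptance is locally constant in `t`;
connectedness of `ℝ≥0` does the rest. -/
theorem Rigid.acc_cons_iff {w : TimedWord α} (ih : Rigid α w) {M : RegionMachine α K}
    {M' : RegionMachine α K'} (hM : M.IsStrict) (hM' : M'.IsStrict) {x : M.X} {y : M'.X}
    {ν μ : ℝ≥0} (hL : ∀ v, M.acc x ν v ↔ M'.acc y μ v) (hνμ : Incongruent ν μ)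
    (t t' : ℝ≥0) (a : α) : M.acc x ν ((t, a) :: w) ↔ M.acc x ν ((t', a) :: w) := by
  have hloc : IsLocallyConstant fun t => M.acc x ν ((t, a) :: w) := by
    rw [IsLocallyConstant.iff_eventually_eq]
    intro t
    rcases (hνμ.add_right t).isNonInt_or with h | h
    · filter_upwards [h.eventually_regionEquiv] with t' ht'
      exact propext (ih.acc_cons_of_regionEquiv hM hM' hL hνμ (Or.inl ht')).symm
    · filter_upwards [h.eventually_regionEquiv] with t' ht'
      simp only [hL]
      exact propext (ih.acc_cons_of_regionEquiv hM' hM (fun v => (hL v).symm) hνμ.symm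
        (Or.inl ht')).symm
  exact iff_of_eq (hloc.apply_eq_of_isPreconnected isPreconnected_univ (Set.mem_univ t)
    (Set.mem_univ t'))

theorem rigid (w : TimedWord α) : Rigid α w := by
  induction w with
  | nil =>
      intro K K' M M' hM hM' x y ν μ hL hνμ ν' hν'
      rfl
  | cons p w ih =>
      obtain ⟨t, a⟩ := p
      intro K K' M M' hM hM' x y ν μ hL hνμ ν' hν'
      -- Shifting the clock value by `δ` amounts to shifting the first delay by `δ`, which is
      -- immaterial by `acc_cons_iff`. If the delay is too short to be lowered by `δ`, it is
      -- replaced by 0: then `ν' + t` lies between `ν'` and `ν`, hence in their region.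
      rcases le_total ν ν' with h | h
      · obtain ⟨δ, rfl⟩ := exists_add_of_le h
        rw [ih.acc_cons_iff hM hM' hL hνμ t (δ + t) a, acc_cons, acc_cons, add_assoc]
      · obtain ⟨δ, rfl⟩ := exists_add_of_le h
        rcases le_total δ t with h' | h'
        · obtain ⟨s, rfl⟩ := exists_add_of_le h'
          rw [ih.acc_cons_iff hM hM' hL hνμ _ s a, acc_cons, acc_cons, add_assoc]
        · rw [ih.acc_cons_iff hM hM' hL hνμ t 0 a, acc_cons]
          refine ih.acc_cons_of_regionEquiv hM hM' hL hνμ ?_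
          rw [add_zero]
          refine hν'.trans (hν'.symm.of_between le_self_add ?_)
          gcongr

end RegionMachine

/-! ### Recognizable configurations -/

namespace RegionMachine

variable {α : Type u} {K : ℕ}

/-- The second configuration required by rigidity is the initial one of a machine for the
recognizable language; its clock value 0 is incongruent with the nonintegral `ν`. -/
theorem setOf_acc_eq_of_recognizable {M : RegionMachine α K} (hM : M.IsStrict) {x : M.X}
    {ν ν' : ℝ≥0} (hν : IsNonInt ν) (h : IsDTARecognizable {w | M.acc x ν w})
    (hνν : KRegionEquiv K ν ν') : {w | M.acc x ν w} = {w | M.acc x ν' w} := by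
  obtain ⟨K', M', hM', hL⟩ := h.exists_machine
  ext w
  refine rigid w K K' M M' hM hM' x M'.init ν 0 ?_ hν.incongruent_zero ν' hνν
  intro v
  exact (Set.ext_iff.1 hL v).symm

theorem acc_cons_iff_of_recognizable {M : RegionMachine α K} (hM : M.IsStrict) {x : M.X}
    {ν : ℝ≥0} (hν : IsNonInt ν) (h : IsDTARecognizable {w | M.acc x ν w})
    (t t' : ℝ≥0) (a : α) (w : TimedWord α) :
    M.acc x ν ((t, a) :: w) ↔ M.acc x ν ((t', a) :: w) := by
  obtain ⟨K', M', hM', hL⟩ := h.exists_machine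
  refine (rigid w).acc_cons_iff hM hM' (y := M'.init) (μ := 0) ?_ hν.incongruent_zero t t' a
  intro v
  exact (Set.ext_iff.1 hL v).symm

theorem conf_snd_eq_zero_or {M : RegionMachine α K} (hM : M.IsStrict) (u : TimedWord α) :
    (M.conf (M.init, 0) u).2 = 0 ∨
      ((M.conf (M.init, 0) u).2 ≤ K ∧ IsNonInt (M.conf (M.init, 0) u).2) := by
  rcases List.eq_nil_or_concat u with rfl | ⟨v, ⟨t, a⟩, rfl⟩
  · exact Or.inl rfl
  · rw [List.concat_eq_append, conf_snoc, clock]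
    simp only
    split_ifs with h
    · exact Or.inr (hM _ _ _ h)
    · exact Or.inl rfl

end RegionMachine

/-! ### The syntactic reset function -/

section

variable {α : Type u} {L : Set (TimedWord α)}

theorem residualLang_append (L : Set (TimedWord α)) (u v : TimedWord α) :
    residualLang L (u ++ v) = residualLang (residualLang L u) v := by
  ext w
  simp [residualLang]

theorem synReset_snoc_of_recognizable {u : TimedWord α} {t : ℝ≥0} {a : α}
    (h : IsDTARecognizable (residualLang L (u ++ [(t, a)]))) : synReset L (u ++ [(t, a)]) = 0 := by
  rw [synReset_snoc, if_pos h]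

theorem synReset_snoc_of_not_recognizable {u : TimedWord α} {t : ℝ≥0} {a : α}
    (h : ¬ IsDTARecognizable (residualLang L (u ++ [(t, a)]))) :
    synReset L (u ++ [(t, a)]) = synReset L u + t := by
  rw [synReset_snoc, if_neg h]

theorem isResetFunction_synReset (L : Set (TimedWord α)) : IsResetFunction (synReset L) where
  nil := synReset_nil L
  snoc u t a := by
    classical
    rw [synReset_snoc]
    split_ifs
    · exact Or.inl rfl
    · exact Or.inr rfl

/-- The future of the syntactic reset function depends only on its present value and on the
residual; this makes `≈^L` a right congruence. -/
theorem synReset_append_congr {u v : TimedWord α} (h : synReset L u = synReset L v)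
    (h' : residualLang L u = residualLang L v) (w : TimedWord α) :
    synReset L (u ++ w) = synReset L (v ++ w) := by
  classical
  induction w using List.reverseRecOn with
  | nil => simpa using h
  | append_singleton w p ih =>
      obtain ⟨t, a⟩ := p
      rw [← List.append_assoc, ← List.append_assoc, synReset_snoc, synReset_snoc, ih,
        List.append_assoc u, List.append_assoc v, residualLang_append, h', ← residualLang_append]

end

/-! ### The syntactic reset function compared with the clock of a strict machine -/

namespace RegionMachine

variable {α : Type u} {K : ℕ} {M : RegionMachine α K}

theorem residualLang_snoc_eq (M : RegionMachine α K) {L : Set (TimedWord α)} {u : TimedWord α}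
    {x : M.X} {ν : ℝ≥0} (h : residualLang L u = {w | M.acc x ν w}) (t : ℝ≥0) (a : α) :
    residualLang L (u ++ [(t, a)]) =
      {w | M.acc (M.step x a (ν + t)).1 (M.clock x a (ν + t)) w} := by
  rw [residualLang_append, h]
  rfl

variable [Finite α]

/-- If the language of a word is recognizable although the clock value is not integral, then the
next delay is irrelevant and the next language is recognizable. -/
theorem residualLang_snoc_of_recognizable (hM : M.IsStrict) {L : Set (TimedWord α)}
    {u : TimedWord α} {x : M.X} {ν : ℝ≥0} (h : residualLang L u = {w | M.acc x ν w})
    (hν : IsNonInt ν) (hrec : IsDTARecognizable (residualLang L u)) (t t' : ℝ≥0) (a : α) :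
    residualLang L (u ++ [(t, a)]) = residualLang L (u ++ [(t', a)]) ∧
      IsDTARecognizable (residualLang L (u ++ [(t, a)])) := by
  have key : ∀ t t', residualLang L (u ++ [(t, a)]) = residualLang L (u ++ [(t', a)]) := by
    intro t t'
    rw [M.residualLang_snoc_eq h, M.residualLang_snoc_eq h]
    ext w
    rw [h] at hrec
    exact acc_cons_iff_of_recognizable hM hν hrec t t' a w
  refine ⟨key t t', ?_⟩
  -- Since the delay is irrelevant, let the clock run to the next integer. There a strict machine
  -- resets, and a state at clock value 0 has a recognizable language.
  rw [key t ((⌊ν⌋₊ : ℝ≥0) + 1 - ν), M.residualLang_snoc_eq h]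
  have e : ν + ((⌊ν⌋₊ : ℝ≥0) + 1 - ν) = ((⌊ν⌋₊ + 1 : ℕ) : ℝ≥0) := by
    push_cast
    exact add_tsub_cancel_of_le (Nat.lt_floor_add_one ν).le
  rw [e, M.clock_of_reset fun hk => isNonInt_iff.1 (hM _ _ _ hk).2 _ rfl]
  exact M.isDTARecognizable_acc_zero _

/-- The syntactic reset function vanishes or follows the clock of a strict machine. -/
theorem synReset_eq_or (hM : M.IsStrict) (u : TimedWord α) :
    synReset M.lang u = (M.conf (M.init, 0) u).2 ∨
      (synReset M.lang u = 0 ∧ IsNonInt (M.conf (M.init, 0) u).2 ∧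
        IsDTARecognizable (residualLang M.lang u)) := by
  induction u using List.reverseRecOn with
  | nil => exact Or.inl rfl
  | append_singleton u p ih =>
      obtain ⟨t, a⟩ := p
      by_cases hrec : IsDTARecognizable (residualLang M.lang (u ++ [(t, a)]))
      · rw [synReset_snoc_of_recognizable hrec]
        rcases conf_snd_eq_zero_or hM (u ++ [(t, a)]) with h | ⟨-, h⟩
        · exact Or.inl h.symm
        · exact Or.inr ⟨rfl, h, hrec⟩
      · left
        rw [synReset_snoc_of_not_recognizable hrec, conf_snoc]
        -- If the machine reset here, the residual would be recognizable, so it keeps its clock and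
        -- both values grow by `t`. The exceptional case cannot precede, because it passes
        -- recognizability on to the next residual.
        rcases ih with h | ⟨-, h1, h2⟩
        · rw [h]
          refine (M.clock_of_keep ?_).symm
          by_contra hk
          refine hrec ?_
          rw [M.residualLang_snoc_eq (M.residualLang_lang u), M.clock_of_reset hk]
          exact M.isDTARecognizable_acc_zero _
        · exact absurd (residualLang_snoc_of_recognizable hM (M.residualLang_lang u) h1 h2 t t a).2
            hrec

theorem synReset_le (hM : M.IsStrict) (u : TimedWord α) : synReset M.lang u ≤ K := by
  rcases synReset_eq_or hM u with h | ⟨h, -⟩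
  · rw [h]
    rcases conf_snd_eq_zero_or hM u with h' | ⟨h', -⟩
    · rw [h']; exact zero_le
    · exact h'
  · rw [h]; exact zero_le

theorem not_isPosInt_synReset (hM : M.IsStrict) (u : TimedWord α) :
    ¬ IsPosInt (synReset M.lang u) := by
  rcases synReset_eq_or hM u with h | ⟨h, -⟩
  · rw [h]
    rcases conf_snd_eq_zero_or hM u with h' | ⟨-, h'⟩
    · rw [h']; exact not_isPosInt_zero
    · exact h'.not_isPosInt
  · rw [h]; exact not_isPosInt_zero

/-- Above `K` a strict machine resets and makes the same move for both delays. In the exceptional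
case of `synReset_eq_or` no delay matters at all. -/
theorem residualLang_snoc_of_gt (hM : M.IsStrict) {u : TimedWord α} {t t' : ℝ≥0} {a : α}
    (h : (K : ℝ≥0) < synReset M.lang u + t) (h' : (K : ℝ≥0) < synReset M.lang u + t') :
    residualLang M.lang (u ++ [(t, a)]) = residualLang M.lang (u ++ [(t', a)]) := by
  rcases synReset_eq_or hM u with h1 | ⟨-, h2, h3⟩
  · rw [h1] at h h'
    have hs := M.region (M.conf (M.init, 0) u).1 a _ _ (KRegionEquiv.of_gt h h')
    have hk : ∀ y : ℝ≥0, (K : ℝ≥0) < y → ¬ (M.step (M.conf (M.init, 0) u).1 a y).2 = true :=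
      fun y hy hk => absurd (hM _ _ _ hk).1 (not_le.2 hy)
    rw [M.residualLang_snoc_eq (M.residualLang_lang u), M.residualLang_snoc_eq
      (M.residualLang_lang u), M.clock_of_reset (hk _ h), M.clock_of_reset (hk _ h'), hs]
  · exact (residualLang_snoc_of_recognizable hM (M.residualLang_lang u) h2 h3 t t' a).1

end RegionMachine

/-! ### Normal forms -/

section

variable {α : Type u}

theorem normalFormAux_snoc (R : TimedWord α → ℝ≥0) (w : TimedWord α) (t : ℝ≥0) (a : α) :
    ∀ pre, normalFormAux R pre (w ++ [(t, a)]) =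
      normalFormAux R pre w ++ [(hi (R (pre ++ w) + t) - hi (R (pre ++ w)), a)] := by
  induction w with
  | nil => intro pre; simp [normalFormAux]
  | cons p w ih =>
      intro pre
      obtain ⟨s, b⟩ := p
      simp [normalFormAux, ih]

theorem normalForm_snoc (R : TimedWord α → ℝ≥0) (w : TimedWord α) (t : ℝ≥0) (a : α) :
    normalForm R (w ++ [(t, a)]) = normalForm R w ++ [(hi (R w + t) - hi (R w), a)] :=
  normalFormAux_snoc R w t a []

theorem isHIWord_nil : IsHIWord ([] : TimedWord α) := fun _ h => absurd h (by simp)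

theorem isHIWord_append {u v : TimedWord α} : IsHIWord (u ++ v) ↔ IsHIWord u ∧ IsHIWord v := by
  simp only [IsHIWord, List.mem_append]
  exact ⟨fun h => ⟨fun p hp => h p (Or.inl hp), fun p hp => h p (Or.inr hp)⟩,
    fun h p hp => hp.elim (h.1 p) (h.2 p)⟩

theorem isHIWord_cons {p : ℝ≥0 × α} {v : TimedWord α} :
    IsHIWord (p :: v) ↔ IsHalfInt p.1 ∧ IsHIWord v := by
  simp [IsHIWord]

theorem isHIWord_singleton {p : ℝ≥0 × α} : IsHIWord [p] ↔ IsHalfInt p.1 := by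
  simp [IsHIWord]

theorem isHIWord_normalFormAux (R : TimedWord α → ℝ≥0) (w : TimedWord α) :
    ∀ pre, IsHIWord (normalFormAux R pre w) := by
  induction w with
  | nil => intro pre; exact isHIWord_nil
  | cons p w ih =>
      intro pre
      obtain ⟨t, a⟩ := p
      exact isHIWord_cons.2 ⟨(isHalfInt_hi _).tsub (isHalfInt_hi _), ih _⟩

theorem IsResetFunction.isHalfInt {R : TimedWord α → ℝ≥0} (hR : IsResetFunction R)
    {w : TimedWord α} (hw : IsHIWord w) : IsHalfInt (R w) := by
  induction w using List.reverseRecOn with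
  | nil => rw [hR.nil]; exact isHalfInt_zero
  | append_singleton w p ih =>
      obtain ⟨t, a⟩ := p
      rw [isHIWord_append, isHIWord_singleton] at hw
      rcases hR.snoc w t a with h | h
      · rw [h]; exact isHalfInt_zero
      · rw [h]; exact (ih hw.1).add hw.2

end

namespace RegionMachine

variable {α : Type u} {K : ℕ}

theorem isHalfInt_conf (M : RegionMachine α K) {w : TimedWord α} (hw : IsHIWord w) :
    IsHalfInt (M.conf (M.init, 0) w).2 := by
  induction w using List.reverseRecOn with
  | nil => exact isHalfInt_zero
  | append_singleton w p ih =>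
      obtain ⟨t, a⟩ := p
      rw [isHIWord_append, isHIWord_singleton] at hw
      rw [conf_snoc, clock]
      split_ifs
      · exact (ih hw.1).add hw.2
      · exact isHalfInt_zero

/-- The language and the reset value of `v` are those of `u`, up to moving the clock value of `u`
to its half-integral representative. -/
def Matches (M : RegionMachine α K) (u v : TimedWord α) : Prop :=
  (synReset M.lang u = 0 ∧ synReset M.lang v = 0 ∧
    residualLang M.lang u = residualLang M.lang v) ∨
  ∃ x : M.X, residualLang M.lang u = {w | M.acc x (synReset M.lang u) w} ∧
    residualLang M.lang v = {w | M.acc x (synReset M.lang v) w} ∧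
    synReset M.lang v = hi (synReset M.lang u)

theorem Matches.synReset_eq {M : RegionMachine α K} {u v : TimedWord α} (h : M.Matches u v) :
    synReset M.lang v = hi (synReset M.lang u) := by
  rcases h with ⟨h1, h2, -⟩ | ⟨-, -, -, h⟩
  · rw [h1, h2, hi_zero]
  · exact h

theorem Matches.mem_iff {M : RegionMachine α K} {u v : TimedWord α} (h : M.Matches u v) :
    u ∈ M.lang ↔ v ∈ M.lang := by
  have key : ∀ u : TimedWord α, u ∈ M.lang ↔ [] ∈ residualLang M.lang u := fun u => by
    simp [residualLang]
  rw [key, key]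
  rcases h with ⟨-, -, h⟩ | ⟨x, h1, h2, -⟩
  · rw [h]
  · rw [h1, h2]
    rfl

variable [Finite α]

theorem Matches.snoc_of_acc {M : RegionMachine α K} (hM : M.IsStrict) {u v : TimedWord α} {x : M.X}
    (hu : residualLang M.lang u = {w | M.acc x (synReset M.lang u) w})
    (hv : residualLang M.lang v = {w | M.acc x (synReset M.lang v) w})
    (huv : synReset M.lang v = hi (synReset M.lang u)) (t : ℝ≥0) (a : α) :
    M.Matches (u ++ [(t, a)])
      (v ++ [(hi (synReset M.lang u + t) - hi (synReset M.lang u), a)]) := by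
  set t' := hi (synReset M.lang u + t) - hi (synReset M.lang u) with ht'
  set y := synReset M.lang u + t with hy
  have hz : synReset M.lang v + t' = hi y := by
    rw [huv, ht']
    exact add_tsub_cancel_of_le (hi_mono le_self_add)
  have hyz : KRegionEquiv K y (hi y) := kRegionEquiv_hi K y
  have hu' := M.residualLang_snoc_eq hu t a
  have hv' := M.residualLang_snoc_eq hv t' a
  rw [← hy] at hu'
  rw [hz, ← M.region x a _ _ hyz] at hv'
  by_cases hk : (M.step x a y).2 = true
  · have hk' : (M.step x a (hi y)).2 = true := by rw [← M.region x a _ _ hyz, hk]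
    rw [M.clock_of_keep hk] at hu'
    rw [M.clock_of_keep hk'] at hv'
    have hny : IsNonInt y := (hM _ _ _ hk).2
    have hnz : IsNonInt (hi y) := (hM _ _ _ hk').2
    by_cases hrec : IsDTARecognizable (residualLang M.lang (u ++ [(t, a)]))
    · have e : residualLang M.lang (u ++ [(t, a)]) = residualLang M.lang (v ++ [(t', a)]) := by
        rw [hu', hv']
        exact setOf_acc_eq_of_recognizable hM hny (hu' ▸ hrec) hyz
      exact Or.inl ⟨synReset_snoc_of_recognizable hrec,
        synReset_snoc_of_recognizable (e ▸ hrec), e⟩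
    -- The value `hi y` is nonintegral as well, so rigidity also transfers recognizability from `v`
    -- back to `u`.
    · have hrec' : ¬ IsDTARecognizable (residualLang M.lang (v ++ [(t', a)])) := by
        intro h
        rw [hv', setOf_acc_eq_of_recognizable hM hnz (hv' ▸ h) hyz.symm, ← hu'] at h
        exact hrec h
      refine Or.inr ⟨(M.step x a y).1, ?_, ?_, ?_⟩
      · rw [synReset_snoc_of_not_recognizable hrec, hu']
      · rw [synReset_snoc_of_not_recognizable hrec', hv', hz]
      · rw [synReset_snoc_of_not_recognizable hrec', synReset_snoc_of_not_recognizable hrec, hz]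
  · have hk' : ¬ (M.step x a (hi y)).2 = true := by rwa [← M.region x a _ _ hyz]
    rw [M.clock_of_reset hk] at hu'
    rw [M.clock_of_reset hk'] at hv'
    have hrec := M.isDTARecognizable_acc_zero (M.step x a y).1
    exact Or.inl ⟨synReset_snoc_of_recognizable (hu' ▸ hrec),
      synReset_snoc_of_recognizable (hv' ▸ hrec), hu'.trans hv'.symm⟩

theorem Matches.snoc {M : RegionMachine α K} (hM : M.IsStrict) {u v : TimedWord α}
    (h : M.Matches u v) (t : ℝ≥0) (a : α) :
    M.Matches (u ++ [(t, a)])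
      (v ++ [(hi (synReset M.lang u + t) - hi (synReset M.lang u), a)]) := by
  rcases h with ⟨hu, hv, huv⟩ | ⟨x, hu, hv, huv⟩
  -- If the clock of the machine is also 0, its state after `u` serves both words. Otherwise the
  -- clock has become useless, and the delays `t` and `t'` lead to the same residual.
  · rcases synReset_eq_or hM u with h | ⟨-, h1, h2⟩
    · have e := M.residualLang_lang u
      rw [← h] at e
      refine Matches.snoc_of_acc hM e ?_ ?_ t a
      · rw [← huv, e, hu, hv]
      · rw [hu, hv, hi_zero]
    · set t' := hi (synReset M.lang u + t) - hi (synReset M.lang u)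
      obtain ⟨h3, h4⟩ := residualLang_snoc_of_recognizable hM (M.residualLang_lang u) h1 h2 t t' a
      have e : residualLang M.lang (u ++ [(t, a)]) = residualLang M.lang (v ++ [(t', a)]) := by
        rw [h3, residualLang_append, huv, ← residualLang_append]
      exact Or.inl ⟨synReset_snoc_of_recognizable h4, synReset_snoc_of_recognizable (e ▸ h4), e⟩
  · exact Matches.snoc_of_acc hM hu hv huv t a

theorem matches_normalForm {M : RegionMachine α K} (hM : M.IsStrict) (u : TimedWord α) :
    M.Matches u (normalForm (synReset M.lang) u) := by
  induction u using List.reverseRecOn with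
  | nil => exact Or.inl ⟨rfl, rfl, rfl⟩
  | append_singleton u p ih =>
      obtain ⟨t, a⟩ := p
      rw [normalForm_snoc]
      exact ih.snoc hM t a

end RegionMachine

/-! ### Consequences for recognizable languages -/

namespace IsDTARecognizable

variable {α : Type u} [Finite α] {L : Set (TimedWord α)}

theorem isStrictResetFunction_synReset (hL : IsDTARecognizable L) :
    IsStrictResetFunction (synReset L) where
  toIsResetFunction := isResetFunction_synReset L
  not_posInt u := by
    obtain ⟨_, M, hM, rfl⟩ := hL.exists_machine
    exact RegionMachine.not_isPosInt_synReset hM u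

theorem synReset_le_minConst (hL : IsDTARecognizable L) (u : TimedWord α) :
    synReset L u ≤ minConst L := by
  obtain ⟨M, hM, hML⟩ := hL.exists_machine_minConst
  have := RegionMachine.synReset_le hM u
  rwa [hML] at this

theorem residualLang_snoc_of_minConst_lt (hL : IsDTARecognizable L) {u : TimedWord α} {t t' : ℝ≥0}
    {a : α} (h : (minConst L : ℝ≥0) < synReset L u + t)
    (h' : (minConst L : ℝ≥0) < synReset L u + t') :
    residualLang L (u ++ [(t, a)]) = residualLang L (u ++ [(t', a)]) := by
  obtain ⟨M, hM, hML⟩ := hL.exists_machine_minConst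
  have := RegionMachine.residualLang_snoc_of_gt hM (u := u) (t := t) (t' := t') (a := a)
  rw [hML] at this
  exact this h h'

theorem synReset_snoc_of_minConst_lt (hL : IsDTARecognizable L) {u : TimedWord α} {t : ℝ≥0}
    {a : α} (h : (minConst L : ℝ≥0) < synReset L u + t) : synReset L (u ++ [(t, a)]) = 0 := by
  rcases (isResetFunction_synReset L).snoc u t a with h' | h'
  · exact h'
  · have := hL.synReset_le_minConst (u ++ [(t, a)])
    rw [h'] at this
    exact absurd h (not_lt.2 this)

theorem synReset_normalForm (hL : IsDTARecognizable L) (u : TimedWord α) :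
    synReset L (normalForm (synReset L) u) = hi (synReset L u) := by
  obtain ⟨_, M, hM, rfl⟩ := hL.exists_machine
  exact (RegionMachine.matches_normalForm hM u).synReset_eq

theorem normalForm_mem_iff (hL : IsDTARecognizable L) (u : TimedWord α) :
    u ∈ L ↔ normalForm (synReset L) u ∈ L := by
  obtain ⟨_, M, hM, rfl⟩ := hL.exists_machine
  exact (RegionMachine.matches_normalForm hM u).mem_iff

/-- On half-integral words both `synReset L` and the clock of a strict machine with constant
`minConst L` are half-integral and at most `minConst L`. The configuration of the machine determines
the residual. -/
theorem finite_synSetoid (hL : IsDTARecognizable L) : Finite (Quotient (synSetoid L)) := by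
  obtain ⟨M, hM, hML⟩ := hL.exists_machine_minConst
  have := M.finite_X
  have hle : ∀ x : ℝ≥0, IsHalfInt x → x ≤ minConst L →
      ∃ k : Fin (2 * minConst L + 1), x = ((k : ℕ) : ℝ≥0) / 2 := by
    rintro x ⟨k, rfl⟩ hx
    refine ⟨⟨k, ?_⟩, rfl⟩
    rw [div_le_iff₀ (by norm_num)] at hx
    have : k ≤ minConst L * 2 := by exact_mod_cast hx
    omega
  let f : Quotient (synSetoid L) → ℝ≥0 × Set (TimedWord α) :=
    Quotient.lift (fun w => (synReset L w.1, residualLang L w.1)) fun _ _ h => Prod.ext h.1 h.2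
  have hf : Function.Injective f := by
    rintro ⟨u⟩ ⟨v⟩ h
    exact Quotient.sound ⟨(Prod.ext_iff.1 h).1, (Prod.ext_iff.1 h).2⟩
  refine Set.finite_univ_iff.1 (Set.Finite.of_finite_image (f := f) ?_ hf.injOn)
  refine Set.Finite.subset (Set.finite_range
    fun i : Fin (2 * minConst L + 1) × M.X × Fin (2 * minConst L + 1) =>
      ((((i.1 : ℕ) : ℝ≥0) / 2, {w | M.acc i.2.1 (((i.2.2 : ℕ) : ℝ≥0) / 2) w}) :
        ℝ≥0 × Set (TimedWord α))) ?_
  rintro _ ⟨⟨u⟩, -, rfl⟩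
  obtain ⟨k, hk⟩ := hle _ ((isResetFunction_synReset L).isHalfInt u.2)
    (hL.synReset_le_minConst u.1)
  obtain ⟨j, hj⟩ := hle _ (M.isHalfInt_conf u.2) (by
    rcases RegionMachine.conf_snd_eq_zero_or hM u.1 with h | ⟨h, -⟩
    · rw [h]; exact zero_le
    · exact h)
  refine ⟨(k, (M.conf (M.init, 0) u.1).1, j), Prod.ext hk.symm ?_⟩
  simp only
  rw [← hj, ← M.residualLang_lang, hML]

end IsDTARecognizable

/-! ### Runs of deterministic automata -/

namespace OneTA

variable {α : Type u} {A : OneTA α}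

theorem IsDeterministic.run_unique (hA : A.IsDeterministic) {w : TimedWord α} :
    ∀ {q : A.Q} {ν : ℝ≥0} {θs θs' : List (ClockTransition α A.Q)} {q₁ q₂ : A.Q} {ν₁ ν₂ : ℝ≥0},
      A.Run q ν w θs q₁ ν₁ → A.Run q ν w θs' q₂ ν₂ → θs = θs' ∧ q₁ = q₂ ∧ ν₁ = ν₂ := by
  induction w with
  | nil =>
      intro q ν θs θs' q₁ q₂ ν₁ ν₂ h h'
      obtain ⟨rfl, rfl, rfl⟩ := run_nil_iff.1 h
      obtain ⟨rfl, rfl, rfl⟩ := run_nil_iff.1 h'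
      exact ⟨rfl, rfl, rfl⟩
  | cons p w ih =>
      intro q ν θs θs' q₁ q₂ ν₁ ν₂ h h'
      obtain ⟨t, a⟩ := p
      obtain ⟨θ, hθ, h1, h2, h3, σ, rfl, hrun⟩ := run_cons_iff.1 h
      obtain ⟨θ', hθ', h1', h2', h3', σ', rfl, hrun'⟩ := run_cons_iff.1 h'
      have hθθ : θ = θ' := by
        by_contra hne
        rcases hA θ hθ θ' hθ' hne with h5 | h5 | h5
        · exact h5 (h1.trans h1'.symm)
        · exact h5 (h2.trans h2'.symm)
        · exact Set.disjoint_left.1 h5 h3 h3'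
      subst hθθ
      obtain ⟨rfl, rfl, rfl⟩ := ih hrun hrun'
      exact ⟨rfl, rfl, rfl⟩

theorem Run.append_singleton {w : TimedWord α} {t : ℝ≥0} {θ : ClockTransition α A.Q}
    (hθ : θ ∈ A.trans) :
    ∀ {q : A.Q} {ν : ℝ≥0} {θs : List (ClockTransition α A.Q)} {ν' : ℝ≥0},
      A.Run q ν w θs θ.src ν' → ν' + t ∈ θ.guard.denote →
      A.Run q ν (w ++ [(t, θ.letter)]) (θs ++ [θ]) θ.tgt (if θ.keep then ν' + t else 0) := by
  induction w with
  | nil =>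
      intro q ν θs ν' h hg
      obtain ⟨rfl, rfl, rfl⟩ := run_nil_iff.1 h
      exact .cons θ _ t [] [] _ _ hθ hg (.nil _ _)
  | cons p w ih =>
      intro q ν θs ν' h hg
      obtain ⟨s, b⟩ := p
      obtain ⟨θ', hθ', rfl, rfl, h3, σ, rfl, hrun⟩ := run_cons_iff.1 h
      exact .cons θ' _ s _ _ _ _ hθ' h3 (ih hrun hg)

end OneTA

/-! ### The conjecture of a table -/

theorem mem_extensions {α : Type u} {K : ℕ} {S : Set (TimedWord α)} {s : TimedWord α}
    {p : ℝ≥0 × α} (hs : s ∈ S) (hp : p ∈ sigmaK α K) : s ++ [p] ∈ extensions K S :=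
  ⟨s, hs, p, hp, rfl⟩

namespace ObsTable

variable {α : Type u} {T : ObsTable α} {L : Set (TimedWord α)}

theorem row_eq_iff {s s' : TimedWord α} :
    T.row s = T.row s' ↔ ∀ e ∈ T.E, T.entry s e = T.entry s' e := by
  constructor
  · intro h e he
    exact congrFun h ⟨e, he⟩
  · intro h
    funext e
    exact h e.1 e.2

theorem r_eq_of_row_eq {s s' : TimedWord α} (h : T.row s = T.row s') : T.r s = T.r s' :=
  congrArg Prod.snd (row_eq_iff.1 h [] T.nil_mem_E)

theorem cell_nil {s : TimedWord α} (hs : s ∈ T.S ∪ extensions T.K T.S) :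
    (s, []) ∈ cells T.K T.S T.E := ⟨hs, T.nil_mem_E⟩

theorem isHalfInt_r {s : TimedWord α} (hs : s ∈ T.S ∪ extensions T.K T.S) : IsHalfInt (T.r s) :=
  (T.range_entry s [] (cell_nil hs)).1

theorem not_isPosInt_r {s : TimedWord α} (hs : s ∈ T.S ∪ extensions T.K T.S) :
    ¬ IsPosInt (T.r s) :=
  (T.range_entry s [] (cell_nil hs)).2

theorem Filled.r_nil (h : T.Filled L) : T.r [] = 0 := by
  obtain ⟨-, R, hR, hRT⟩ := h
  rw [r, hRT _ _ (cell_nil (Or.inl T.nil_mem_S))]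
  exact hR.nil

theorem Filled.r_snoc (h : T.Filled L) {s : TimedWord α} {p : ℝ≥0 × α} (hs : s ∈ T.S)
    (hp : p ∈ sigmaK α T.K) : T.r (s ++ [p]) = 0 ∨ T.r (s ++ [p]) = T.r s + p.1 := by
  obtain ⟨-, R, hR, hRT⟩ := h
  rw [r, r, hRT _ _ (cell_nil (Or.inl hs)), hRT _ _ (cell_nil (Or.inr (mem_extensions hs hp))),
    List.append_nil, List.append_nil]
  exact hR.snoc _ _ _

theorem Ready.r_le (h : T.Ready) {s : TimedWord α} (hs : s ∈ T.S) : T.r s ≤ T.K :=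
  h.2.2.2 s [] (cell_nil (Or.inl hs))

/-- Region-equivalent extensions of words with the same row have the same row. -/
theorem Ready.row_snoc_eq (h : T.Ready) {s s' : TimedWord α} (hs : s ∈ T.S) (hs' : s' ∈ T.S)
    (hss : T.row s = T.row s') {t t' : ℝ≥0} {a : α} (ht : (t, a) ∈ sigmaK α T.K)
    (ht' : (t', a) ∈ sigmaK α T.K) (hr : KRegionEquiv T.K (T.r s + t) (T.r s' + t')) :
    T.row (s ++ [(t, a)]) = T.row (s' ++ [(t', a)]) := by
  obtain ⟨-, hA, hB, -⟩ := h
  by_cases hK : T.r s + t ≤ T.K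
  · have e := IsHalfInt.eq_of_kRegionEquiv ((isHalfInt_r (Or.inl hs)).add ht.1)
      ((isHalfInt_r (Or.inl hs')).add ht'.1) hr hK
    rw [r_eq_of_row_eq hss] at e
    obtain rfl := add_left_cancel e
    exact hA s hs s' hs' hss _ ht
  · rw [not_le] at hK
    rw [hB s t a (Or.inr (mem_extensions hs ht)) hK,
      hB s' t' a (Or.inr (mem_extensions hs' ht')) (hr.lt_iff.1 hK)]
    exact hA s hs s' hs' hss _ (natCast_add_half_mem_sigmaK _ _)

/-- Up to `K`, `r(s)` is `hi ν`, and the delay leading from there to `hi (ν + t)` is suitable.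
Beyond `K`, the delay `K + 1/2` works from every clock value. -/
theorem Ready.exists_delay (h : T.Ready) {s : TimedWord α} (hs : s ∈ T.S) {ν : ℝ≥0}
    (hν : KRegionEquiv T.K (T.r s) ν) (t : ℝ≥0) (a : α) :
    ∃ t', (t', a) ∈ sigmaK α T.K ∧ KRegionEquiv T.K (T.r s + t') (ν + t) := by
  by_cases hK : ν + t ≤ T.K
  · have hr : T.r s = hi ν := IsHalfInt.eq_of_kRegionEquiv (isHalfInt_r (Or.inl hs))
      (isHalfInt_hi ν) (hν.trans (kRegionEquiv_hi _ _)) (h.r_le hs)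
    have e : T.r s + (hi (ν + t) - T.r s) = hi (ν + t) := by
      rw [hr]
      exact add_tsub_cancel_of_le (hi_mono le_self_add)
    refine ⟨hi (ν + t) - T.r s, ?_, ?_⟩
    · refine IsHalfInt.mem_sigmaK_of_le
        ((isHalfInt_hi _).tsub (isHalfInt_r (Or.inl hs))) (tsub_le_self.trans ?_) a
      simpa [hi_natCast] using hi_mono hK
    · rw [e]
      exact (kRegionEquiv_hi _ _).symm
  · refine ⟨_, natCast_add_half_mem_sigmaK T.K a, KRegionEquiv.of_gt ?_ (not_le.1 hK)⟩
    exact lt_of_lt_of_le (natCast_lt_add_half _) le_add_self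

open Classical in
-- A nonzero `r(s')` equals `r(sp)`, which can then only be `r(s) + p.1` because the entries come
-- from a reset function. So table and automaton keep the clock together.
theorem kRegionEquiv_next (hF : T.Filled L) {s s' : TimedWord α} (hs : s ∈ T.S) {p : ℝ≥0 × α}
    (hp : p ∈ sigmaK α T.K) (h : T.row (s ++ [p]) = T.row s') {y : ℝ≥0}
    (hy : KRegionEquiv T.K (T.r s + p.1) y) :
    KRegionEquiv T.K (T.r s') (if (!decide (T.r s' = 0)) = true then y else 0) := by
  by_cases h0 : T.r s' = 0
  · simp [h0, KRegionEquiv.refl]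
  · have e := r_eq_of_row_eq h
    rcases hF.r_snoc hs hp with h1 | h1
    · exact absurd (e.symm.trans h1) h0
    · simp only [h0, decide_false, Bool.not_false, if_true]
      rwa [← e, h1]

/-! ### The conjecture of a filled and ready table is a strict acceptor -/

section Conj

variable [Finite α]

/-- The state of the conjecture that belongs to a row word. -/
def state (T : ObsTable α) (s : TimedWord α) (hs : s ∈ T.S) : T.conj.Q :=
  ⟨T.row s, Set.mem_image_of_mem _ hs⟩

theorem state_eq {s s' : TimedWord α} (hs : s ∈ T.S) (hs' : s' ∈ T.S) (h : T.row s = T.row s') :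
    T.state s hs = T.state s' hs' := Subtype.ext h

open Classical in
theorem mem_trans_conj_iff {θ : ClockTransition α T.conj.Q} :
    θ ∈ T.conj.trans ↔ ∃ (s s' : TimedWord α) (hs : s ∈ T.S) (hs' : s' ∈ T.S) (p : ℝ≥0 × α),
      p ∈ sigmaK α T.K ∧ T.row (s ++ [p]) = T.row s' ∧
      θ = ⟨T.state s hs, T.state s' hs', p.2, regionGuard T.K (T.r s + p.1),
        !decide (T.r s' = 0)⟩ := by
  constructor
  · rintro ⟨s, hs, s', hs', p, hp, h, h1, h2, h3, h4, h5⟩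
    refine ⟨s, s', hs, hs', p, hp, h, ?_⟩
    obtain ⟨q, q', a, g, k⟩ := θ
    simp only at h1 h2 h3 h4 h5
    subst h3 h4 h5
    congr 1
    · exact Subtype.ext h1
    · exact Subtype.ext h2
  · rintro ⟨s, s', hs, hs', p, hp, h, rfl⟩
    exact ⟨s, hs, s', hs', p, hp, h, rfl, rfl, rfl, rfl, rfl⟩

/-- Guards that meet are the same region, and by `Ready.row_snoc_eq` they then lead to the same row,
hence to the same reset. -/
theorem Ready.isDeterministic_conj (h : T.Ready) : T.conj.IsDeterministic := by
  classical
  intro θ hθ θ₁ hθ₁ hne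
  obtain ⟨s, s', hs, hs', ⟨t, a⟩, hp, hrow, rfl⟩ := mem_trans_conj_iff.1 hθ
  obtain ⟨s₁, s₁', hs₁, hs₁', ⟨t₁, a₁⟩, hp₁, hrow₁, rfl⟩ := mem_trans_conj_iff.1 hθ₁
  by_contra hcon
  push Not at hcon
  obtain ⟨h1, h2, h3⟩ := hcon
  simp only at h1 h2 h3
  subst h2
  have hss : T.row s = T.row s₁ := congrArg Subtype.val h1
  obtain ⟨z, hz, hz'⟩ := Set.not_disjoint_iff.1 h3
  rw [mem_regionGuard] at hz hz'
  have hr := hz.trans hz'.symm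
  have htgt : T.row s' = T.row s₁' := by
    rw [← hrow, ← hrow₁]
    exact h.row_snoc_eq hs hs₁ hss hp hp₁ hr
  apply hne
  simp only [h1, hr.regionGuard_eq, state_eq hs' hs₁' htgt, r_eq_of_row_eq htgt]

/-- Every clock value reached in the state of `s` is equivalent to `r(s)`. -/
theorem Filled.run_conj (hF : T.Filled L) {w : TimedWord α} :
    ∀ {s : TimedWord α} (hs : s ∈ T.S) {ν : ℝ≥0} {θs : List (ClockTransition α T.conj.Q)}
      {q : T.conj.Q} {ν' : ℝ≥0}, KRegionEquiv T.K (T.r s) ν →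
      T.conj.Run (T.state s hs) ν w θs q ν' →
      ∃ (s' : TimedWord α) (hs' : s' ∈ T.S), q = T.state s' hs' ∧ KRegionEquiv T.K (T.r s') ν' := by
  classical
  induction w with
  | nil =>
      intro s hs ν θs q ν' hν hrun
      obtain ⟨-, rfl, rfl⟩ := OneTA.run_nil_iff.1 hrun
      exact ⟨s, hs, rfl, hν⟩
  | cons p w ih =>
      intro s hs ν θs q ν' hν hrun
      obtain ⟨t, a⟩ := p
      obtain ⟨θ, hθ, h1, h2, h3, σ, rfl, hrun'⟩ := OneTA.run_cons_iff.1 hrun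
      obtain ⟨s₁, s₁', hs₁, hs₁', p, hp, hrow, rfl⟩ := mem_trans_conj_iff.1 hθ
      exact ih hs₁' (kRegionEquiv_next hF hs₁ hp hrow (mem_regionGuard.1 h3)) hrun'

theorem Filled.run_conj_init (hF : T.Filled L) {w : TimedWord α}
    {θs : List (ClockTransition α T.conj.Q)} {q : T.conj.Q} {ν : ℝ≥0}
    (hrun : T.conj.Run T.conj.init 0 w θs q ν) :
    ∃ (s : TimedWord α) (hs : s ∈ T.S), q = T.state s hs ∧ KRegionEquiv T.K (T.r s) ν :=
  hF.run_conj T.nil_mem_S (by rw [hF.r_nil]; exact KRegionEquiv.refl _ _) hrun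

open Classical in
/-- The transition of the conjecture along a region-equivalent delay. -/
theorem run_conj_snoc {w : TimedWord α} {θs : List (ClockTransition α T.conj.Q)}
    {s s' : TimedWord α} (hs : s ∈ T.S) (hs' : s' ∈ T.S) {q : T.conj.Q} {μ ν t t' : ℝ≥0} {a : α}
    (hrun : T.conj.Run q μ w θs (T.state s hs) ν) (ht' : (t', a) ∈ sigmaK α T.K)
    (hrow : T.row (s ++ [(t', a)]) = T.row s') (hr : KRegionEquiv T.K (T.r s + t') (ν + t)) :
    ∃ θs', T.conj.Run q μ (w ++ [(t, a)]) θs' (T.state s' hs')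
      (if T.r s' = 0 then 0 else ν + t) := by
  have hθ := mem_trans_conj_iff.2 ⟨s, s', hs, hs', (t', a), ht', hrow, rfl⟩
  have := OneTA.Run.append_singleton hθ hrun (t := t) (mem_regionGuard.2 hr)
  have e : (if T.r s' = 0 then 0 else ν + t) =
      if (!decide (T.r s' = 0)) = true then ν + t else 0 := by
    by_cases h : T.r s' = 0 <;> simp [h]
  rw [e]
  exact ⟨_, this⟩

theorem Ready.exists_run_conj (h : T.Ready) (hF : T.Filled L) (w : TimedWord α) :
    ∃ θs q ν, T.conj.Run T.conj.init 0 w θs q ν := by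
  classical
  induction w using List.reverseRecOn with
  | nil => exact ⟨_, _, _, .nil _ _⟩
  | append_singleton w p ih =>
      obtain ⟨t, a⟩ := p
      obtain ⟨θs, q, ν, hrun⟩ := ih
      obtain ⟨s, hs, rfl, hν⟩ := hF.run_conj_init hrun
      obtain ⟨t', ht', hr⟩ := h.exists_delay hs hν t a
      obtain ⟨s', hs', hrow⟩ := h.1 _ (mem_extensions hs ht')
      obtain ⟨θs', hrun'⟩ := run_conj_snoc hs hs' hrun ht' hrow hr
      exact ⟨θs', _, _, hrun'⟩

theorem Ready.mem_lang_conj_iff (h : T.Ready) {w : TimedWord α}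
    {θs : List (ClockTransition α T.conj.Q)} {s : TimedWord α} (hs : s ∈ T.S) {ν : ℝ≥0}
    (hrun : T.conj.Run T.conj.init 0 w θs (T.state s hs) ν) :
    w ∈ T.conj.lang ↔ (T.entry s []).1 = true := by
  constructor
  · rintro ⟨θs', q, ν', hrun', hq⟩
    obtain ⟨-, rfl, -⟩ := h.isDeterministic_conj.run_unique hrun hrun'
    exact hq
  · intro hq
    exact ⟨θs, _, ν, hrun, hq⟩

/-- The constant `K` is attained: the delay `K + 1/2` after the empty word, where the clock is 0,
produces the guard `K < x`. -/
theorem maxConst_conj [Nonempty α] (h : T.Ready) (hF : T.Filled L) : T.conj.maxConst = T.K := by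
  classical
  have hle : ∀ k ∈ (fun θ : ClockTransition α T.conj.Q => θ.guard.maxConst) '' T.conj.trans,
      k ≤ T.K := by
    rintro _ ⟨θ, hθ, rfl⟩
    obtain ⟨s, s', hs, hs', p, hp, hrow, rfl⟩ := mem_trans_conj_iff.1 hθ
    exact maxConst_regionGuard_le _ _
  obtain ⟨a⟩ := ‹Nonempty α›
  have hp := natCast_add_half_mem_sigmaK T.K a
  obtain ⟨s', hs', hrow⟩ := h.1 _ (mem_extensions T.nil_mem_S hp)
  have hθ := mem_trans_conj_iff.2 ⟨[], s', T.nil_mem_S, hs', _, hp, hrow, rfl⟩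
  have hmem : T.K ∈ (fun θ : ClockTransition α T.conj.Q => θ.guard.maxConst) '' T.conj.trans := by
    refine ⟨_, hθ, ?_⟩
    have hK : ¬ T.r [] + ((T.K : ℝ≥0) + 1 / 2) ≤ T.K := by
      rw [hF.r_nil, zero_add, not_le]
      exact natCast_lt_add_half _
    simp only [regionGuard, if_neg hK, ClockConstraint.maxConst]
  exact le_antisymm (csSup_le ⟨_, hmem⟩ hle) (le_csSup ⟨T.K, hle⟩ hmem)

theorem Ready.isStrictAcceptor_conj [Nonempty α] (h : T.Ready) (hF : T.Filled L) :
    T.conj.IsStrictAcceptor T.K where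
  det := h.isDeterministic_conj
  complete w := by
    obtain ⟨θs, q, ν, hrun⟩ := h.exists_run_conj hF w
    refine ⟨θs, ⟨q, ν, hrun⟩, ?_⟩
    rintro θs' ⟨q', ν', hrun'⟩
    exact (h.isDeterministic_conj.run_unique hrun' hrun).1
  maxConst_eq := maxConst_conj h hF
  guard_region θ hθ := by
    obtain ⟨s, s', hs, hs', p, hp, hrow, rfl⟩ := mem_trans_conj_iff.1 hθ
    exact ⟨_, denote_regionGuard _ _⟩
  region := by
    classical
    refine ⟨fun q => {z | KRegionEquiv T.K (q.1 ⟨[], T.nil_mem_E⟩).2 z}, fun q => ⟨_, rfl⟩,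
      ?_, ?_, ?_⟩
    · intro w θs q ν hrun
      obtain ⟨s, hs, rfl, hν⟩ := hF.run_conj_init hrun
      exact hν
    · rintro q ⟨θ, hθ, rfl, hk⟩
      obtain ⟨s, s', hs, hs', p, hp, hrow, rfl⟩ := mem_trans_conj_iff.1 hθ
      have h0 : T.r s' = 0 := by simpa using hk
      refine ⟨?_, ?_⟩
      · ext z
        show KRegionEquiv T.K (T.r s') z ↔ z = 0
        rw [h0, kRegionEquiv_zero_iff]
      · intro θ₁ hθ₁ htgt
        obtain ⟨s₁, s₁', hs₁, hs₁', p₁, hp₁, hrow₁, rfl⟩ := mem_trans_conj_iff.1 hθ₁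
        have : T.r s₁' = T.r s' := r_eq_of_row_eq (congrArg Subtype.val htgt)
        simp [this, h0]
    · rintro q hq θ hθ rfl
      have hk := hq θ hθ rfl
      obtain ⟨s, s', hs, hs', p, hp, hrow, rfl⟩ := mem_trans_conj_iff.1 hθ
      have h0 : T.r s' ≠ 0 := by simpa using hk
      have e := r_eq_of_row_eq hrow
      have h1 := (hF.r_snoc hs hp).resolve_left fun h1 => h0 (e.symm.trans h1)
      show (regionGuard T.K (T.r s + p.1)).denote = {z | KRegionEquiv T.K (T.r s') z}
      rw [denote_regionGuard, ← e, h1]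
  strict θ hθ c hc := by
    classical
    obtain ⟨s, s', hs, hs', p, hp, hrow, rfl⟩ := mem_trans_conj_iff.1 hθ
    have e := r_eq_of_row_eq hrow
    have hmem : T.r s + p.1 ∈ (regionGuard T.K (T.r s + p.1)).denote :=
      mem_regionGuard.2 (KRegionEquiv.refl _ _)
    simp only at hc
    rw [hc, Set.mem_singleton_iff] at hmem
    -- A clock kept at an equality guard would have an integral value. Positive integers are
    -- excluded from the entries, and the value 0 counts as a reset.
    have h0 : T.r s' = 0 := by
      rw [← e]
      rcases hF.r_snoc hs hp with h1 | h1
      · exact h1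
      · by_contra h2
        refine not_isPosInt_r (Or.inr (mem_extensions hs hp)) ?_
        rw [h1, hmem] at h2 ⊢
        exact ⟨c, Nat.pos_of_ne_zero (by simpa using h2), rfl⟩
    simp [h0]

theorem Ready.run_conj_le (h : T.Ready) (hF : T.Filled L) {w : TimedWord α}
    {θs : List (ClockTransition α T.conj.Q)} {q : T.conj.Q} {ν : ℝ≥0}
    (hrun : T.conj.Run T.conj.init 0 w θs q ν) : ν ≤ (T.K : ℝ≥0) ∧ ¬ IsPosInt ν := by
  obtain ⟨s, hs, rfl, hν⟩ := hF.run_conj_init hrun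
  have hle := hν.le_iff.1 (h.r_le hs)
  refine ⟨hle, ?_⟩
  rintro ⟨k, hk, rfl⟩
  have hkK : k ≤ T.K := by exact_mod_cast hle
  have := ((kRegionEquiv_iff.1 hν k hkK).2).2 rfl
  exact not_isPosInt_r (Or.inl hs) ⟨k, hk, this⟩

end Conj

/-! ### Progress -/

theorem exists_action (h : ¬ T.Ready) : ∃ K' S' E', T.Action K' S' E' := by
  by_cases h1 : T.Closed
  · by_cases h2 : T.ConsistentA
    · by_cases h3 : T.ConsistentB
      · have h4 : ¬ T.Valid := fun h4 => h ⟨h1, h2, h3, h4⟩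
        simp only [Valid, not_forall, not_le] at h4
        obtain ⟨s, e, hse, h4⟩ := h4
        exact ⟨_, _, _, .validate s e hse h4⟩
      · exact ⟨_, _, _, .enlarge h3⟩
    · simp only [ConsistentA, not_forall] at h2
      obtain ⟨s₁, hs₁, s₂, hs₂, hrow, p, hp, hne⟩ := h2
      rw [row_eq_iff] at hne
      push Not at hne
      obtain ⟨e, he, hne⟩ := hne
      exact ⟨_, _, _, .distinguish s₁ s₂ p e hs₁ hs₂ hp he hrow hne⟩
  · simp only [Closed, not_forall, not_exists, not_and] at h1
    obtain ⟨w, hw, hne⟩ := h1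
    exact ⟨_, _, _, .close w hw hne⟩

end ObsTable

/-! ### Prefixes of normal forms -/

section NormalPrefixes

variable {α : Type u}

/-- The nonempty prefixes of the normal forms of a word, read from the clock value `v`. -/
def normalPrefixes : ℝ≥0 → TimedWord α → Set (TimedWord α)
  | _, [] => ∅
  | v, (t, a) :: w => insert [(hi (v + t) - hi v, a)]
      ((fun z => (hi (v + t) - hi v, a) :: z) '' (normalPrefixes 0 w ∪ normalPrefixes (v + t) w))

theorem finite_normalPrefixes (w : TimedWord α) : ∀ v, (normalPrefixes v w).Finite := by
  induction w with
  | nil => intro v; exact Set.finite_empty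
  | cons p w ih =>
      intro v
      obtain ⟨t, a⟩ := p
      exact (((ih _).union (ih _)).image _).insert _

/-- The first delay is fixed by `v`, and after it a reset function only chooses between the clock
values 0 and `v + t`. So the nonempty prefixes are nodes of a binary tree, at most `2 ^ |w| - 1` of
them. -/
theorem ncard_normalPrefixes (w : TimedWord α) :
    ∀ v, (normalPrefixes v w).ncard + 1 ≤ 2 ^ w.length := by
  induction w with
  | nil => intro v; simp [normalPrefixes]
  | cons p w ih =>
      intro v
      obtain ⟨t, a⟩ := p
      have h1 := Set.ncard_insert_le [(hi (v + t) - hi v, a)]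
        ((fun z => (hi (v + t) - hi v, a) :: z) '' (normalPrefixes 0 w ∪ normalPrefixes (v + t) w))
      have h2 := Set.ncard_image_le (f := fun z => (hi (v + t) - hi v, a) :: z)
        ((finite_normalPrefixes w 0).union (finite_normalPrefixes w (v + t)))
      have h3 := Set.ncard_union_le (normalPrefixes 0 w) (normalPrefixes (v + t) w)
      have h4 := ih 0
      have h5 := ih (v + t)
      simp only [normalPrefixes, List.length_cons, pow_succ]
      omega

theorem mem_normalPrefixes {R : TimedWord α → ℝ≥0} (hR : IsResetFunction R) (w : TimedWord α) :
    ∀ pre v, v <+: normalFormAux R pre w → v = [] ∨ v ∈ normalPrefixes (R pre) w := by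
  induction w with
  | nil =>
      intro pre v h
      exact Or.inl (List.prefix_nil.1 h)
  | cons p w ih =>
      intro pre v h
      obtain ⟨t, a⟩ := p
      rw [normalFormAux, List.prefix_cons_iff] at h
      rcases h with rfl | ⟨z, rfl, h⟩
      · exact Or.inl rfl
      · right
        rcases ih _ _ h with rfl | h
        · exact Set.mem_insert _ _
        · refine Set.mem_insert_of_mem _ ⟨z, ?_, rfl⟩
          rcases hR.snoc pre t a with h' | h'
          · rw [h'] at h; exact Or.inl h
          · rw [h'] at h; exact Or.inr h

theorem mem_normalForms_prefix {w v x : TimedWord α} (hx : x ∈ normalForms w) (hv : v <+: x) :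
    v = [] ∨ v ∈ normalPrefixes 0 w := by
  obtain ⟨R, hR, rfl⟩ := hx
  have := mem_normalPrefixes hR w [] v hv
  rwa [hR.nil] at this

end NormalPrefixes

/-! ### Parameters of tables -/

/-- The conditions on the row and column words of a table. -/
structure IsTableShape {α : Type u} (S E : Set (TimedWord α)) : Prop where
  finite_S : S.Finite
  finite_E : E.Finite
  nil_mem_S : [] ∈ S
  nil_mem_E : [] ∈ E
  hi_S : ∀ s ∈ S, IsHIWord s
  hi_E : ∀ e ∈ E, IsHIWord e
  prefix_S : ∀ s ∈ S, ∀ v, v <+: s → v ∈ S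
  suffix_E : ∀ e ∈ E, ∀ v, v <:+ e → v ∈ E

theorem extensions_mono {α : Type u} {K K' : ℕ} {S S' : Set (TimedWord α)} (hK : K ≤ K')
    (hS : S ⊆ S') : extensions K S ⊆ extensions K' S' := by
  rintro _ ⟨s, hs, p, hp, rfl⟩
  refine ⟨s, hS hs, p, ⟨hp.1, lt_of_lt_of_le hp.2 ?_⟩, rfl⟩
  gcongr

theorem cells_mono {α : Type u} {K K' : ℕ} {S S' E E' : Set (TimedWord α)} (hK : K ≤ K')
    (hS : S ⊆ S') (hE : E ⊆ E') : cells K S E ⊆ cells K' S' E' :=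
  Set.prod_mono (Set.union_subset_union hS (extensions_mono hK hS)) hE

namespace IsTableShape

variable {α : Type u} {K : ℕ} {S E : Set (TimedWord α)}

theorem isHIWord (h : IsTableShape S E) {s e : TimedWord α} (hse : (s, e) ∈ cells K S E) :
    IsHIWord (s ++ e) := by
  obtain ⟨hs, he⟩ := hse
  refine isHIWord_append.2 ⟨?_, h.hi_E e he⟩
  rcases hs with hs | ⟨s', hs', p, hp, rfl⟩
  · exact h.hi_S s hs
  · exact isHIWord_append.2 ⟨h.hi_S s' hs', isHIWord_singleton.2 hp.1⟩

theorem trivial : IsTableShape ({[]} : Set (TimedWord α)) {[]} where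
  finite_S := Set.finite_singleton _
  finite_E := Set.finite_singleton _
  nil_mem_S := rfl
  nil_mem_E := rfl
  hi_S := by rintro _ rfl; exact isHIWord_nil
  hi_E := by rintro _ rfl; exact isHIWord_nil
  prefix_S := by rintro _ rfl v hv; exact List.prefix_nil.1 hv
  suffix_E := by rintro _ rfl v hv; exact List.suffix_nil.1 hv

end IsTableShape

namespace ObsTable

variable {α : Type u} {T : ObsTable α} {L : Set (TimedWord α)}

theorem isTableShape (T : ObsTable α) : IsTableShape T.S T.E :=
  ⟨T.finite_S, T.finite_E, T.nil_mem_S, T.nil_mem_E, T.hi_S, T.hi_E, T.prefix_S, T.suffix_E⟩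

theorem mem_S_of_snoc_mem {s : TimedWord α} {p : ℝ≥0 × α}
    (h : s ++ [p] ∈ T.S ∪ extensions T.K T.S) : s ∈ T.S := by
  rcases h with h | ⟨s', hs', p', -, h⟩
  · exact T.prefix_S _ h s (List.prefix_append _ _)
  · obtain ⟨rfl, -⟩ := List.append_inj' h rfl
    exact hs'

theorem Action.mono {K' : ℕ} {S' E' : Set (TimedWord α)} (h : T.Action K' S' E') :
    T.K ≤ K' ∧ T.S ⊆ S' ∧ T.E ⊆ E' := by
  cases h with
  | close w hw hne => exact ⟨le_rfl, Set.subset_union_left, subset_rfl⟩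
  | distinguish => exact ⟨le_rfl, subset_rfl, Set.subset_union_left⟩
  | enlarge => exact ⟨Nat.le_succ _, subset_rfl, subset_rfl⟩
  | validate => exact ⟨Nat.le_succ _, subset_rfl, subset_rfl⟩

theorem Action.isTableShape {K' : ℕ} {S' E' : Set (TimedWord α)} (h : T.Action K' S' E') :
    IsTableShape S' E' := by
  cases h with
  | close w hw hne =>
      obtain ⟨s, hs, p, hp, rfl⟩ := hw
      refine { T.isTableShape with
        finite_S := T.finite_S.union (Set.finite_singleton _)
        nil_mem_S := Or.inl T.nil_mem_S
        hi_S := ?_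
        prefix_S := ?_ }
      · rintro w (hw | rfl)
        · exact T.hi_S w hw
        · exact isHIWord_append.2 ⟨T.hi_S s hs, isHIWord_singleton.2 hp.1⟩
      · rintro w (hw | rfl) v hv
        · exact Or.inl (T.prefix_S w hw v hv)
        · rcases List.prefix_concat_iff.1 hv with rfl | hv
          · exact Or.inr rfl
          · exact Or.inl (T.prefix_S s hs v hv)
  | distinguish s₁ s₂ p e hs₁ hs₂ hp he hrow hne =>
      refine { T.isTableShape with
        finite_E := T.finite_E.union (Set.finite_singleton _)
        nil_mem_E := Or.inl T.nil_mem_E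
        hi_E := ?_
        suffix_E := ?_ }
      · rintro w (hw | rfl)
        · exact T.hi_E w hw
        · exact isHIWord_cons.2 ⟨hp.1, T.hi_E e he⟩
      · rintro w (hw | rfl) v hv
        · exact Or.inl (T.suffix_E w hw v hv)
        · rcases List.suffix_cons_iff.1 hv with rfl | hv
          · exact Or.inr rfl
          · exact Or.inl (T.suffix_E e he v hv)
  | enlarge => exact T.isTableShape
  | validate => exact T.isTableShape

theorem refineRows_subset (T : ObsTable α) (w : TimedWord α) :
    T.refineRows w ⊆ T.S ∪ normalPrefixes 0 w := by
  rintro v (hv | ⟨x, hx, hv⟩)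
  · exact Or.inl hv
  · rcases mem_normalForms_prefix hx hv with rfl | h
    · exact Or.inl T.nil_mem_S
    · exact Or.inr h

theorem isTableShape_refineRows (T : ObsTable α) (w : TimedWord α) :
    IsTableShape (T.refineRows w) T.E where
  __ := T.isTableShape
  finite_S := (T.finite_S.union (finite_normalPrefixes w 0)).subset (T.refineRows_subset w)
  nil_mem_S := Or.inl T.nil_mem_S
  hi_S := by
    rintro v (hv | ⟨x, ⟨R, -, rfl⟩, y, hy⟩)
    · exact T.hi_S v hv
    · have := isHIWord_normalFormAux R w []
      rw [← normalForm, ← hy, isHIWord_append] at this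
      exact this.1
  prefix_S := by
    rintro v (hv | ⟨x, hx, hv⟩) z hz
    · exact Or.inl (T.prefix_S v hv z hz)
    · exact Or.inr ⟨x, hx, hz.trans hv⟩

end ObsTable

/-! ### Tables filled with the syntactic reset function -/

open Classical in
/-- The entry of a table for the syntactic reset function. -/
noncomputable def synEntry {α : Type u} (L : Set (TimedWord α)) (w : TimedWord α) : Bool × ℝ≥0 :=
  (decide (w ∈ L), synReset L w)

open Classical in
/-- The row of `s` for the syntactic reset function. -/
noncomputable def synRow {α : Type u} (L E : Set (TimedWord α)) (s : TimedWord α) :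
    TimedWord α → Bool × ℝ≥0 :=
  fun e => if e ∈ E then synEntry L (s ++ e) else (false, 0)

theorem synRow_eq_iff {α : Type u} {L E : Set (TimedWord α)} {s s' : TimedWord α} :
    synRow L E s = synRow L E s' ↔ ∀ e ∈ E, synEntry L (s ++ e) = synEntry L (s' ++ e) := by
  constructor
  · intro h e he
    simpa [synRow, he] using congrFun h e
  · intro h
    funext e
    by_cases he : e ∈ E
    · simpa [synRow, he] using h e he
    · simp [synRow, he]

/-- The number of rows for the syntactic reset function. -/
noncomputable def rowCount {α : Type u} (L S E : Set (TimedWord α)) : ℕ :=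
  (synRow L E '' S).ncard

/-! ### Counting rows filled with the syntactic reset function -/

section RowCount

variable {α : Type u} {L S S' E E' : Set (TimedWord α)}

theorem rowCount_pos (hS : IsTableShape S E) : 1 ≤ rowCount L S E := by
  rw [Nat.one_le_iff_ne_zero, ← Nat.pos_iff_ne_zero, rowCount,
    Set.ncard_pos (hS.finite_S.image _)]
  exact ⟨_, [], hS.nil_mem_S, rfl⟩

/-- As a right congruence, `≈^L` refines equality of rows for every choice of columns. -/
theorem rowCount_le [Finite α] (hL : IsDTARecognizable L) (hS : ∀ s ∈ S, IsHIWord s) :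
    rowCount L S E ≤ synIndex L := by
  have := hL.finite_synSetoid
  let f : Quotient (synSetoid L) → TimedWord α → Bool × ℝ≥0 :=
    Quotient.lift (fun w => synRow L E w.1) (by
      rintro ⟨u, hu⟩ ⟨v, hv⟩ ⟨h1, h2⟩
      refine synRow_eq_iff.2 fun e _ => Prod.ext ?_ (synReset_append_congr h1 h2 e)
      have : u ++ e ∈ L ↔ v ++ e ∈ L := Set.ext_iff.1 h2 e
      exact decide_eq_decide.2 this)
  have hsub : synRow L E '' S ⊆ f '' Set.univ := by
    rintro _ ⟨s, hs, rfl⟩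
    exact ⟨Quotient.mk _ ⟨s, hS s hs⟩, trivial, rfl⟩
  refine (Set.ncard_le_ncard hsub (Set.toFinite _)).trans ((Set.ncard_image_le).trans ?_)
  rw [Set.ncard_univ, synIndex]

theorem rowCount_mono_left (hS' : S'.Finite) (h : S ⊆ S') : rowCount L S E ≤ rowCount L S' E :=
  Set.ncard_le_ncard (Set.image_mono h) (hS'.image _)

/-- Restriction to `E` maps the rows over `E'` onto those over `E` and identifies two of them. -/
theorem rowCount_lt_right (hS : S.Finite) (h : E ⊆ E') {s s' : TimedWord α} (hs : s ∈ S)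
    (hs' : s' ∈ S) (hE : synRow L E s = synRow L E s') (hE' : synRow L E' s ≠ synRow L E' s') :
    rowCount L S E < rowCount L S E' := by
  classical
  let f : (TimedWord α → Bool × ℝ≥0) → TimedWord α → Bool × ℝ≥0 :=
    fun g e => if e ∈ E then g e else (false, 0)
  have hf : ∀ s, f (synRow L E' s) = synRow L E s := by
    intro s
    funext e
    by_cases he : e ∈ E
    · simp [f, synRow, he, h he]
    · simp [f, synRow, he]
  have himg : synRow L E '' S = f '' (synRow L E' '' S) := by
    rw [Set.image_image]
    exact Set.image_congr fun s _ => (hf s).symm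
  rw [rowCount, rowCount, himg]
  refine lt_of_le_of_ne (Set.ncard_image_le (hS.image _)) fun h => hE' ?_
  rw [Set.ncard_image_iff (hS.image _)] at h
  exact h ⟨s, hs, rfl⟩ ⟨s', hs', rfl⟩ (by rw [hf, hf, hE])

end RowCount

namespace ObsTable

variable {α : Type u} {T T' : ObsTable α} {L : Set (TimedWord α)}

/-- The table is filled with the syntactic reset function, and its constant does not exceed `K_L`. -/
structure IsSyntactic (L : Set (TimedWord α)) (T : ObsTable α) : Prop where
  le : T.K ≤ minConst L
  entry_eq : ∀ s e, (s, e) ∈ cells T.K T.S T.E → T.entry s e = synEntry L (s ++ e)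

/-- The progress of a table. -/
noncomputable def level (L : Set (TimedWord α)) (T : ObsTable α) : ℕ := T.K + rowCount L T.S T.E

namespace IsSyntactic

theorem row_eq_iff (h : T.IsSyntactic L) {s s' : TimedWord α}
    (hs : s ∈ T.S ∪ extensions T.K T.S) (hs' : s' ∈ T.S ∪ extensions T.K T.S) :
    T.row s = T.row s' ↔ synRow L T.E s = synRow L T.E s' := by
  rw [ObsTable.row_eq_iff, synRow_eq_iff]
  refine forall₂_congr fun e he => ?_
  rw [h.entry_eq s e ⟨hs, he⟩, h.entry_eq s' e ⟨hs', he⟩]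

theorem r_eq (h : T.IsSyntactic L) {s : TimedWord α} (hs : s ∈ T.S ∪ extensions T.K T.S) :
    T.r s = synReset L s := by
  rw [r, h.entry_eq s [] (cell_nil hs), List.append_nil, synEntry]

theorem level_le [Finite α] (h : T.IsSyntactic L) (hL : IsDTARecognizable L) :
    T.level L ≤ minConst L + synIndex L :=
  Nat.add_le_add h.le (rowCount_le hL T.hi_S)

theorem filled (h : T.IsSyntactic L) (hR : IsStrictResetFunction (synReset L)) : T.Filled L := by
  refine ⟨fun s e hse => ?_, synReset L, hR, fun s e hse => ?_⟩
  · rw [h.entry_eq s e hse]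
    simp [synEntry]
  · rw [h.entry_eq s e hse, synEntry]

end IsSyntactic

theorem exists_isSyntactic (hR : IsStrictResetFunction (synReset L)) {K : ℕ}
    {S E : Set (TimedWord α)} (hK : K ≤ minConst L) (h : IsTableShape S E) :
    ∃ T : ObsTable α, T.K = K ∧ T.S = S ∧ T.E = E ∧ T.IsSyntactic L := by
  classical
  refine ⟨{ h with
    K := K
    S := S
    E := E
    entry := fun s e => if (s, e) ∈ cells K S E then synEntry L (s ++ e) else (false, 0)
    range_entry := ?_
    entry_default := fun s e hse => if_neg hse }, rfl, rfl, rfl, hK, fun s e hse => if_pos hse⟩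
  intro s e hse
  rw [if_pos hse]
  exact ⟨hR.isHalfInt (h.isHIWord hse), hR.not_posInt _⟩

/-- `synReset L` is a strict reset function, so its values are one of the possible extensions of the
reset assignment and the syntactic table survives among the copies. -/
theorem IsSyntactic.exists_mem_copies (hT : T.IsSyntactic L)
    (hR : IsStrictResetFunction (synReset L)) {K : ℕ} {S E : Set (TimedWord α)}
    (hK : K ≤ minConst L) (h : IsTableShape S E) (hKK : T.K ≤ K) (hS : T.S ⊆ S) (hE : T.E ⊆ E) :
    ∃ T' ∈ T.copies L K S E, T'.IsSyntactic L := by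
  obtain ⟨T', rfl, rfl, rfl, hT'⟩ := exists_isSyntactic hR hK h
  refine ⟨T', ⟨rfl, rfl, rfl, hT'.filled hR, fun s e hse => ?_⟩, hT'⟩
  rw [hT.entry_eq s e hse, hT'.entry_eq s e (cells_mono hKK hS hE hse)]

variable [Finite α]

/-- Past `minConst L` the residual ignores the exact delay and the clock is reset. So a failure of
(b) never pushes the constant of a syntactic table beyond `minConst L`. -/
theorem IsSyntactic.consistentB (hT : T.IsSyntactic L) (hL : IsDTARecognizable L)
    (hK : minConst L ≤ T.K) : T.ConsistentB := by
  intro s t a hsa hlt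
  have hs := mem_S_of_snoc_mem hsa
  rw [hT.r_eq (Or.inl hs)] at hlt
  have hK' : (minConst L : ℝ≥0) ≤ T.K := by exact_mod_cast hK
  have h1 := lt_of_le_of_lt hK' hlt
  have h2 : (minConst L : ℝ≥0) < synReset L s + ((T.K : ℝ≥0) + 1 / 2) :=
    lt_of_le_of_lt hK' (lt_of_lt_of_le (natCast_lt_add_half _) le_add_self)
  rw [hT.row_eq_iff hsa (Or.inr (mem_extensions hs (natCast_add_half_mem_sigmaK _ _))),
    synRow_eq_iff]
  have hres := hL.residualLang_snoc_of_minConst_lt (a := a) h1 h2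
  intro e he
  refine Prod.ext ?_ ?_
  · have : s ++ [(t, a)] ++ e ∈ L ↔ s ++ [((T.K : ℝ≥0) + 1 / 2, a)] ++ e ∈ L :=
      Set.ext_iff.1 hres e
    exact decide_eq_decide.2 this
  · refine synReset_append_congr ?_ hres e
    rw [hL.synReset_snoc_of_minConst_lt h1, hL.synReset_snoc_of_minConst_lt h2]

/-- Closing adds a new row, distinguishing splits two equal rows, and the other two actions raise
the constant. The latter occur only below `minConst L`, by `consistentB` and by the bound on
`synReset L`. -/
theorem IsSyntactic.action (hT : T.IsSyntactic L) (hL : IsDTARecognizable L) {K' : ℕ}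
    {S' E' : Set (TimedWord α)} (h : T.Action K' S' E') :
    K' ≤ minConst L ∧ T.level L + 1 ≤ K' + rowCount L S' E' := by
  cases h with
  | close w hw hne =>
      refine ⟨hT.le, ?_⟩
      have hnot : synRow L T.E w ∉ synRow L T.E '' T.S := by
        rintro ⟨s, hs, h⟩
        exact hne s hs ((hT.row_eq_iff (Or.inr hw) (Or.inl hs)).2 h.symm)
      rw [level, rowCount, rowCount, Set.union_singleton, Set.image_insert_eq,
        Set.ncard_insert_of_notMem hnot (T.finite_S.image _), add_assoc]
  | distinguish s₁ s₂ p e hs₁ hs₂ hp he hrow hne =>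
      refine ⟨hT.le, ?_⟩
      rw [level, add_assoc]
      refine Nat.add_le_add_left ?_ _
      refine rowCount_lt_right T.finite_S Set.subset_union_left hs₁ hs₂
        ((hT.row_eq_iff (Or.inl hs₁) (Or.inl hs₂)).1 hrow) fun h => hne ?_
      have := synRow_eq_iff.1 h (p :: e) (Or.inr rfl)
      rw [hT.entry_eq _ _ ⟨Or.inr (mem_extensions hs₁ hp), he⟩,
        hT.entry_eq _ _ ⟨Or.inr (mem_extensions hs₂ hp), he⟩]
      simpa using this
  | enlarge h =>
      refine ⟨?_, by rw [level]; omega⟩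
      by_contra hK
      exact h (hT.consistentB hL (by omega))
  | validate s e hse h =>
      refine ⟨?_, by rw [level]; omega⟩
      rw [hT.entry_eq s e hse] at h
      exact_mod_cast lt_of_lt_of_le h (hL.synReset_le_minConst _)

/-- A table with the normal forms of a counterexample among its rows needs a further action. -/
theorem IsSyntactic.not_ready_of_counterexample (hT : T.IsSyntactic L) (hT' : T'.IsSyntactic L)
    (hL : IsDTARecognizable L) (hready : T.Ready) {w : TimedWord α}
    (hw : ¬ (w ∈ T.conj.lang ↔ w ∈ L)) (hK : T'.K = T.K) (hE : T'.E = T.E)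
    (hS : T'.S = T.refineRows w) : ¬ T'.Ready := by
  -- If `T'` were ready, the conjecture of `T` would be right on `w`: after each prefix `u` it is in
  -- a state with the row of the normal form of `u`, at clock value `synReset L u`. The columns are
  -- unchanged, so rows agree in `T'` exactly if the old rows agree. Consistency of `T'`, whose row
  -- words include the normal forms, gives the induction step, and closedness of `T` the next state.
  intro hready'
  have hR := hL.isStrictResetFunction_synReset
  have hF := hT.filled hR
  have hsub : T.S ⊆ T'.S := hS ▸ Set.subset_union_left
  have hr : ∀ {s s' : TimedWord α}, synRow L T.E s = synRow L T.E s' →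
      synReset L s = synReset L s' := by
    intro s s' h
    simpa [synEntry] using congrArg Prod.snd (synRow_eq_iff.1 h [] T.nil_mem_E)
  have hrow' : ∀ {s s' : TimedWord α}, s ∈ T'.S ∪ extensions T'.K T'.S →
      s' ∈ T'.S ∪ extensions T'.K T'.S →
      (T'.row s = T'.row s' ↔ synRow L T.E s = synRow L T.E s') := by
    intro s s' hs hs'
    rw [hT'.row_eq_iff hs hs', hE]
  have hmem : ∀ u, u <+: w → normalForm (synReset L) u ∈ T'.S := by
    rintro u ⟨v, rfl⟩
    rw [hS]
    refine Or.inr ⟨_, ⟨synReset L, hR.toIsResetFunction, rfl⟩, ?_⟩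
    clear hw hS
    induction v using List.reverseRecOn with
    | nil => simp
    | append_singleton v p ih =>
        obtain ⟨t, a⟩ := p
        rw [← List.append_assoc, normalForm_snoc]
        exact ih.trans (List.prefix_append _ _)
  have key : ∀ u, u <+: w → ∃ (s : TimedWord α) (hs : s ∈ T.S) (θs : _),
      synRow L T.E (normalForm (synReset L) u) = synRow L T.E s ∧
      T.conj.Run T.conj.init 0 u θs (T.state s hs) (synReset L u) := by
    intro u
    induction u using List.reverseRecOn with
    | nil => exact fun _ => ⟨[], T.nil_mem_S, [], rfl, .nil _ _⟩
    | append_singleton u p ih =>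
        intro hu
        obtain ⟨t, a⟩ := p
        have hx' := hmem _ hu
        obtain ⟨s, hs, θs, hxs, hrun⟩ := ih ((List.prefix_append _ _).trans hu)
        have hx := hmem _ ((List.prefix_append _ _).trans hu)
        have hnf := normalForm_snoc (synReset L) u t a
        have hfin := hL.synReset_normalForm (u ++ [(t, a)])
        have hrx := hL.synReset_normalForm u
        rw [hnf] at hx' hfin ⊢
        set x := normalForm (synReset L) u
        set t' := hi (synReset L u + t) - hi (synReset L u) with ht'
        have hrs : T.r s = hi (synReset L u) := by rw [hT.r_eq (Or.inl hs), ← hr hxs, hrx]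
        have hadd : hi (synReset L u) + t' = hi (synReset L u + t) :=
          add_tsub_cancel_of_le (hi_mono le_self_add)
        have hrow : T'.row x = T'.row s := (hrow' (Or.inl hx) (Or.inl (hsub hs))).2 hxs
        obtain ⟨t'', ht'', hreg, hrow''⟩ : ∃ t'', (t'', a) ∈ sigmaK α T.K ∧
            KRegionEquiv T.K (T.r s + t'') (synReset L u + t) ∧
            T'.row (x ++ [(t', a)]) = T'.row (s ++ [(t'', a)]) := by
          by_cases hle : hi (synReset L u + t) ≤ T.K
          · have hmemσ : (t', a) ∈ sigmaK α T.K :=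
              IsHalfInt.mem_sigmaK_of_le ((isHalfInt_hi _).tsub (isHalfInt_hi _))
                (tsub_le_self.trans hle) a
            refine ⟨t', hmemσ, ?_, ?_⟩
            · rw [hrs, hadd]
              exact (kRegionEquiv_hi _ _).symm
            · exact hready'.2.1 x hx s (hsub hs) hrow _ (hK ▸ hmemσ)
          -- The delay `t'` may lie outside `Σ_K`. Condition (b) also covers words of `S`, and
          -- replaces `t'` by `K + 1/2`.
          · rw [not_le] at hle
            refine ⟨_, natCast_add_half_mem_sigmaK T.K a, KRegionEquiv.of_gt ?_ ?_, ?_⟩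
            · exact lt_of_lt_of_le (natCast_lt_add_half _) le_add_self
            · exact (kRegionEquiv_hi T.K _).lt_iff.2 hle
            · have := hready'.2.2.1 x t' a (Or.inl hx') (by
                rw [hT'.r_eq (Or.inl hx), hrx, hadd, hK]; exact hle)
              rw [this, hK]
              exact hready'.2.1 x hx s (hsub hs) hrow _
                (hK ▸ natCast_add_half_mem_sigmaK T.K a)
        have hext := mem_extensions hs ht''
        obtain ⟨s', hs', hss'⟩ := hready.1 _ hext
        have hfinal : synRow L T.E (x ++ [(t', a)]) = synRow L T.E s' := by
          rw [← (hT.row_eq_iff (Or.inr hext) (Or.inl hs')).1 hss']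
          exact (hrow' (Or.inl hx') (Or.inr (extensions_mono hK.ge hsub hext))).1 hrow''
        obtain ⟨θs', hrun'⟩ := run_conj_snoc hs hs' hrun ht'' hss' hreg
        refine ⟨s', hs', θs', hfinal, ?_⟩
        have hrs' : T.r s' = hi (synReset L (u ++ [(t, a)])) := by
          rw [hT.r_eq (Or.inl hs'), ← hr hfinal, hfin]
        -- `hi` vanishes only at 0, so the conjecture resets exactly where `synReset L` is 0.
        have hzero : T.r s' = 0 ↔ synReset L (u ++ [(t, a)]) = 0 := by
          rw [hrs']
          constructor
          · intro h
            have := (kRegionEquiv_hi 0 (synReset L (u ++ [(t, a)]))).symm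
            rw [h] at this
            exact kRegionEquiv_zero_iff.1 this
          · intro h
            rw [h, hi_zero]
        by_cases h0 : synReset L (u ++ [(t, a)]) = 0
        · rw [if_pos (hzero.2 h0)] at hrun'
          rwa [h0]
        · rw [if_neg (fun h => h0 (hzero.1 h))] at hrun'
          rwa [(hR.snoc u t a).resolve_left h0]
  obtain ⟨s, hs, θs, hxs, hrun⟩ := key w List.prefix_rfl
  apply hw
  rw [hready.mem_lang_conj_iff hs hrun, hL.normalForm_mem_iff w,
    hT.entry_eq s [] (cell_nil (Or.inl hs))]
  have := congrArg Prod.fst (synRow_eq_iff.1 hxs [] T.nil_mem_E)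
  simp only [synEntry, List.append_nil, decide_eq_decide] at this ⊢
  rw [this]
  simp

theorem IsSyntactic.exists_copy_of_action (hT : T.IsSyntactic L) (hL : IsDTARecognizable L) {K' : ℕ}
    {S' E' : Set (TimedWord α)} (h : T.Action K' S' E') :
    ∃ T' ∈ T.copies L K' S' E', T'.IsSyntactic L ∧ T.level L + 1 ≤ T'.level L := by
  obtain ⟨hK, hlev⟩ := hT.action hL h
  obtain ⟨h1, h2, h3⟩ := h.mono
  obtain ⟨T', hT', hsyn⟩ := hT.exists_mem_copies hL.isStrictResetFunction_synReset hK
    h.isTableShape h1 h2 h3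
  refine ⟨T', hT', hsyn, ?_⟩
  obtain ⟨rfl, rfl, rfl, -⟩ := hT'
  exact hlev

theorem IsSyntactic.exists_copy_of_counterexample (hT : T.IsSyntactic L) (hL : IsDTARecognizable L)
    (hready : T.Ready) {w : TimedWord α} (hw : ¬ (w ∈ T.conj.lang ↔ w ∈ L)) :
    ∃ T' ∈ T.copies L T.K (T.refineRows w) T.E, T'.IsSyntactic L ∧
      T.level L ≤ T'.level L ∧ ¬ T'.Ready := by
  obtain ⟨T', hT', hsyn⟩ := hT.exists_mem_copies hL.isStrictResetFunction_synReset hT.le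
    (T.isTableShape_refineRows w) le_rfl Set.subset_union_left subset_rfl
  refine ⟨T', hT', hsyn, ?_⟩
  obtain ⟨hK, hS, hE, -⟩ := hT'
  have hsub : T.S ⊆ T'.S := hS ▸ Set.subset_union_left
  refine ⟨?_, hT.not_ready_of_counterexample hsyn hL hready hw hK hE hS⟩
  rw [level, level, hK, hE]
  exact Nat.add_le_add_left (rowCount_mono_left T'.finite_S hsub) _

end ObsTable

/-! ### Counting reset assignments -/

open scoped ENNReal

/-- The only possible nonzero value on a half-integral word is the same for all strict reset
functions. -/
theorem IsStrictResetFunction.eq_of_ne_zero {α : Type u} {R R' : TimedWord α → ℝ≥0}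
    (hR : IsStrictResetFunction R) (hR' : IsStrictResetFunction R') {w : TimedWord α}
    (hw : IsHIWord w) (h : R w ≠ 0) (h' : R' w ≠ 0) : R w = R' w := by
  have aux : ∀ {R R' : TimedWord α → ℝ≥0}, IsStrictResetFunction R → IsStrictResetFunction R' →
      ∀ {w : TimedWord α} {t : ℝ≥0} {a : α}, IsHIWord w → IsHalfInt t → R w = 0 → R' w ≠ 0 →
      R (w ++ [(t, a)]) = R w + t → R' (w ++ [(t, a)]) = R' w + t → R (w ++ [(t, a)]) ≠ 0 →
      False := by
    -- Only one clock having just been 0 is impossible: `t` and `R' w` are both half-integral and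
    -- nonintegral, so their sum, a value of `R'`, would be a positive integer.
    intro R R' hR hR' w t a hw ht h0 h0' h1 h1' h2
    have n1 := hR.not_posInt (w ++ [(t, a)])
    have n2 := hR'.not_posInt w
    have n3 := hR'.not_posInt (w ++ [(t, a)])
    rw [h1, h0, zero_add] at n1 h2
    rw [h1'] at n3
    rw [← isNonInt_iff_not_isPosInt h2, isNonInt_iff] at n1
    rw [← isNonInt_iff_not_isPosInt h0', isNonInt_iff] at n2
    rcases ht.eq_or with ⟨k, hk⟩ | ⟨k, hk⟩
    · exact n1 k hk
    · rcases (hR'.isHalfInt hw).eq_or with ⟨j, hj⟩ | ⟨j, hj⟩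
      · exact n2 j hj
      · refine n3 ⟨j + k + 1, Nat.succ_pos _, ?_⟩
        rw [hj, hk]
        push_cast
        rw [add_add_add_comm, add_halves]
  induction w using List.reverseRecOn with
  | nil => exact absurd hR.nil h
  | append_singleton w p ih =>
      obtain ⟨t, a⟩ := p
      rw [isHIWord_append, isHIWord_singleton] at hw
      have h1 := (hR.snoc w t a).resolve_left h
      have h1' := (hR'.snoc w t a).resolve_left h'
      by_cases h0 : R w = 0 <;> by_cases h0' : R' w = 0
      · rw [h1, h1', h0, h0']
      · exact (aux hR hR' hw.1 hw.2 h0 h0' h1 h1' h).elim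
      · exact (aux hR' hR hw.1 hw.2 h0' h0 h1' h1 h').elim
      · rw [h1, h1', ih hw.1 h0 h0']

theorem finite_cells {α : Type u} [Finite α] (K : ℕ) {S E : Set (TimedWord α)} (hS : S.Finite)
    (hE : E.Finite) : (cells K S E).Finite := by
  refine Set.Finite.prod (hS.union ?_) hE
  refine ((hS.prod (sigmaK_finite α K)).image fun x => x.1 ++ [x.2]).subset ?_
  rintro _ ⟨s, hs, p, hp, rfl⟩
  exact ⟨(s, p), ⟨hs, hp⟩, rfl⟩

theorem ncard_sigmaK_le (α : Type u) [Fintype α] (K : ℕ) :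
    (sigmaK α K).ncard ≤ Fintype.card α * (2 * K + 2) := by
  have hsub : sigmaK α K ⊆ Set.range fun i : Fin (2 * K + 2) × α =>
      ((((i.1 : ℕ) : ℝ≥0) / 2, i.2) : ℝ≥0 × α) := by
    rintro ⟨t, a⟩ ⟨⟨k, hk⟩, hlt⟩
    simp only at hk hlt
    subst hk
    rw [div_lt_iff₀ (by norm_num)] at hlt
    have : k < (K + 1) * 2 := by exact_mod_cast hlt
    exact ⟨(⟨k, by omega⟩, a), rfl⟩
  refine (Set.ncard_le_ncard hsub (Set.finite_range _)).trans ?_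
  rw [← Set.image_univ]
  refine (Set.ncard_image_le).trans ?_
  rw [Set.ncard_univ, Nat.card_prod, Nat.card_eq_fintype_card, Nat.card_eq_fintype_card,
    Fintype.card_fin, mul_comm]

theorem ncard_cells_le {α : Type u} [Fintype α] (K : ℕ) {S E : Set (TimedWord α)}
    (hS : S.Finite) :
    (cells K S E).ncard ≤ S.ncard * (1 + Fintype.card α * (2 * K + 2)) * E.ncard := by
  have hext : extensions K S ⊆ (fun x : TimedWord α × (ℝ≥0 × α) => x.1 ++ [x.2]) ''
      (S ×ˢ sigmaK α K) := by
    rintro _ ⟨s, hs, p, hp, rfl⟩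
    exact ⟨(s, p), ⟨hs, hp⟩, rfl⟩
  have hfin := hS.prod (sigmaK_finite α K)
  have h1 : (extensions K S).ncard ≤ S.ncard * (Fintype.card α * (2 * K + 2)) := by
    refine (Set.ncard_le_ncard hext (hfin.image _)).trans ((Set.ncard_image_le hfin).trans ?_)
    rw [Set.ncard_prod]
    exact Nat.mul_le_mul_left _ (ncard_sigmaK_le α K)
  rw [cells, Set.ncard_prod, mul_add, mul_one]
  exact Nat.mul_le_mul_right _ ((Set.ncard_union_le _ _).trans (Nat.add_le_add_left h1 _))

namespace ObsTable

variable {α : Type u} {L : Set (TimedWord α)}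

theorem ext_of_entry {T T' : ObsTable α} (hK : T.K = T'.K) (hS : T.S = T'.S) (hE : T.E = T'.E)
    (h : T.entry = T'.entry) : T = T' := by
  obtain ⟨⟩ := T
  obtain ⟨⟩ := T'
  simp only at hK hS hE h
  subst hK hS hE h
  rfl

/-- The number of ways of filling the cells outside `B`. -/
theorem ncard_le_of_filled {P : Set (ObsTable α)} {K : ℕ} {S E : Set (TimedWord α)}
    {B : Set (TimedWord α × TimedWord α)} (hfin : (cells K S E).Finite)
    (hP : ∀ T ∈ P, T.K = K ∧ T.S = S ∧ T.E = E ∧ T.Filled L)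
    (hB : ∀ T ∈ P, ∀ T' ∈ P, ∀ s e, (s, e) ∈ B → T.entry s e = T'.entry s e) :
    P.Finite ∧ P.ncard ≤ 2 ^ (cells K S E \ B).ncard := by
  classical
  have : Finite ↥(cells K S E \ B) := (hfin.subset Set.sdiff_subset).to_subtype
  -- The membership bit is fixed by `L`, and by `eq_of_ne_zero` a reset value is known once it is
  -- known whether it is 0: one bit per cell.
  let f : ObsTable α → (↥(cells K S E \ B) → Bool) :=
    fun T c => decide ((T.entry c.1.1 c.1.2).2 = 0)
  have hf : Set.InjOn f P := by
    intro T hT T' hT' h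
    obtain ⟨h1, h2, h3, hF, R, hR, hRT⟩ := hP T hT
    obtain ⟨h1', h2', h3', hF', R', hR', hRT'⟩ := hP T' hT'
    refine ext_of_entry (h1.trans h1'.symm) (h2.trans h2'.symm) (h3.trans h3'.symm) ?_
    funext s e
    by_cases hB' : (s, e) ∈ B
    · exact hB T hT T' hT' s e hB'
    by_cases hse : (s, e) ∈ cells K S E
    · have hw := T.isTableShape.isHIWord (h1 ▸ h2 ▸ h3 ▸ hse : (s, e) ∈ cells T.K T.S T.E)
      have h4 := decide_eq_decide.1 (congrFun h ⟨(s, e), hse, hB'⟩)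
      rw [← h1, ← h2, ← h3] at hse
      have h5 := hF s e hse
      have h6 := hRT s e hse
      rw [h1, h2, h3, ← h1', ← h2', ← h3'] at hse
      have h5' := hF' s e hse
      have h6' := hRT' s e hse
      refine Prod.ext (Bool.eq_iff_iff.2 (h5.trans h5'.symm)) ?_
      simp only at h4
      by_cases h0 : (T.entry s e).2 = 0
      · rw [h0, h4.1 h0]
      · have h0' := fun h => h0 (h4.2 h)
        rw [h6] at h0 ⊢
        rw [h6'] at h0' ⊢
        exact hR.eq_of_ne_zero hR' hw h0 h0'
    · rw [T.entry_default s e (by rwa [h1, h2, h3]), T'.entry_default s e (by rwa [h1', h2', h3'])]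
  have hfinP : P.Finite := Set.Finite.of_finite_image (Set.toFinite (f '' P)) hf
  refine ⟨hfinP, ?_⟩
  rw [← hf.ncard_image]
  refine (Set.ncard_le_ncard (Set.subset_univ _) (Set.toFinite _)).trans ?_
  rw [Set.ncard_univ, Nat.card_fun, Nat.card_eq_fintype_card (α := Bool), Fintype.card_bool,
    Nat.card_coe_set_eq]

/-! ### Weights of pools -/

/-- The weight of a table, halved for each cell. -/
noncomputable def weight (T : ObsTable α) : ℝ≥0∞ := 2⁻¹ ^ (cells T.K T.S T.E).ncard

/-- The total weight of a pool. -/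
noncomputable def poolWeight (P : Set (ObsTable α)) : ℝ≥0∞ := ∑' T : P, weight T.1

theorem poolWeight_empty : poolWeight (∅ : Set (ObsTable α)) = 0 := by
  simp [poolWeight]

theorem poolWeight_union_le (P P' : Set (ObsTable α)) :
    poolWeight (P ∪ P') ≤ poolWeight P + poolWeight P' :=
  ENNReal.tsum_union_le _ _ _

theorem poolWeight_eq_add_diff {P : Set (ObsTable α)} {T : ObsTable α} (hT : T ∈ P) :
    poolWeight P = weight T + poolWeight (P \ {T}) := by
  have h : P = {T} ∪ P \ {T} := by
    rw [Set.union_sdiff_self, Set.singleton_union, Set.insert_eq_of_mem hT]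
  have := (ENNReal.summable (f := fun x : ({T} : Set (ObsTable α)) => weight x.1)).tsum_union_disjoint
    (f := weight) (t := P \ {T}) Set.disjoint_sdiff_right ENNReal.summable
  rw [← h] at this
  rw [poolWeight, this, poolWeight]
  congr 1
  exact tsum_singleton T weight

/-- A Kraft-type count: at most `2 ^ |cells \ B|` tables of weight `2⁻¹ ^ |cells|` each. With `B`
the cells of a processed table, its copies weigh at most as much as the table itself. -/
theorem poolWeight_le_of_filled {P : Set (ObsTable α)} {K : ℕ} {S E : Set (TimedWord α)}
    {B : Set (TimedWord α × TimedWord α)} (hfin : (cells K S E).Finite) (hBsub : B ⊆ cells K S E)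
    (hP : ∀ T ∈ P, T.K = K ∧ T.S = S ∧ T.E = E ∧ T.Filled L)
    (hB : ∀ T ∈ P, ∀ T' ∈ P, ∀ s e, (s, e) ∈ B → T.entry s e = T'.entry s e) :
    poolWeight P ≤ 2⁻¹ ^ B.ncard := by
  obtain ⟨hPfin, hcard⟩ := ncard_le_of_filled hfin hP hB
  have h1 : poolWeight P = ∑' _ : P, (2⁻¹ : ℝ≥0∞) ^ (cells K S E).ncard := by
    refine tsum_congr fun T => ?_
    obtain ⟨h1, h2, h3, -⟩ := hP T.1 T.2
    rw [weight, h1, h2, h3]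
  rw [h1, ENNReal.tsum_set_const, ← hPfin.cast_ncard_eq,
    ← Set.ncard_sdiff_add_ncard_of_subset hBsub hfin, pow_add, ← mul_assoc]
  refine mul_le_of_le_one_left' ?_
  have h2 : (P.ncard : ℝ≥0∞) ≤ 2 ^ (cells K S E \ B).ncard := by exact_mod_cast hcard
  rw [ENat.toENNReal_coe]
  calc (P.ncard : ℝ≥0∞) * 2⁻¹ ^ (cells K S E \ B).ncard
      ≤ 2 ^ (cells K S E \ B).ncard * 2⁻¹ ^ (cells K S E \ B).ncard := by gcongr
    _ = 1 := by
        rw [← mul_pow, ENNReal.mul_inv_cancel (by norm_num) (by norm_num), one_pow]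

theorem copies_finite [Finite α] (T : ObsTable α) (L : Set (TimedWord α)) {K' : ℕ}
    {S' E' : Set (TimedWord α)} (h : IsTableShape S' E') : (T.copies L K' S' E').Finite :=
  (ncard_le_of_filled (B := cells T.K T.S T.E) (finite_cells K' h.finite_S h.finite_E)
    (fun _ hT => ⟨hT.1, hT.2.1, hT.2.2.1, hT.2.2.2.1⟩)
    fun _ h₁ _ h₂ s e hse => (h₁.2.2.2.2 s e hse).trans (h₂.2.2.2.2 s e hse).symm).1

theorem poolWeight_copies_le [Finite α] (T : ObsTable α) (L : Set (TimedWord α)) {K' : ℕ}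
    {S' E' : Set (TimedWord α)} (h : IsTableShape S' E') (hK : T.K ≤ K') (hS : T.S ⊆ S')
    (hE : T.E ⊆ E') : poolWeight (T.copies L K' S' E') ≤ T.weight :=
  poolWeight_le_of_filled (finite_cells K' h.finite_S h.finite_E) (cells_mono hK hS hE)
    (fun _ hT => ⟨hT.1, hT.2.1, hT.2.2.1, hT.2.2.2.1⟩)
    fun _ h₁ _ h₂ s e hse => (h₁.2.2.2.2 s e hse).trans (h₂.2.2.2.2 s e hse).symm

end ObsTable

/-! ### Sizes of tables -/

/-- The size of tables after `i` rounds with counterexamples of length at most `m`. -/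
def IsSized {α : Type u} (m i K : ℕ) (S E : Set (TimedWord α)) : Prop :=
  ∃ a b c : ℕ, a + b + c ≤ i ∧ S.ncard ≤ 1 + a * (2 ^ m - 1) ∧ E.ncard ≤ 1 + b ∧ K ≤ c

theorem isSized_trivial {α : Type u} (m : ℕ) :
    IsSized m 0 0 ({[]} : Set (TimedWord α)) ({[]} : Set (TimedWord α)) :=
  ⟨0, 0, 0, by simp⟩

theorem one_le_two_pow_sub_one {m : ℕ} (hm : 1 ≤ m) : 1 ≤ 2 ^ m - 1 := by
  have : 2 ^ 1 ≤ 2 ^ m := Nat.pow_le_pow_right (by norm_num) hm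
  omega

/-- The numbers `a`, `b`, `c` bound the rounds that added rows, columns and constants. One row added
by closing is within the allowance `2 ^ m - 1` because `1 ≤ m`. -/
theorem ObsTable.Action.isSized {α : Type u} {T : ObsTable α} {m i K' : ℕ}
    {S' E' : Set (TimedWord α)} (h : T.Action K' S' E') (hm : 1 ≤ m)
    (hT : IsSized m i T.K T.S T.E) : IsSized m (i + 1) K' S' E' := by
  obtain ⟨a, b, c, habc, hS, hE, hK⟩ := hT
  have h1 := one_le_two_pow_sub_one hm
  cases h with
  | close w hw hne =>
      refine ⟨a + 1, b, c, by omega, ?_, hE, hK⟩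
      have := Set.ncard_union_le T.S {w}
      rw [Set.ncard_singleton] at this
      rw [add_mul, one_mul]
      omega
  | distinguish s₁ s₂ p e =>
      refine ⟨a, b + 1, c, by omega, hS, ?_, hK⟩
      have := Set.ncard_union_le T.E {p :: e}
      rw [Set.ncard_singleton] at this
      omega
  | enlarge => exact ⟨a, b, c + 1, by omega, hS, hE, by omega⟩
  | validate => exact ⟨a, b, c + 1, by omega, hS, hE, by omega⟩

theorem ObsTable.isSized_refineRows {α : Type u} {T : ObsTable α} {m i : ℕ} {w : TimedWord α}
    (hw : w.length ≤ m) (hT : IsSized m i T.K T.S T.E) :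
    IsSized m (i + 1) T.K (T.refineRows w) T.E := by
  obtain ⟨a, b, c, habc, hS, hE, hK⟩ := hT
  refine ⟨a + 1, b, c, by omega, ?_, hE, hK⟩
  have h1 := Set.ncard_le_ncard (T.refineRows_subset w)
    (T.finite_S.union (finite_normalPrefixes w 0))
  have h2 := Set.ncard_union_le T.S (normalPrefixes 0 w)
  have h3 := ncard_normalPrefixes w 0
  have h4 : 2 ^ w.length ≤ 2 ^ m := Nat.pow_le_pow_right (by norm_num) hw
  rw [add_mul, one_mul]
  omega

/-! ### Estimates for the number of cells -/

section Arithmetic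

theorem two_mul_two_pow_sub_one_le {m : ℕ} (hm : 1 ≤ m) : 2 * (2 ^ m - 1) ≤ m * 2 ^ m := by
  rcases hm.eq_or_lt with rfl | hm
  · norm_num
  · calc 2 * (2 ^ m - 1) ≤ 2 * 2 ^ m := Nat.mul_le_mul_left _ (Nat.sub_le _ _)
      _ ≤ m * 2 ^ m := Nat.mul_le_mul_right _ hm

theorem cellBound_le {M σ a b c : ℕ} (hM : 1 ≤ M) (hσ : 1 ≤ σ) :
    (1 + a * M) * (1 + σ * (2 * c + 2)) * (1 + b) ≤
      3 * (M * σ) * ((1 + a) * (1 + b) * (1 + c)) := by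
  have h1 : 1 + a * M ≤ (1 + a) * M := by nlinarith
  have h2 : 1 + σ * (2 * c + 2) ≤ 3 * σ * (1 + c) := by nlinarith [Nat.zero_le (σ * c)]
  calc (1 + a * M) * (1 + σ * (2 * c + 2)) * (1 + b)
      ≤ ((1 + a) * M) * (3 * σ * (1 + c)) * (1 + b) := by gcongr
    _ = _ := by ring

theorem twentySeven_mul_le (x y z : ℕ) : 27 * (x * y * z) ≤ (x + y + z) ^ 3 := by
  zify
  have hx : (0 : ℤ) ≤ x := by positivity
  have hy : (0 : ℤ) ≤ y := by positivity
  have hz : (0 : ℤ) ≤ z := by positivity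
  nlinarith [mul_nonneg hx (sq_nonneg ((y : ℤ) - z)), mul_nonneg hy (sq_nonneg ((x : ℤ) - z)),
    mul_nonneg hz (sq_nonneg ((x : ℤ) - y)), mul_nonneg hx (sq_nonneg ((x : ℤ) - y)),
    mul_nonneg hx (sq_nonneg ((x : ℤ) - z)), mul_nonneg hy (sq_nonneg ((x : ℤ) - y)),
    mul_nonneg hy (sq_nonneg ((y : ℤ) - z)), mul_nonneg hz (sq_nonneg ((x : ℤ) - z)),
    mul_nonneg hz (sq_nonneg ((y : ℤ) - z))]

/-- This estimate goes into an exponent, where no constant factor may be lost. So the product is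
bounded through the sum `(1 + a) + (1 + b) + (1 + c) ≤ 2 * H + 1` rather than factor by factor. The
summand `H` on the left later pays for the number of rounds. -/
theorem cellBound_add_le {m σ H a b c : ℕ} (hm : 1 ≤ m) (hσ : 1 ≤ σ) (h : a + b + c + 2 ≤ 2 * H) :
    (1 + a * (2 ^ m - 1)) * (1 + σ * (2 * c + 2)) * (1 + b) + H ≤
      H ^ 3 * m * 2 ^ m * σ + 2 := by
  have hM := one_le_two_pow_sub_one hm
  have hMm := two_mul_two_pow_sub_one_le hm
  set M := 2 ^ m - 1
  have hX : 2 * (M * σ) * H ^ 3 ≤ H ^ 3 * m * 2 ^ m * σ := by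
    calc 2 * (M * σ) * H ^ 3 = (2 * M) * (σ * H ^ 3) := by ring
      _ ≤ (m * 2 ^ m) * (σ * H ^ 3) := Nat.mul_le_mul_right _ hMm
      _ = _ := by ring
  have hP : 1 ≤ M * σ := Nat.mul_pos hM hσ
  rcases (show H = 1 ∨ 2 ≤ H by omega) with rfl | hH
  · obtain ⟨rfl, rfl, rfl⟩ : a = 0 ∧ b = 0 ∧ c = 0 := by omega
    have : σ ≤ M * σ := Nat.le_mul_of_pos_left _ hM
    omega
  · have h1 := cellBound_le (a := a) (b := b) (c := c) hM hσ
    have h2 := twentySeven_mul_le (1 + a) (1 + b) (1 + c)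
    have h3 : (1 + a + (1 + b) + (1 + c)) ^ 3 ≤ (2 * H + 1) ^ 3 :=
      Nat.pow_le_pow_left (by omega) 3
    have h4 : (2 * H + 1) ^ 3 + 9 * H ≤ 18 * H ^ 3 + 18 := by
      obtain ⟨k, rfl⟩ := Nat.exists_eq_add_of_le hH
      ring_nf
      nlinarith [Nat.zero_le k]
    generalize (1 + a) * (1 + b) * (1 + c) = q at *
    generalize M * σ = P at *
    have h5 : P * (27 * q) + P * (9 * H) ≤ P * (18 * H ^ 3 + 18) := by
      rw [← Nat.mul_add]
      exact Nat.mul_le_mul_left _ (by omega)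
    have h6 : 1 * (H - 2) ≤ P * (H - 2) := Nat.mul_le_mul_right _ hP
    obtain ⟨k, rfl⟩ := Nat.exists_eq_add_of_le hH
    simp only [Nat.add_sub_cancel_left] at h6
    nlinarith

/-- Outside the exponent a constant is harmless, and the crude bound `2 * H` for each of the three
factors gives `24 = 3 * 2 ^ 3`. -/
theorem cellBound_le_mul {m σ H a b c : ℕ} (hm : 1 ≤ m) (hσ : 1 ≤ σ)
    (h : a + b + c + 1 ≤ 2 * H) :
    (1 + a * (2 ^ m - 1)) * (1 + σ * (2 * c + 2)) * (1 + b) ≤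
      24 * (H ^ 3 * m * 2 ^ m * σ) := by
  have hM := one_le_two_pow_sub_one hm
  have hMm := two_mul_two_pow_sub_one_le hm
  set M := 2 ^ m - 1
  calc (1 + a * M) * (1 + σ * (2 * c + 2)) * (1 + b)
      ≤ 3 * (M * σ) * ((1 + a) * (1 + b) * (1 + c)) := cellBound_le hM hσ
    _ ≤ 3 * ((m * 2 ^ m) * σ) * ((2 * H) * (2 * H) * (2 * H)) := by
        gcongr <;> omega
    _ = _ := by ring

theorem two_mul_le_two_pow (H : ℕ) : 2 * H ≤ 2 ^ H + 1 := by
  induction H with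
  | zero => norm_num
  | succ n ih =>
      rcases Nat.eq_zero_or_pos n with rfl | hn
      · norm_num
      · have : 2 ^ 1 ≤ 2 ^ n := Nat.pow_le_pow_right (by norm_num) hn
        rw [pow_succ]
        omega

end Arithmetic

theorem IsSized.ncard_cells_add_le {α : Type u} [Fintype α] [Nonempty α] {m i K H : ℕ}
    {S E : Set (TimedWord α)} (h : IsSized m i K S E) (hS : S.Finite) (hm : 1 ≤ m)
    (hi : i + 2 ≤ 2 * H) :
    (cells K S E).ncard + H ≤ H ^ 3 * m * 2 ^ m * Fintype.card α + 2 := by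
  obtain ⟨a, b, c, habc, hSa, hEb, hKc⟩ := h
  refine le_trans ?_ (cellBound_add_le (a := a) (b := b) (c := c) hm Fintype.card_pos (by omega))
  refine Nat.add_le_add_right ((ncard_cells_le K hS).trans ?_) _
  gcongr

theorem IsSized.ncard_cells_le {α : Type u} [Fintype α] [Nonempty α] {m i K H : ℕ}
    {S E : Set (TimedWord α)} (h : IsSized m i K S E) (hS : S.Finite) (hm : 1 ≤ m)
    (hi : i + 1 ≤ 2 * H) :
    (cells K S E).ncard ≤ 24 * (H ^ 3 * m * 2 ^ m * Fintype.card α) := by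
  obtain ⟨a, b, c, habc, hSa, hEb, hKc⟩ := h
  refine le_trans ?_ (cellBound_le_mul (a := a) (b := b) (c := c) hm Fintype.card_pos (by omega))
  refine (_root_.ncard_cells_le K hS).trans ?_
  gcongr

/-! ### The invariant of the algorithm -/

namespace ObsTable

variable {α : Type u} [Finite α] {T : ObsTable α} {L : Set (TimedWord α)}

/-- A syntactic table that is in time in round `i`. -/
def OnTrack (L : Set (TimedWord α)) (i : ℕ) (T : ObsTable α) : Prop :=
  T.IsSyntactic L ∧ (i + 2 ≤ 2 * T.level L ∨ (i + 1 ≤ 2 * T.level L ∧ ¬ T.Ready))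

theorem OnTrack.depth_le {i : ℕ} (h : T.OnTrack L i) (hL : IsDTARecognizable L) :
    i + 2 ≤ 2 * (minConst L + synIndex L) := by
  obtain ⟨hT, h | ⟨h, hready⟩⟩ := h
  · have := hT.level_le hL
    omega
  -- An applicable action yields a syntactic table of larger level, so the level of `T` itself is at
  -- most `H - 1`.
  · obtain ⟨K', S', E', hact⟩ := exists_action hready
    obtain ⟨T', -, hT', hlev⟩ := hT.exists_copy_of_action hL hact
    have := hT'.level_le hL
    omega

/-- The gain of one level is worth two rounds, so the spare round is restored even if a
counterexample has used it up. -/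
theorem OnTrack.action {i : ℕ} (h : T.OnTrack L i) (hL : IsDTARecognizable L) {K' : ℕ}
    {S' E' : Set (TimedWord α)} (hact : T.Action K' S' E') :
    ∃ T' ∈ T.copies L K' S' E', T'.OnTrack L (i + 1) := by
  obtain ⟨T', hmem, hT', hlev⟩ := h.1.exists_copy_of_action hL hact
  refine ⟨T', hmem, hT', Or.inl ?_⟩
  rcases h.2 with h | ⟨h, -⟩ <;> omega

/-- A ready table still has its spare round, and the counterexample spends it. The new table is not
ready, so no second counterexample can come before an action. -/
theorem OnTrack.refine {i : ℕ} (h : T.OnTrack L i) (hL : IsDTARecognizable L) (hready : T.Ready)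
    {w : TimedWord α} (hw : ¬ (w ∈ T.conj.lang ↔ w ∈ L)) :
    ∃ T' ∈ T.copies L T.K (T.refineRows w) T.E, T'.OnTrack L (i + 1) := by
  obtain ⟨T', hmem, hT', hlev, hready'⟩ := h.1.exists_copy_of_counterexample hL hready hw
  refine ⟨T', hmem, hT', Or.inr ⟨?_, hready'⟩⟩
  have := h.2.resolve_right fun h' => h'.2 hready
  omega

end ObsTable

namespace LearnState

variable {α : Type u} {L : Set (TimedWord α)}

/-- The quantitative part of the invariant in round `i`, for counterexamples of length at most
`m`, with `D` and `D'` bounding the numbers of cells in the current and the next round. -/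
structure Counted (m i D D' : ℕ) (st : LearnState α) : Prop where
  sized_pool : ∀ T ∈ st.pool, IsSized m i T.K T.S T.E
  sized_next : ∀ T ∈ st.next, IsSized m (i + 1) T.K T.S T.E
  weight_le : ObsTable.poolWeight st.pool + ObsTable.poolWeight st.next ≤ 1
  processed_le : (st.processed : ℝ≥0∞) * 2⁻¹ ^ D + ObsTable.poolWeight st.pool ≤ i + 1
  queries_le : st.queries ≤ ((st.processed + 1) * D' : ℕ)

/-- The bound `H³m2ᵐ|Σ|`. -/
noncomputable def sizeBound [Fintype α] (L : Set (TimedWord α)) (m : ℕ) : ℕ :=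
  (minConst L + synIndex L) ^ 3 * m * 2 ^ m * Fintype.card α

/-- The invariant of the algorithm in round `i`. -/
structure Invariant [Fintype α] (L : Set (TimedWord α)) (i : ℕ) (st : LearnState α) : Prop where
  filled_pool : ∀ T ∈ st.pool, T.Filled L
  filled_next : ∀ T ∈ st.next, T.Filled L
  finite_pool : st.pool.Finite
  finite_next : st.next.Finite
  onTrack : st.result = none →
    (∃ T ∈ st.pool, T.OnTrack L i) ∨ ∃ T ∈ st.next, T.OnTrack L (i + 1)
  depth_le : i + 2 ≤ 2 * (minConst L + synIndex L)
  result_eq : ∀ A, st.result = some A →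
    ∃ T : ObsTable α, T.Ready ∧ T.Filled L ∧ A = T.conj ∧ T.conj.lang = L
  counted : ∀ m, 1 ≤ m → st.longest ≤ m →
    st.Counted m i (sizeBound L m + 2 - (minConst L + synIndex L)) (24 * sizeBound L m)

theorem mem_copies_filled {T T' : ObsTable α} {K' : ℕ} {S' E' : Set (TimedWord α)}
    (h : T' ∈ T.copies L K' S' E') : T'.Filled L := h.2.2.2.1

/-- Processing a table that is replaced by its copies. -/
theorem Counted.replace {m i D D' : ℕ} {st : LearnState α} (h : st.Counted m i D D')
    {T : ObsTable α} (hT : T ∈ st.pool) (hD : (cells T.K T.S T.E).ncard ≤ D)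
    {P : Set (ObsTable α)} (hP : ∀ T' ∈ P, IsSized m (i + 1) T'.K T'.S T'.E)
    (hPw : ObsTable.poolWeight P ≤ T.weight) {N : Set (TimedWord α × TimedWord α)}
    (hN : N.encard ≤ D') (k : ℕ) (res : Option (OneTA α)) :
    Counted m i D D' ⟨st.pool \ {T}, st.next ∪ P, st.processed + 1, st.queries + N.encard, k, res⟩ := by
  have hw := ObsTable.poolWeight_eq_add_diff hT
  have hD' : (2⁻¹ : ℝ≥0∞) ^ D ≤ T.weight :=
    pow_le_pow_right_of_le_one' (ENNReal.inv_le_one.2 (by norm_num)) hD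
  refine ⟨fun T' hT' => h.sized_pool T' hT'.1, ?_, ?_, ?_, ?_⟩
  · rintro T' (hT' | hT')
    · exact h.sized_next T' hT'
    · exact hP T' hT'
  · refine le_trans ?_ h.weight_le
    calc ObsTable.poolWeight (st.pool \ {T}) + ObsTable.poolWeight (st.next ∪ P)
        ≤ ObsTable.poolWeight (st.pool \ {T}) + (ObsTable.poolWeight st.next + T.weight) := by
          gcongr
          exact (ObsTable.poolWeight_union_le _ _).trans (by gcongr)
      _ = (T.weight + ObsTable.poolWeight (st.pool \ {T})) + ObsTable.poolWeight st.next := by ring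
      _ = _ := by rw [hw]
  -- The table leaves the pool, and its weight, at least `2⁻¹ ^ D`, pays for the increment of the
  -- counter.
  · refine le_trans ?_ h.processed_le
    simp only
    rw [hw]
    push_cast
    calc ((st.processed : ℝ≥0∞) + 1) * 2⁻¹ ^ D + ObsTable.poolWeight (st.pool \ {T})
        = st.processed * 2⁻¹ ^ D + (2⁻¹ ^ D + ObsTable.poolWeight (st.pool \ {T})) := by ring
      _ ≤ _ := by gcongr
  · have := add_le_add h.queries_le hN
    refine this.trans (le_of_eq ?_)
    simp only
    norm_cast
    ring

/-- The next pool weighs at most 1, so each round adds at most 1 to the weight budget for processed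
tables. -/
theorem Counted.advance {m i D D' : ℕ} {st : LearnState α} (h : st.Counted m i D D')
    (res : Option (OneTA α)) :
    Counted m (i + 1) D D' ⟨st.next, ∅, st.processed, st.queries, st.longest, res⟩ := by
  refine ⟨h.sized_next, fun T hT => absurd hT (Set.notMem_empty T), ?_, ?_, h.queries_le⟩
  · simp only [ObsTable.poolWeight_empty, add_zero]
    exact le_trans le_add_self h.weight_le
  · have h1 := le_trans le_self_add h.processed_le
    have h2 := le_trans le_add_self h.weight_le
    simp only
    push_cast
    exact add_le_add h1 h2

variable [Fintype α]

theorem minConst_add_synIndex_pos (hL : IsDTARecognizable L) : 1 ≤ minConst L + synIndex L := by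
  have := hL.finite_synSetoid
  have : Nonempty (Quotient (synSetoid L)) := ⟨Quotient.mk _ ⟨[], isHIWord_nil⟩⟩
  have : 0 < synIndex L := Nat.card_pos
  omega

theorem exists_step {st : LearnState α} (hres : st.result = none) :
    ∃ st', LearnStep L st st' := by
  rcases st.pool.eq_empty_or_nonempty with hpool | ⟨T, hT⟩
  · exact ⟨_, .advance st hres hpool⟩
  · by_cases hready : T.Ready
    · by_cases hTL : T.conj.lang = L
      · exact ⟨_, .confirm st hres T hT hready hTL⟩
      · obtain ⟨w, hw⟩ := not_forall.1 fun h => hTL (Set.ext h)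
        exact ⟨_, .refute st hres T hT hready w hw⟩
    · obtain ⟨K', S', E', hact⟩ := ObsTable.exists_action hready
      exact ⟨_, .act st hres T hT hready K' S' E' hact⟩

variable [Nonempty α]

theorem invariant_initial (hL : IsDTARecognizable L) : Invariant L 0 (LearnState.initial L) := by
  have hfin : (cells (α := α) 0 {[]} {[]}).Finite :=
    finite_cells 0 (Set.finite_singleton _) (Set.finite_singleton _)
  have hpool := ObsTable.ncard_le_of_filled (P := (LearnState.initial L).pool) (B := ∅) hfin
    (fun T hT => hT) (fun _ _ _ _ _ _ h => absurd h (Set.notMem_empty _))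
  refine ⟨fun T hT => hT.2.2.2, fun T hT => absurd hT (Set.notMem_empty T), hpool.1,
    Set.finite_empty, fun _ => Or.inl ?_, ?_, fun A h => (by cases h), fun m hm _ => ?_⟩
  · obtain ⟨T, hK, hS, hE, hT⟩ := ObsTable.exists_isSyntactic
      hL.isStrictResetFunction_synReset (Nat.zero_le _) IsTableShape.trivial
    refine ⟨T, ⟨hK, hS, hE, hT.filled hL.isStrictResetFunction_synReset⟩, hT, Or.inl ?_⟩
    have := rowCount_pos (L := L) T.isTableShape
    rw [ObsTable.level]
    omega
  · have := minConst_add_synIndex_pos hL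
    omega
  · have hw : ObsTable.poolWeight (LearnState.initial L).pool ≤ 1 := by
      have := ObsTable.poolWeight_le_of_filled (P := (LearnState.initial L).pool) (B := ∅) hfin
        (Set.empty_subset _) (fun T hT => hT) (fun _ _ _ _ _ _ h => absurd h (Set.notMem_empty _))
      simpa using this
    refine ⟨?_, fun T hT => absurd hT (Set.notMem_empty T), ?_, ?_, ?_⟩
    · rintro T ⟨hK, hS, hE, -⟩
      rw [hK, hS, hE]
      exact isSized_trivial m
    · show ObsTable.poolWeight (LearnState.initial L).pool + ObsTable.poolWeight ∅ ≤ 1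
      rwa [ObsTable.poolWeight_empty, add_zero]
    · show ((0 : ℕ) : ℝ≥0∞) * _ + ObsTable.poolWeight (LearnState.initial L).pool ≤ (0 : ℕ) + 1
      simpa using hw
    · show (cells (α := α) 0 {[]} {[]}).encard ≤ ((0 + 1) * (24 * sizeBound L m) : ℕ)
      rw [zero_add, one_mul, ← hfin.cast_ncard_eq]
      have := minConst_add_synIndex_pos hL
      exact_mod_cast (isSized_trivial (α := α) m).ncard_cells_le (H := minConst L + synIndex L)
        (Set.finite_singleton _) hm (by omega)

/-- The common part of the steps that replace a table by its copies. -/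
theorem Invariant.replace {i : ℕ} {st : LearnState α} (h : Invariant L i st)
    {T : ObsTable α} (hT : T ∈ st.pool) {K' : ℕ} {S' E' : Set (TimedWord α)}
    (hshape : IsTableShape S' E') (hK : T.K ≤ K') (hS : T.S ⊆ S') (hE : T.E ⊆ E') {k : ℕ}
    (hk : st.longest ≤ k)
    (hsized : ∀ m, 1 ≤ m → k ≤ m → IsSized m i T.K T.S T.E → IsSized m (i + 1) K' S' E')
    (htrack : T.OnTrack L i → ∃ T' ∈ T.copies L K' S' E', T'.OnTrack L (i + 1))
    (hres : st.result = none) :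
    Invariant L i ⟨st.pool \ {T}, st.next ∪ T.copies L K' S' E', st.processed + 1,
      st.queries + (T.newCells K' S' E').encard, k, none⟩ := by
  refine ⟨fun T' hT' => h.filled_pool T' hT'.1, ?_, h.finite_pool.subset Set.sdiff_subset,
    h.finite_next.union (T.copies_finite L hshape), ?_, h.depth_le, fun A hA => (by cases hA), ?_⟩
  · rintro T' (hT' | hT')
    · exact h.filled_next T' hT'
    · exact mem_copies_filled hT'
  · intro _
    rcases h.onTrack hres with ⟨T', hT', htr⟩ | ⟨T', hT', htr⟩
    · by_cases hTT : T' = T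
      · subst hTT
        obtain ⟨T'', hT'', htr''⟩ := htrack htr
        exact Or.inr ⟨T'', Or.inr hT'', htr''⟩
      · exact Or.inl ⟨T', ⟨hT', hTT⟩, htr⟩
    · exact Or.inr ⟨T', Or.inl hT', htr⟩
  -- The bounds are maintained for every `m` not below the counterexamples received so far, so a
  -- longer counterexample only restricts the range of `m`.
  · intro m hm hkm
    have hc := h.counted m hm (hk.trans hkm)
    have hs := hc.sized_pool T hT
    have hs' := hsized m hm hkm hs
    have h1 := hs.ncard_cells_add_le T.finite_S hm h.depth_le
    have h2 := hs'.ncard_cells_le (H := minConst L + synIndex L) hshape.finite_S hm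
      (by have := h.depth_le; omega)
    have hfin := finite_cells K' hshape.finite_S hshape.finite_E
    refine hc.replace hT ?_ ?_ (T.poolWeight_copies_le L hshape hK hS hE) ?_ k none
    · rw [sizeBound]
      omega
    · rintro T' ⟨hK', hS', hE', -⟩
      rwa [hK', hS', hE']
    · rw [ObsTable.newCells, ← (hfin.subset Set.sdiff_subset).cast_ncard_eq]
      exact_mod_cast (Set.ncard_le_ncard Set.sdiff_subset hfin).trans h2

/-- Every step stays in the round and shrinks the pool, or goes on to the next round. -/
theorem Invariant.step (hL : IsDTARecognizable L) {i : ℕ} {st st' : LearnState α}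
    (h : Invariant L i st) (hstep : LearnStep L st st') :
    (Invariant L i st' ∧ st'.pool.ncard < st.pool.ncard) ∨ Invariant L (i + 1) st' := by
  have hlt : ∀ {T}, T ∈ st.pool → (st.pool \ {T}).ncard < st.pool.ncard :=
    fun hT => Set.ncard_sdiff_singleton_lt_of_mem hT h.finite_pool
  cases hstep with
  | act hres T hT hready K' S' E' haction =>
      obtain ⟨hK, hS, hE⟩ := haction.mono
      exact Or.inl ⟨h.replace hT haction.isTableShape hK hS hE le_rfl
        (fun m hm _ => haction.isSized hm) (fun htr => htr.action hL haction) hres, hlt hT⟩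
  | refute hres T hT hready w hw =>
      exact Or.inl ⟨h.replace hT (T.isTableShape_refineRows w) le_rfl Set.subset_union_left
        subset_rfl (le_max_left _ _)
        (fun m hm hk => ObsTable.isSized_refineRows ((le_max_right _ _).trans hk))
        (fun htr => htr.refine hL hready hw) hres, hlt hT⟩
  | confirm hres T hT hready hTL =>
      refine Or.inl ⟨⟨fun T' hT' => h.filled_pool T' hT'.1, h.filled_next,
        h.finite_pool.subset Set.sdiff_subset, h.finite_next, fun hA => (by cases hA), h.depth_le,
        ?_, ?_⟩, hlt hT⟩
      · rintro A hA
        cases hA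
        exact ⟨T, hready, h.filled_pool T hT, rfl, hTL⟩
      · intro m hm hkm
        have hc := h.counted m hm hkm
        have h1 := (hc.sized_pool T hT).ncard_cells_add_le T.finite_S hm h.depth_le
        have := hc.replace hT (by rw [sizeBound]; omega) (P := ∅)
          (fun T' hT' => absurd hT' (Set.notMem_empty T')) (by simp [ObsTable.poolWeight_empty])
          (N := ∅) (by simp) st.longest (some T.conj)
        simpa using this
  | advance hres hpool =>
      have htrack : ∃ T ∈ st.next, T.OnTrack L (i + 1) := by
        rcases h.onTrack hres with ⟨T, hT, -⟩ | h'
        · rw [hpool] at hT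
          exact absurd hT (Set.notMem_empty T)
        · exact h'
      refine Or.inr ⟨h.filled_next, fun T hT => absurd hT (Set.notMem_empty T), h.finite_next,
        Set.finite_empty, fun _ => Or.inl htrack, ?_, h.result_eq,
        fun m hm hkm => (h.counted m hm hkm).advance _⟩
      obtain ⟨T, -, hT⟩ := htrack
      exact hT.depth_le hL

theorem Invariant.of_reflTransGen (hL : IsDTARecognizable L) {st : LearnState α}
    (h : Relation.ReflTransGen (LearnStep L) (LearnState.initial L) st) :
    ∃ i, Invariant L i st := by
  induction h with
  | refl => exact ⟨0, invariant_initial hL⟩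
  | tail _ hstep ih =>
      obtain ⟨i, hi⟩ := ih
      rcases hi.step hL hstep with ⟨h, -⟩ | h
      · exact ⟨i, h⟩
      · exact ⟨i + 1, h⟩

/-- Lexicographic descent: `depth_le` bounds the round index, and within a round the finite pool
shrinks with every step. -/
theorem Invariant.not_infinite (hL : IsDTARecognizable L) {i : ℕ} {st : ℕ → LearnState α}
    (h : Invariant L i (st 0)) : ¬ ∀ j, LearnStep L (st j) (st (j + 1)) := by
  obtain ⟨k, hk⟩ : ∃ k, k = 2 * (minConst L + synIndex L) - i := ⟨_, rfl⟩
  induction k using Nat.strong_induction_on generalizing i st with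
  | _ k ihk =>
    obtain ⟨c, hc⟩ : ∃ c, c = (st 0).pool.ncard := ⟨_, rfl⟩
    induction c using Nat.strong_induction_on generalizing st with
    | _ c ihc =>
      intro hst
      have hst' : ∀ j, LearnStep L (st (j + 1)) (st (j + 1 + 1)) := fun j => hst (j + 1)
      rcases h.step hL (hst 0) with ⟨h', hlt⟩ | h'
      · exact ihc _ (by rw [hc]; exact hlt) (st := fun j => st (j + 1)) h' rfl hst'
      · have := h'.depth_le
        exact ihk _ (by omega) (st := fun j => st (j + 1)) h' rfl hst'

theorem Invariant.processed_le (hL : IsDTARecognizable L) {i : ℕ} {st : LearnState α}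
    (h : Invariant L i st) {m : ℕ} (hm : 1 ≤ m) (hk : st.longest ≤ m) :
    st.processed ≤ 4 * 2 ^ sizeBound L m := by
  have h1 := le_trans le_self_add (h.counted m hm hk).processed_le
  set H := minConst L + synIndex L with hH
  set D := sizeBound L m + 2 - H with hD
  have h2 : (st.processed : ℝ≥0∞) ≤ (i + 1) * 2 ^ D := by
    calc (st.processed : ℝ≥0∞) = st.processed * 2⁻¹ ^ D * 2 ^ D := by
          rw [mul_assoc, ← mul_pow, ENNReal.inv_mul_cancel (by norm_num) (by norm_num), one_pow,
            mul_one]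
      _ ≤ _ := by gcongr
  have h3 : st.processed ≤ (i + 1) * 2 ^ D := by exact_mod_cast h2
  have h4 : i + 1 ≤ 2 ^ H := by
    have := two_mul_le_two_pow H
    have := h.depth_le
    omega
  have h5 : H ≤ sizeBound L m + 2 := by
    have h0 := minConst_add_synIndex_pos hL
    have := (isSized_trivial (α := α) m).ncard_cells_add_le (H := H) (Set.finite_singleton _) hm
      (by omega)
    rw [sizeBound, ← hH]
    omega
  calc st.processed ≤ (i + 1) * 2 ^ D := h3
    _ ≤ 2 ^ H * 2 ^ D := Nat.mul_le_mul_right _ h4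
    -- There are at most `2 ^ H` rounds, and this factor cancels the `- H` in `D`.
    _ = 2 ^ (sizeBound L m + 2) := by rw [← pow_add, hD, Nat.add_sub_cancel' h5]
    _ = _ := by rw [pow_add]; ring

/-- The initial pool and each processed table account for at most `24 * sizeBound L m` queries, and
`processed + 1` is at most `5 * 2 ^ sizeBound L m`; hence `120 = 5 * 24`. -/
theorem Invariant.queries_le (hL : IsDTARecognizable L) {i : ℕ} {st : LearnState α}
    (h : Invariant L i st) {m : ℕ} (hm : 1 ≤ m) (hk : st.longest ≤ m) :
    st.queries ≤ ((120 * (2 ^ sizeBound L m * sizeBound L m) : ℕ) : ℕ∞) := by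
  refine (h.counted m hm hk).queries_le.trans ?_
  have h1 := h.processed_le hL hm hk
  have h2 : 1 ≤ 2 ^ sizeBound L m := Nat.one_le_two_pow
  have h3 : (st.processed + 1) * (24 * sizeBound L m) ≤
      120 * (2 ^ sizeBound L m * sizeBound L m) := by
    calc (st.processed + 1) * (24 * sizeBound L m)
        ≤ (5 * 2 ^ sizeBound L m) * (24 * sizeBound L m) := Nat.mul_le_mul_right _ (by omega)
      _ = _ := by ring
  exact_mod_cast h3

end LearnState

theorem mainTheorem9 :
    ∃ C : ℕ, ∀ (α : Type u) [Fintype α] [Nonempty α] (L : Set (TimedWord α)),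
      IsDTARecognizable L →
      -- the algorithm terminates: there is no infinite execution
      (¬ ∃ st : ℕ → LearnState α,
        st 0 = LearnState.initial L ∧ ∀ i, LearnStep L (st i) (st (i + 1))) ∧
      -- every execution that cannot be continued has returned an automaton as claimed
      ∀ st : LearnState α,
        Relation.ReflTransGen (LearnStep L) (LearnState.initial L) st →
        (∀ st', ¬ LearnStep L st st') →
        (∃ (A : OneTA α) (K : ℕ), st.result = some A ∧
          A.IsStrictAcceptor K ∧ A.lang = L ∧ minConst L ≤ K ∧
          ∀ w θs q ν, A.Run A.init 0 w θs q ν → ν ≤ (K : ℝ≥0) ∧ ¬ IsPosInt ν) ∧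
        (∀ H m : ℕ, H = minConst L + synIndex L → m = max 1 st.longest →
          st.processed ≤ C * (2 ^ (H ^ 3 * m * 2 ^ m * Fintype.card α) * H) ∧
          st.queries ≤ ((C * (2 ^ (H ^ 3 * m * 2 ^ m * Fintype.card α) *
            (H ^ 3 * m * 2 ^ m * Fintype.card α)) : ℕ) : ℕ∞)) := by
  -- The constant comes from the queries. For the processed tables 4 would do, and the factor `H`
  -- enters only through `1 ≤ H`.
  refine ⟨120, fun α _ _ L hL => ⟨?_, ?_⟩⟩
  · rintro ⟨st, h0, hst⟩
    have h := LearnState.invariant_initial hL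
    rw [← h0] at h
    exact h.not_infinite hL hst
  · intro st hreach hstuck
    obtain ⟨i, h⟩ := LearnState.Invariant.of_reflTransGen hL hreach
    refine ⟨?_, ?_⟩
    · cases hres : st.result with
      | none =>
          obtain ⟨st', hst'⟩ := LearnState.exists_step (L := L) hres
          exact absurd hst' (hstuck st')
      | some A =>
          obtain ⟨T, hready, hF, rfl, hTL⟩ := h.result_eq A hres
          have hA := hready.isStrictAcceptor_conj hF
          exact ⟨T.conj, T.K, rfl, hA, hTL, Nat.sInf_le ⟨T.conj, hA.det, hA.maxConst_eq, hTL⟩,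
            fun w θs q ν hrun => hready.run_conj_le hF hrun⟩
    · rintro H m rfl rfl
      refine ⟨?_, h.queries_le hL (le_max_left _ _) (le_max_right _ _)⟩
      refine (h.processed_le hL (le_max_left 1 st.longest) (le_max_right _ _)).trans ?_
      have h1 := LearnState.minConst_add_synIndex_pos hL
      rw [LearnState.sizeBound]
      generalize 2 ^ _ = x
      nlinarith [Nat.mul_le_mul_left x h1]
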